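/- Let $k$ be an algebraically closed field and let $A=\bigoplus_{i\ge 0}A^i$ be a separably augmented $k$-algebra, that is, an $\mathbb N$-graded $k$-algebra whose degree-zero part $R=A^0$ is a separable $k$-algebra (there is $p=\sum x_i\otimes y_i\in R\otimes_k R$ with $ap=pa$ for all $a\in R$ and $\sum x_iy_i=1$). Regard $R=A/A^+$, with $A^+=\bigoplus_{i>0}A^i$, as a left and as a right $A$-module, and let $\operatorname{Tor}^A_m(R,R)$ denote the graded $R$-$R$-bimodule $H_m(R\otimes_A Q_\bullet)$, where $Q_\bullet\to R$ is any resolution of $R$ by graded $A$-$R$-bimodules that are projective as $A\otimes_k R^{op}$-modules; such resolutions exist, and the statements below hold for each of them. Put $A^e=A\otimes_k A^{op}$. A resolution $P_\bullet\to A$ by graded projective $A^e$-modules (all maps homogeneous of degree $0$) is called minimal if $d(P_{m+1})\subseteq (A^e)^+P_m$ for all $m\ge 0$, where $(A^e)^+$ is the part of positive degree. (1) The graded $A^e$-module $A$ has a minimal resolution, and for every minimal resolution $P_\bullet\to A$ and every $m\ge 0$ there is an isomorphism of graded $A^e$-modules $$P_m\;\cong\;A\otimes_R\operatorname{Tor}^A_m(R,R)\otimes_R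 A .$$ (2) Let $V$ be a graded $R$-$R$-bimodule (with $k$ acting centrally) concentrated in positive degrees, let $T(V)=R\oplus V\oplus (V\otimes_R V)\oplus\cdots$ be its tensor algebra over $R$ with the grading induced by that of $V$, and let $J\subset T(V)$ be the two-sided ideal generated by $V$. Let $T(V)\to A$ be a surjective homomorphism of graded $k$-algebras that is the identity on $R$, let $I$ be its kernel, and assume that $J^n\subseteq I\subseteq J^2$ for some $n\ge 2$. Then there are isomorphisms of graded $R$-$R$-bimodules $$\operatorname{Tor}^A_{2p}(R,R)\cong\frac{I^p\cap JI^{p-1}J}{JI^p+I^pJ}\quad(p\ge 1),\qquad \operatorname{Tor}^A_{2p+1}(R,R)\cong\frac{JI^p\cap I^pJ}{I^{p+1}+JI^pJ}\quad(p\ge 0),$$ where $I^0=T(V)$, the grading on the left is induced by that of $A$, and the grading on the right is induced by that of $T(V)$. -/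

import Mathlib

open scoped TensorProduct DirectSum
open MulOpposite

universe u v w w₁ w₂ w₃

noncomputable section

/-! ### Internal `ℤ`-gradings of `k`-modules -/

section Components

variable {k : Type u} [CommRing k] {X : Type w} [AddCommGroup X] [Module k X]

/-- The map `x ↦ (xᵢ)ᵢ` sending an element of a graded module to its homogeneous components. -/
def components {ℳ : ℤ → Submodule k X} (h : DirectSum.IsInternal ℳ) : X →ₗ[k] (ℤ →₀ X) :=
  (DirectSum.toModule k ℤ (ℤ →₀ X) fun i => (Finsupp.lsingle i) ∘ₗ (ℳ i).subtype) ∘ₗ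
    (LinearEquiv.ofBijective (DirectSum.coeLinearMap ℳ) h).symm.toLinearMap

theorem components_of_mem {ℳ : ℤ → Submodule k X} (h : DirectSum.IsInternal ℳ) {i : ℤ} {x : X}
    (hx : x ∈ ℳ i) : components h x = Finsupp.single i x := by
  have : (LinearEquiv.ofBijective (DirectSum.coeLinearMap ℳ) h).symm x
      = DirectSum.lof k ℤ (fun i => ℳ i) i ⟨x, hx⟩ := by
    rw [LinearEquiv.symm_apply_eq]
    exact (DirectSum.coeLinearMap_lof ℳ i ⟨x, hx⟩).symm
  rw [components, LinearMap.comp_apply, LinearEquiv.coe_coe, this, DirectSum.toModule_lof]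
  rfl

theorem mem_induction {ℳ : ℤ → Submodule k X} (h : ⨆ i, ℳ i = ⊤) {p : X → Prop}
    (hom : ∀ i, ∀ x ∈ ℳ i, p x) (zero : p 0) (add : ∀ x y, p x → p y → p (x + y)) (x : X) : p x :=
  Submodule.iSup_induction ℳ (motive := p) (h ▸ Submodule.mem_top : x ∈ ⨆ i, ℳ i) hom zero add

theorem components_mem {ℳ : ℤ → Submodule k X} (h : DirectSum.IsInternal ℳ) (x : X) (i : ℤ) :
    components h x i ∈ ℳ i := by
  induction x using mem_induction h.submodule_iSup_eq_top with
  | hom j x hx =>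
    rw [components_of_mem h hx]
    by_cases hij : i = j
    · subst hij; simpa using hx
    · rw [Finsupp.single_eq_of_ne hij]; exact zero_mem _
  | zero => simp
  | add x y hx hy => rw [map_add]; exact add_mem hx hy

theorem sum_components {ℳ : ℤ → Submodule k X} (h : DirectSum.IsInternal ℳ) (x : X) :
    (components h x).sum (fun _ y => y) = x := by
  induction x using mem_induction h.submodule_iSup_eq_top with
  | hom j x hx => rw [components_of_mem h hx]; simp
  | zero => simp
  | add x y hx hy =>
    rw [map_add, Finsupp.sum_add_index' (fun _ => rfl) (fun _ _ _ => rfl), hx, hy]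

theorem isInternal_of_components {Y : Type w₁} [AddCommGroup Y] [Module k Y]
    {ℳ : ℤ → Submodule k X} (htop : ⨆ i, ℳ i = ⊤) (j : X →ₗ[k] Y) (hj : Function.Injective j)
    (δ : X →ₗ[k] (ℤ →₀ Y)) (hδ : ∀ i, ∀ x ∈ ℳ i, δ x = Finsupp.single i (j x)) :
    DirectSum.IsInternal ℳ := by
  constructor
  · have key : ∀ f : ⨁ i, ℳ i, ∀ i, δ (DirectSum.coeLinearMap ℳ f) i = j (f i : X) := by
      intro f i
      induction f using DirectSum.induction_on with
      | zero => simp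
      | of l x =>
        have h2 : DirectSum.coeLinearMap ℳ (DirectSum.of (fun i => ℳ i) l x) = (x : X) :=
          DirectSum.coeLinearMap_of ℳ l x
        rw [h2, hδ l x x.2]
        by_cases hij : i = l
        · subst hij; simp
        · rw [Finsupp.single_eq_of_ne hij, DirectSum.of_eq_of_ne _ _ _ hij]; simp
      | add f g hf hg => simp [map_add, hf, hg]
    intro f g hfg
    refine DFinsupp.ext fun i => Subtype.ext (hj ?_)
    have hfg' : DirectSum.coeLinearMap ℳ f = DirectSum.coeLinearMap ℳ g := hfg
    rw [← key f i, ← key g i, hfg']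
  · have : LinearMap.range (DirectSum.coeLinearMap ℳ) = ⊤ := by
      rw [DirectSum.range_coeLinearMap, htop]
    exact LinearMap.range_eq_top.mp this

end Components

/-! ### Graded modules over graded algebras -/

section GrMod

variable {k : Type u} [CommRing k] {E : Type v} [Ring E] [Algebra k E]

/-- A `ℤ`-graded left module over the `k`-algebra `E` with grading `ℰ`. -/
structure GrMod (ℰ : ℤ → Submodule k E) where
  carrier : Type w
  [addCommGroup : AddCommGroup carrier]
  [kmodule : Module k carrier]
  [module : Module E carrier]
  [tower : IsScalarTower k E carrier]
  deg : ℤ → Submodule k carrier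
  internal : DirectSum.IsInternal deg
  smul_mem : ∀ {i j : ℤ} {e : E} {x : carrier}, e ∈ ℰ i → x ∈ deg j → e • x ∈ deg (i + j)

attribute [instance] GrMod.addCommGroup GrMod.kmodule GrMod.module GrMod.tower

variable {ℰ : ℤ → Submodule k E}

/-- The `E`-linear map `f` is homogeneous of degree `0`. -/
def GrMod.IsGrHom {M : GrMod.{u, v, w₁} ℰ} {N : GrMod.{u, v, w₂} ℰ}
    (f : M.carrier →ₗ[E] N.carrier) : Prop :=
  ∀ i, ∀ x ∈ M.deg i, f x ∈ N.deg i

/-- `M` and `N` are isomorphic as graded `E`-modules. -/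
def GrMod.Isomorphic (M : GrMod.{u, v, w₁} ℰ) (N : GrMod.{u, v, w₂} ℰ) : Prop :=
  ∃ e : M.carrier ≃ₗ[E] N.carrier, ∀ i x, e x ∈ N.deg i ↔ x ∈ M.deg i

namespace GrMod

variable (M : GrMod.{u, v, w} ℰ)

/-- A submodule is homogeneous if it contains the homogeneous components of its elements. -/
def IsHomogeneous (N : Submodule E M.carrier) : Prop :=
  ∀ x ∈ N, ∀ i, components M.internal x i ∈ N

theorem iSup_deg : ⨆ i, M.deg i = ⊤ := M.internal.submodule_iSup_eq_top

theorem components_smul {p : ℤ} {e : E} (he : e ∈ ℰ p) (x : M.carrier) (i : ℤ) :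
    components M.internal (e • x) i = e • components M.internal x (i - p) := by
  induction x using mem_induction M.iSup_deg with
  | hom j x hx =>
    rw [components_of_mem _ hx, components_of_mem _ (M.smul_mem he hx)]
    by_cases hij : i = p + j
    · subst hij; simp
    · rw [Finsupp.single_eq_of_ne hij, Finsupp.single_eq_of_ne (by omega), smul_zero]
  | zero => simp
  | add x y hx hy => simp only [smul_add, map_add, Finsupp.add_apply, hx, hy]

theorem isHomogeneous_span (hE : ⨆ i, ℰ i = ⊤) (s : Set M.carrier)
    (hs : ∀ x ∈ s, ∃ i, x ∈ M.deg i) : M.IsHomogeneous (Submodule.span E s) := by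
  intro x hx
  induction hx using Submodule.span_induction with
  | mem x hx =>
    intro i
    obtain ⟨j, hj⟩ := hs x hx
    rw [components_of_mem _ hj]
    by_cases hij : i = j
    · subst hij; simpa using Submodule.subset_span hx
    · rw [Finsupp.single_eq_of_ne hij]; exact zero_mem _
  | zero => intro i; simp
  | add x y _ _ hx hy => intro i; rw [map_add]; exact add_mem (hx i) (hy i)
  | smul e x _ hx =>
    induction e using mem_induction hE with
    | hom p e he => intro i; rw [components_smul M he]; exact Submodule.smul_mem _ _ (hx _)
    | zero => intro i; simp
    | add e f he hf => intro i; rw [add_smul, map_add]; exact add_mem (he i) (hf i)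

/-- A homogeneous submodule with the induced grading `(N ∩ Mᵢ)ᵢ`. -/
def sub (N : Submodule E M.carrier) (hN : M.IsHomogeneous N) : GrMod.{u, v, w} ℰ where
  carrier := N
  deg i := (M.deg i).comap (N.subtype.restrictScalars k)
  internal := by
    refine isInternal_of_components ?_ (N.subtype.restrictScalars k) N.injective_subtype
      (components M.internal ∘ₗ N.subtype.restrictScalars k)
      (fun i x hx => components_of_mem M.internal hx)
    rw [eq_top_iff]
    intro x _
    have hx : x = (components M.internal (x : M.carrier)).sum
        (fun i _ => (⟨components M.internal (x : M.carrier) i, hN x x.2 i⟩ : N)) := by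
      apply Subtype.ext
      conv_lhs => rw [← sum_components M.internal (x : M.carrier)]
      simp [Finsupp.sum]
    rw [hx]
    exact Submodule.sum_mem _ fun i _ => Submodule.mem_iSup_of_mem i (components_mem M.internal _ i)
  smul_mem he hx := M.smul_mem he hx

/-- The quotient by a homogeneous submodule; its degree `i` part is the image of `Mᵢ`. -/
def quot (N : Submodule E M.carrier) (hN : M.IsHomogeneous N) : GrMod.{u, v, w} ℰ where
  carrier := M.carrier ⧸ N
  deg i := (M.deg i).map (N.mkQ.restrictScalars k)
  internal := by
    let q : M.carrier →ₗ[k] (M.carrier ⧸ N) := N.mkQ.restrictScalars k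
    have hq : Function.Surjective q := N.mkQ_surjective
    let δ₀ : M.carrier →ₗ[k] (ℤ →₀ (M.carrier ⧸ N)) :=
      Finsupp.mapRange.linearMap q ∘ₗ components M.internal
    have hker : LinearMap.ker q ≤ LinearMap.ker δ₀ := by
      intro x hx
      have hx' : x ∈ N := by simpa [q] using hx
      rw [LinearMap.mem_ker]
      ext i
      simpa [δ₀, q] using hN x hx' i
    let δ : (M.carrier ⧸ N) →ₗ[k] (ℤ →₀ (M.carrier ⧸ N)) :=
      ((LinearMap.ker q).liftQ δ₀ hker) ∘ₗ (q.quotKerEquivOfSurjective hq).symm.toLinearMap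
    have hδ : ∀ x, δ (q x) = δ₀ x := by
      intro x
      have : (q.quotKerEquivOfSurjective hq).symm (q x) = (LinearMap.ker q).mkQ x := by
        rw [LinearEquiv.symm_apply_eq]; rfl
      simp only [δ, LinearMap.comp_apply, LinearEquiv.coe_coe, this]
      rfl
    refine isInternal_of_components ?_ LinearMap.id (fun _ _ h => h) δ ?_
    · rw [← Submodule.map_iSup, M.iSup_deg, Submodule.map_top]
      exact LinearMap.range_eq_top.mpr hq
    · rintro i _ ⟨x, hx, rfl⟩
      refine (hδ x).trans ?_
      simp only [δ₀, LinearMap.comp_apply, components_of_mem M.internal hx]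
      simp [q]
  smul_mem := by
    rintro i j e _ he ⟨x, hx, rfl⟩
    exact ⟨e • x, M.smul_mem he hx, rfl⟩

/-- The inclusion of a homogeneous submodule. -/
def subIncl (N : Submodule E M.carrier) (hN : M.IsHomogeneous N) :
    (M.sub N hN).carrier →ₗ[E] M.carrier :=
  N.subtype

variable {M}

theorem map_components {N : GrMod.{u, v, w₂} ℰ} (f : M.carrier →ₗ[E] N.carrier)
    (hf : IsGrHom f) (x : M.carrier) (i : ℤ) :
    f (components M.internal x i) = components N.internal (f x) i := by
  induction x using mem_induction M.iSup_deg with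
  | hom j x hx =>
    rw [components_of_mem _ hx, components_of_mem _ (hf _ _ hx)]
    by_cases hij : i = j
    · subst hij; simp
    · rw [Finsupp.single_eq_of_ne hij, Finsupp.single_eq_of_ne hij, map_zero]
  | zero => simp
  | add x y hx hy => simp only [map_add, Finsupp.add_apply, hx, hy]

theorem isHomogeneous_comap {N : GrMod.{u, v, w₂} ℰ} (f : M.carrier →ₗ[E] N.carrier)
    (hf : IsGrHom f) {D : Submodule E N.carrier} (hD : N.IsHomogeneous D) :
    M.IsHomogeneous (D.comap f) := by
  intro x hx i
  rw [Submodule.mem_comap, map_components f hf]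
  exact hD _ hx i

variable (M) in
/-- The graded module `N / (D ∩ N)` for homogeneous submodules `N` and `D`. -/
def subquot (N D : Submodule E M.carrier) (hN : M.IsHomogeneous N) (hD : M.IsHomogeneous D) :
    GrMod.{u, v, w} ℰ :=
  (M.sub N hN).quot (D.comap (M.subIncl N hN))
    (isHomogeneous_comap (M.subIncl N hN) (fun _ _ hx => hx) hD)

theorem isHomogeneous_ker {N : GrMod.{u, v, w₂} ℰ} (f : M.carrier →ₗ[E] N.carrier)
    (hf : IsGrHom f) : M.IsHomogeneous (LinearMap.ker f) := by
  intro x hx i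
  rw [LinearMap.mem_ker] at hx ⊢
  rw [map_components f hf, hx, map_zero, Finsupp.zero_apply]

theorem isHomogeneous_range {N : GrMod.{u, v, w₂} ℰ} (f : M.carrier →ₗ[E] N.carrier)
    (hf : IsGrHom f) : N.IsHomogeneous (LinearMap.range f) := by
  rintro _ ⟨x, rfl⟩ i
  induction x using mem_induction M.iSup_deg with
  | hom j x hx =>
    rw [components_of_mem _ (hf _ _ hx)]
    by_cases hij : i = j
    · subst hij; exact ⟨x, by simp⟩
    · rw [Finsupp.single_eq_of_ne hij]; exact zero_mem _
  | zero => simp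
  | add x y hx hy => rw [map_add, map_add]; exact add_mem hx hy

theorem isHomogeneous_top : M.IsHomogeneous ⊤ := fun _ _ _ => trivial

end GrMod

/-! ### Graded projective resolutions -/

/-- A resolution `⋯ → X₂ → X₁ → X₀ → M → 0` of the graded module `M` by graded projective
modules, with differentials and augmentation of degree `0`.  (A graded module is projective in the
category of graded modules iff the underlying module is projective.) -/
structure GrProjRes (M : GrMod.{u, v, w} ℰ) where
  X : ℕ → GrMod.{u, v, w₁} ℰ
  d : ∀ m, (X (m + 1)).carrier →ₗ[E] (X m).carrier
  aug : (X 0).carrier →ₗ[E] M.carrier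
  d_gr : ∀ m, GrMod.IsGrHom (d m)
  aug_gr : GrMod.IsGrHom aug
  projective : ∀ m, Module.Projective E (X m).carrier
  exact : ∀ m, Function.Exact (d (m + 1)) (d m)
  exact_aug : Function.Exact (d 0) aug
  surjective_aug : Function.Surjective aug

/-- The submodule `E⁺ M`, where `E⁺` is the part of positive degree. -/
def GrMod.positivePart (M : GrMod.{u, v, w} ℰ) : Submodule E M.carrier :=
  Submodule.span E {y | ∃ i : ℤ, 0 < i ∧ ∃ e ∈ ℰ i, ∃ x : M.carrier, y = e • x}

/-- A resolution is minimal if every differential has image in `E⁺ Xₘ` (for an `ℕ`-graded algebra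
`E` with semisimple `E⁰`, the ideal `E⁺` is the homogeneous radical of `E`). -/
def GrProjRes.IsMinimal {M : GrMod.{u, v, w} ℰ} (P : GrProjRes.{u, v, w, w₁} M) : Prop :=
  ∀ m, LinearMap.range (P.d m) ≤ (P.X m).positivePart

end GrMod

/-! ### Graded bimodules and the tensor product over a noncommutative algebra -/

section Bimodules

variable {k : Type u} [CommRing k]

theorem iSup_grading {A : Type v} [Ring A] [Algebra k A] (𝒜 : ℤ → Submodule k A)
    [GradedAlgebra 𝒜] : ⨆ i, 𝒜 i = ⊤ :=
  (DirectSum.Decomposition.isInternal 𝒜).submodule_iSup_eq_top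

variable (k) in
/-- The algebra `A ⊗ Bᵒᵖ`, whose left modules are the `A`-`B`-bimodules (on which `k` acts
centrally); `a ⊗ bᵒᵖ` acts as `x ↦ a x b`. -/
abbrev Env (A : Type v) (B : Type w) [Ring A] [Algebra k A] [Ring B] [Algebra k B] :=
  A ⊗[k] Bᵐᵒᵖ

/-- The total grading of `A ⊗ Bᵒᵖ`. -/
def envGr {A : Type v} {B : Type w} [Ring A] [Algebra k A] [Ring B] [Algebra k B]
    (𝒜 : ℤ → Submodule k A) (ℬ : ℤ → Submodule k B) : ℤ → Submodule k (Env k A B) :=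
  fun n => Submodule.span k
    {z | ∃ p q : ℤ, p + q = n ∧ ∃ a ∈ 𝒜 p, ∃ b ∈ ℬ q, z = a ⊗ₜ[k] op b}

variable (k) in
/-- The grading of an algebra concentrated in degree `0`. -/
def trivGr (R : Type v) [Ring R] [Algebra k R] : ℤ → Submodule k R :=
  fun i => if i = 0 then ⊤ else ⊥

theorem isInternal_trivGr (R : Type v) [Ring R] [Algebra k R] :
    DirectSum.IsInternal (trivGr k R) := by
  refine isInternal_of_components ?_ LinearMap.id (fun _ _ h => h) (Finsupp.lsingle 0) ?_
  · exact eq_top_iff.mpr fun x _ => Submodule.mem_iSup_of_mem 0 (by simp [trivGr])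
  · intro i x hx
    by_cases hi : i = 0
    · subst hi; rfl
    · have : x = 0 := by simpa [trivGr, hi] using hx
      simp [this]

instance (R : Type v) [Ring R] [Algebra k R] : SetLike.GradedMonoid (trivGr k R) where
  one_mem := by simp [trivGr]
  mul_mem := by
    intro i j a b ha hb
    by_cases hi : i = 0
    · by_cases hj : j = 0
      · simp [trivGr, hi, hj]
      · have : b = 0 := by simpa [trivGr, hj] using hb
        rw [this, mul_zero]; exact zero_mem _
    · have : a = 0 := by simpa [trivGr, hi] using ha
      rw [this, zero_mul]; exact zero_mem _

instance (R : Type v) [Ring R] [Algebra k R] : GradedAlgebra (trivGr k R) where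
  toDecomposition := (isInternal_trivGr R).chooseDecomposition

section EnvLemmas

variable {A : Type v} {B : Type w} [Ring A] [Algebra k A] [Ring B] [Algebra k B]
  {𝒜 : ℤ → Submodule k A} {ℬ : ℤ → Submodule k B}

theorem tmul_mem_envGr {p q : ℤ} {a : A} {b : B} (ha : a ∈ 𝒜 p) (hb : b ∈ ℬ q) :
    a ⊗ₜ[k] op b ∈ envGr 𝒜 ℬ (p + q) :=
  Submodule.subset_span ⟨p, q, rfl, a, ha, b, hb, rfl⟩

theorem iSup_envGr (hA : ⨆ i, 𝒜 i = ⊤) (hB : ⨆ i, ℬ i = ⊤) : ⨆ i, envGr 𝒜 ℬ i = ⊤ := by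
  refine eq_top_iff.mpr fun z hz => ?_
  clear hz
  induction z using TensorProduct.induction_on with
  | zero => exact zero_mem _
  | add x y hx hy => exact add_mem hx hy
  | tmul a b =>
    induction a using mem_induction hA with
    | zero => simp
    | add x y hx hy => rw [TensorProduct.add_tmul]; exact add_mem hx hy
    | hom p a ha =>
      obtain ⟨b, rfl⟩ := op_surjective b
      induction b using mem_induction hB with
      | zero => simp
      | add x y hx hy => rw [op_add, TensorProduct.tmul_add]; exact add_mem hx hy
      | hom q b hb => exact Submodule.mem_iSup_of_mem (p + q) (tmul_mem_envGr ha hb)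

end EnvLemmas

section OfAlgebra

variable {A : Type v} {B : Type w} [Ring A] [Algebra k A] [Ring B] [Algebra k B]
  {𝒜 : ℤ → Submodule k A} {ℬ : ℤ → Submodule k B}
  {S : Type w₁} [Ring S] [Algebra k S]

/-- The action `(a ⊗ bᵒᵖ) s = f(a) s g(b)` of `A ⊗ Bᵒᵖ` on an algebra `S` with algebra maps
`f : A → S` and `g : B → S`. -/
def bimodAction (f : A →ₐ[k] S) (g : B →ₐ[k] S) : Env k A B →ₐ[k] Module.End k S :=
  (AlgHom.mulLeftRight k S).comp (Algebra.TensorProduct.map f (AlgHom.op g))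

theorem bimodAction_tmul (f : A →ₐ[k] S) (g : B →ₐ[k] S) (a : A) (b : B) (s : S) :
    bimodAction f g (a ⊗ₜ op b) s = f a * s * g b := by
  simp [bimodAction]

/-- A graded algebra `S` as a graded `A`-`B`-bimodule along `f : A → S` and `g : B → S`. -/
def bimod (𝒮 : ℤ → Submodule k S) [GradedAlgebra 𝒮] (f : A →ₐ[k] S) (g : B →ₐ[k] S)
    (hf : ∀ i, ∀ a ∈ 𝒜 i, f a ∈ 𝒮 i) (hg : ∀ i, ∀ b ∈ ℬ i, g b ∈ 𝒮 i) :
    GrMod (envGr 𝒜 ℬ) where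
  carrier := S
  module := Module.compHom S (bimodAction f g).toRingHom
  tower := by
    let _ := Module.compHom S (bimodAction f g).toRingHom
    refine ⟨fun c e s => ?_⟩
    change bimodAction f g (c • e) s = c • bimodAction f g e s
    rw [map_smul]; rfl
  deg := 𝒮
  internal := DirectSum.Decomposition.isInternal 𝒮
  smul_mem := by
    intro i j e x he hx
    change bimodAction f g e x ∈ 𝒮 (i + j)
    induction he using Submodule.span_induction with
    | zero => simp
    | add e e' _ _ h h' => rw [map_add]; exact add_mem h h'
    | smul c e _ h => rw [map_smul]; exact Submodule.smul_mem _ _ h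
    | mem e h =>
      obtain ⟨p, q, rfl, a, ha, b, hb, rfl⟩ := h
      rw [bimodAction_tmul, add_right_comm]
      exact SetLike.mul_mem_graded (SetLike.mul_mem_graded (hf _ _ ha) hx) (hg _ _ hb)

end OfAlgebra

section Tensor

variable {A : Type v} {B : Type w} {C : Type w₁} [Ring A] [Algebra k A] [Ring B] [Algebra k B]
  [Ring C] [Algebra k C]
  {𝒜 : ℤ → Submodule k A} {ℬ : ℤ → Submodule k B} {𝒞 : ℤ → Submodule k C}

variable (M : GrMod.{u, max v w, w₂} (envGr 𝒜 ℬ)) (N : GrMod.{u, max w w₁, w₃} (envGr ℬ 𝒞))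

/-- The left action `a (m ⊗ n) = a m ⊗ n` of `A` on `M ⊗[k] N`. -/
def tensLeft : A →ₐ[k] Module.End k (M.carrier ⊗[k] N.carrier) :=
  (Module.End.rTensorAlgHom k M.carrier N.carrier).comp
    ((Algebra.lsmul k k M.carrier).comp
      (Algebra.TensorProduct.includeLeft : A →ₐ[k] Env k A B))

/-- The right action `(m ⊗ n) c = m ⊗ n c` of `C` on `M ⊗[k] N`. -/
def tensRight : Cᵐᵒᵖ →ₐ[k] Module.End k (M.carrier ⊗[k] N.carrier) :=
  (Module.End.lTensorAlgHom k N.carrier M.carrier).comp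
    ((Algebra.lsmul k k N.carrier).comp
      (Algebra.TensorProduct.includeRight : Cᵐᵒᵖ →ₐ[k] Env k B C))

theorem commute_tensLeft_tensRight (a : A) (c : Cᵐᵒᵖ) :
    Commute (tensLeft M N a) (tensRight M N c) :=
  TensorProduct.ext' fun _ _ => rfl

/-- The action `(a ⊗ cᵒᵖ)(m ⊗ n) = a m ⊗ n c` of `A ⊗ Cᵒᵖ` on `M ⊗[k] N`, for an `A`-`B`-bimodule
`M` and a `B`-`C`-bimodule `N`. -/
def tensAction : Env k A C →ₐ[k] Module.End k (M.carrier ⊗[k] N.carrier) :=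
  Algebra.TensorProduct.lift (tensLeft M N) (tensRight M N) (commute_tensLeft_tensRight M N)

variable {M N} in
theorem tensAction_tmul (a : A) (c : C) (m : M.carrier) (n : N.carrier) :
    tensAction M N (a ⊗ₜ op c) (m ⊗ₜ n)
      = ((a ⊗ₜ[k] (1 : Bᵐᵒᵖ)) • m) ⊗ₜ[k] (((1 : B) ⊗ₜ[k] op c) • n) := by
  rw [tensAction, Algebra.TensorProduct.lift_tmul]
  rfl

variable [GradedAlgebra 𝒜] [GradedAlgebra ℬ] [GradedAlgebra 𝒞]

/-- The graded `A`-`C`-bimodule `M ⊗[k] N`, with `deg (m ⊗ n) = deg m + deg n`. -/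
def ktens : GrMod.{u, max v w₁, max w₂ w₃} (envGr 𝒜 𝒞) where
  carrier := M.carrier ⊗[k] N.carrier
  module := Module.compHom _ (tensAction M N).toRingHom
  tower := by
    let _ := Module.compHom (M.carrier ⊗[k] N.carrier) (tensAction M N).toRingHom
    refine ⟨fun c e s => ?_⟩
    change tensAction M N (c • e) s = c • tensAction M N e s
    rw [map_smul]; rfl
  deg n := Submodule.span k
    {z | ∃ p q : ℤ, p + q = n ∧ ∃ x ∈ M.deg p, ∃ y ∈ N.deg q, z = x ⊗ₜ[k] y}
  internal := by
    refine isInternal_of_components ?_ LinearMap.id (fun _ _ h => h)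
      (Finsupp.lmapDomain _ k (fun p : ℤ × ℤ => p.1 + p.2) ∘ₗ
        (finsuppTensorFinsupp k k M.carrier N.carrier ℤ ℤ).toLinearMap ∘ₗ
        TensorProduct.map (components M.internal) (components N.internal)) ?_
    · refine eq_top_iff.mpr fun z hz => ?_
      clear hz
      induction z using TensorProduct.induction_on with
      | zero => exact zero_mem _
      | add x y hx hy => exact add_mem hx hy
      | tmul a b =>
        induction a using mem_induction M.iSup_deg with
        | zero => simp
        | add x y hx hy => rw [TensorProduct.add_tmul]; exact add_mem hx hy
        | hom p a ha =>
          induction b using mem_induction N.iSup_deg with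
          | zero => simp
          | add x y hx hy => rw [TensorProduct.tmul_add]; exact add_mem hx hy
          | hom q b hb =>
            exact Submodule.mem_iSup_of_mem (p + q)
              (Submodule.subset_span ⟨p, q, rfl, a, ha, b, hb, rfl⟩)
    · intro i z hz
      induction hz using Submodule.span_induction with
      | zero => simp
      | add x y _ _ hx hy => rw [map_add, hx, hy, map_add, Finsupp.single_add]
      | smul c x _ hx => rw [map_smul, hx, map_smul, Finsupp.smul_single]
      | mem z hz =>
        obtain ⟨p, q, rfl, x, hx, y, hy, rfl⟩ := hz
        simp [components_of_mem _ hx, components_of_mem _ hy, Finsupp.mapDomain_single]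
  smul_mem := by
    intro i j e z he hz
    change tensAction M N e z ∈ _
    induction he using Submodule.span_induction with
    | zero => simp
    | add e e' _ _ h h' => rw [map_add]; exact add_mem h h'
    | smul c e _ h => rw [map_smul]; exact Submodule.smul_mem _ _ h
    | mem e h =>
      obtain ⟨p, q, rfl, a, ha, c, hc, rfl⟩ := h
      induction hz using Submodule.span_induction with
      | zero => rw [map_zero]; exact zero_mem _
      | add x y _ _ hx hy => rw [map_add]; exact add_mem hx hy
      | smul c x _ hx => rw [map_smul]; exact Submodule.smul_mem _ _ hx
      | mem z hz =>
        obtain ⟨p', q', rfl, x, hx, y, hy, rfl⟩ := hz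
        rw [tensAction_tmul]
        refine Submodule.subset_span ⟨p + 0 + p', 0 + q + q', by ring, _,
          M.smul_mem (tmul_mem_envGr ha (SetLike.one_mem_graded ℬ)) hx, _,
          N.smul_mem (tmul_mem_envGr (SetLike.one_mem_graded ℬ) hc) hy, rfl⟩

/-- The bilinear map `(m, n) ↦ m ⊗ n`. -/
def tm : M.carrier →ₗ[k] N.carrier →ₗ[k] (ktens M N).carrier :=
  TensorProduct.mk k M.carrier N.carrier

variable {M N} in
theorem tm_mem {p q n : ℤ} (h : p + q = n) {x : M.carrier} {y : N.carrier} (hx : x ∈ M.deg p)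
    (hy : y ∈ N.deg q) : tm M N x y ∈ (ktens M N).deg n :=
  Submodule.subset_span (R := k) (M := M.carrier ⊗[k] N.carrier) ⟨p, q, h, x, hx, y, hy, rfl⟩

/-- The element `m b ⊗ n - m ⊗ b n` of `M ⊗[k] N`. -/
def balancing (m : M.carrier) (b : B) (n : N.carrier) : (ktens M N).carrier :=
  tm M N (((1 : A) ⊗ₜ[k] op b) • m) n - tm M N m ((b ⊗ₜ[k] (1 : Cᵐᵒᵖ)) • n)

/-- The sub-bimodule of `M ⊗[k] N` generated by the elements `m b ⊗ n - m ⊗ b n`. -/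
def balancingSubmodule : Submodule (Env k A C) (ktens M N).carrier :=
  Submodule.span _ {z | ∃ m b n, z = balancing M N m b n}

theorem isHomogeneous_balancingSubmodule :
    (ktens M N).IsHomogeneous (balancingSubmodule M N) := by
  let s : Set (ktens M N).carrier :=
    {z | ∃ p q r : ℤ, ∃ m ∈ M.deg p, ∃ b ∈ ℬ q, ∃ n ∈ N.deg r, z = balancing M N m b n}
  have h1 : balancingSubmodule M N = Submodule.span _ s := by
    apply le_antisymm
    · refine Submodule.span_le.mpr ?_
      rintro _ ⟨m, b, n, rfl⟩
      rw [SetLike.mem_coe]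
      induction m using mem_induction M.iSup_deg with
      | zero => simp [balancing]
      | add x y hx hy =>
        have : balancing M N (x + y) b n = balancing M N x b n + balancing M N y b n := by
          simp only [balancing, smul_add, map_add, LinearMap.add_apply]; abel
        rw [this]; exact add_mem hx hy
      | hom p m hm =>
        have hadd : ∀ x y, balancing M N m (x + y) n
            = balancing M N m x n + balancing M N m y n := by
          intro x y
          simp only [balancing, op_add, TensorProduct.tmul_add, add_smul, TensorProduct.add_tmul,
            map_add, LinearMap.add_apply]
          abel
        induction b using mem_induction (iSup_grading ℬ) with
        | zero =>
          have h0 := hadd 0 0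
          rw [add_zero, left_eq_add] at h0
          rw [h0]; exact zero_mem _
        | add x y hx hy => rw [hadd]; exact add_mem hx hy
        | hom q b hb =>
          clear hadd
          induction n using mem_induction N.iSup_deg with
          | zero => simp [balancing]
          | add x y hx hy =>
            have : balancing M N m b (x + y) = balancing M N m b x + balancing M N m b y := by
              simp only [balancing, smul_add, map_add]; abel
            rw [this]; exact add_mem hx hy
          | hom r n hn => exact Submodule.subset_span ⟨p, q, r, m, hm, b, hb, n, hn, rfl⟩
    · refine Submodule.span_mono ?_
      rintro _ ⟨_, _, _, m, _, b, _, n, _, rfl⟩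
      exact ⟨m, b, n, rfl⟩
  rw [h1]
  refine (ktens M N).isHomogeneous_span (iSup_envGr (iSup_grading 𝒜) (iSup_grading 𝒞)) s ?_
  rintro _ ⟨p, q, r, m, hm, b, hb, n, hn, rfl⟩
  refine ⟨p + q + r, sub_mem ?_ ?_⟩
  · exact tm_mem (by ring) (M.smul_mem (tmul_mem_envGr (SetLike.one_mem_graded 𝒜) hb) hm) hn
  · exact tm_mem (by ring) hm (N.smul_mem (tmul_mem_envGr hb (SetLike.one_mem_graded 𝒞)) hn)

/-- The graded `A`-`C`-bimodule `M ⊗_B N`, for a graded `A`-`B`-bimodule `M` and a graded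
`B`-`C`-bimodule `N`. -/
def tens : GrMod.{u, max v w₁, max w₂ w₃} (envGr 𝒜 𝒞) :=
  (ktens M N).quot (balancingSubmodule M N) (isHomogeneous_balancingSubmodule M N)

variable {N} {N' : GrMod.{u, max w w₁, w₃} (envGr ℬ 𝒞)}

theorem lTensor_tensAction (f : N.carrier →ₗ[Env k B C] N'.carrier) (e : Env k A C)
    (z : M.carrier ⊗[k] N.carrier) :
    (f.restrictScalars k).lTensor M.carrier (tensAction M N e z)
      = tensAction M N' e ((f.restrictScalars k).lTensor M.carrier z) := by
  induction e using TensorProduct.induction_on with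
  | zero => simp
  | add e e' h h' => simp only [map_add, LinearMap.add_apply, h, h']
  | tmul a c =>
    obtain ⟨c, rfl⟩ := op_surjective c
    induction z using TensorProduct.induction_on with
    | zero => simp
    | add e e' h h' => simp only [map_add, h, h']
    | tmul m n => simp [tensAction_tmul]

/-- The map `m ⊗ n ↦ m ⊗ f n` from `M ⊗[k] N` to `M ⊗[k] N'`. -/
def ktensMap (f : N.carrier →ₗ[Env k B C] N'.carrier) :
    (ktens M N).carrier →ₗ[Env k A C] (ktens M N').carrier where
  toFun := (f.restrictScalars k).lTensor M.carrier
  map_add' := map_add _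
  map_smul' := lTensor_tensAction M f

theorem ktensMap_tm (f : N.carrier →ₗ[Env k B C] N'.carrier) (m : M.carrier) (n : N.carrier) :
    ktensMap M f (tm M N m n) = tm M N' m (f n) := rfl

/-- The map `m ⊗ n ↦ m ⊗ f n` from `M ⊗_B N` to `M ⊗_B N'`. -/
def tensMap (f : N.carrier →ₗ[Env k B C] N'.carrier) :
    (tens M N).carrier →ₗ[Env k A C] (tens M N').carrier :=
  Submodule.mapQ (balancingSubmodule M N) (balancingSubmodule M N') (ktensMap M f) (by
    refine Submodule.span_le.mpr ?_
    rintro _ ⟨m, b, n, rfl⟩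
    refine Submodule.subset_span ⟨m, b, f n, ?_⟩
    simp only [balancing, map_sub, ktensMap_tm, map_smul])

theorem isGrHom_tensMap {f : N.carrier →ₗ[Env k B C] N'.carrier} (hf : GrMod.IsGrHom f) :
    GrMod.IsGrHom (tensMap M f) := by
  rintro i _ ⟨z, hz, rfl⟩
  refine ⟨ktensMap M f z, ?_, rfl⟩
  have key : (ktens M N).deg i ≤
      ((ktens M N').deg i).comap ((ktensMap M f).restrictScalars k) := by
    refine Submodule.span_le.mpr ?_
    rintro _ ⟨p, q, h, x, hx, y, hy, rfl⟩
    exact tm_mem h hx (hf _ _ hy)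
  exact key hz

end Tensor
end Bimodules

/-! ### Separably augmented algebras, `Tor^A(R, R)` and the minimal resolution -/

section Augmented

/-- A `k`-algebra `R` is separable if there is a separability idempotent `p = ∑ xᵢ ⊗ yᵢ` with
`a p = p a` for all `a ∈ R` and `∑ xᵢ yᵢ = 1`. -/
def IsSeparableAlg (k : Type u) (R : Type v) [CommRing k] [Ring R] [Algebra k R] : Prop :=
  ∃ p : R ⊗[k] R,
    (∀ a : R, (LinearMap.mulLeft k a).rTensor R p = (LinearMap.mulRight k a).lTensor R p) ∧
      LinearMap.mul' k R p = 1

variable {k : Type u} [CommRing k] {A : Type v} [Ring A] [Algebra k A]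

/-- The degree `0` part `R = A⁰` of a graded algebra `A`, as a subalgebra. -/
abbrev degZero {k : Type u} [CommRing k] {A : Type v} [Ring A] [Algebra k A]
    (𝒜 : ℤ → Submodule k A) [GradedAlgebra 𝒜] : Subalgebra k A :=
  SetLike.GradeZero.subalgebra 𝒜

/-- A separably augmented algebra: an `ℕ`-graded algebra (a `ℤ`-graded one without nonzero
elements of negative degree) whose degree `0` part is separable. -/
class SeparablyAugmented (𝒜 : ℤ → Submodule k A) [GradedAlgebra 𝒜] : Prop where
  nonneg : ∀ i < 0, 𝒜 i = ⊥
  separable : IsSeparableAlg k (degZero 𝒜)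

variable (𝒜 : ℤ → Submodule k A) [GradedAlgebra 𝒜]

/-- The inclusion of `R = A⁰` into `A`. -/
def zeroIncl : degZero 𝒜 →ₐ[k] A := (degZero 𝒜).val

/-- The augmentation `A → A⁰ = R`, with kernel `A⁺`. -/
def zeroProj [h : SeparablyAugmented 𝒜] : A →ₐ[k] degZero 𝒜 where
  toFun a := ⟨DirectSum.decompose 𝒜 a 0, (DirectSum.decompose 𝒜 a 0).2⟩
  map_one' := by
    apply Subtype.ext
    exact DirectSum.decompose_of_mem_same 𝒜 (SetLike.one_mem_graded 𝒜)
  map_mul' a b := by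
    apply Subtype.ext
    change (DirectSum.decompose 𝒜 (a * b) 0 : A)
      = (DirectSum.decompose 𝒜 a 0 : A) * (DirectSum.decompose 𝒜 b 0 : A)
    induction a using mem_induction (iSup_grading 𝒜) with
    | zero => simp
    | add x y hx hy => simp only [add_mul, DirectSum.decompose_add, DirectSum.add_apply,
        AddMemClass.coe_add, hx, hy]
    | hom i a ha =>
      induction b using mem_induction (iSup_grading 𝒜) with
      | zero => simp
      | add x y hx hy => simp only [mul_add, DirectSum.decompose_add, DirectSum.add_apply,
          AddMemClass.coe_add, hx, hy]
      | hom j b hb =>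
        rcases lt_or_ge i 0 with hi | hi
        · rw [h.nonneg i hi, Submodule.mem_bot] at ha
          simp [ha]
        rcases lt_or_ge j 0 with hj | hj
        · rw [h.nonneg j hj, Submodule.mem_bot] at hb
          simp [hb]
        have hab : a * b ∈ 𝒜 (i + j) := SetLike.mul_mem_graded ha hb
        by_cases hi0 : i = 0
        · by_cases hj0 : j = 0
          · subst hi0; subst hj0
            rw [DirectSum.decompose_of_mem_same 𝒜 ha, DirectSum.decompose_of_mem_same 𝒜 hb,
              DirectSum.decompose_of_mem_same 𝒜 (by simpa using hab)]
          · rw [DirectSum.decompose_of_mem_ne 𝒜 hb hj0,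
              DirectSum.decompose_of_mem_ne 𝒜 hab (by omega), mul_zero]
        · rw [DirectSum.decompose_of_mem_ne 𝒜 ha hi0,
            DirectSum.decompose_of_mem_ne 𝒜 hab (by omega), zero_mul]
  map_zero' := Subtype.ext (by simp)
  map_add' a b := Subtype.ext (by simp)
  commutes' c := by
    apply Subtype.ext
    exact DirectSum.decompose_of_mem_same 𝒜 (SetLike.algebraMap_mem_graded 𝒜 c)

theorem zeroIncl_mem (i : ℤ) (r : degZero 𝒜) (hr : r ∈ trivGr k (degZero 𝒜) i) : zeroIncl 𝒜 r ∈ 𝒜 i := by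
  by_cases hi : i = 0
  · subst hi; exact r.2
  · have : r = 0 := by simpa [trivGr, hi] using hr
    rw [this, map_zero]; exact zero_mem _

theorem zeroProj_mem [SeparablyAugmented 𝒜] (i : ℤ) (a : A) (ha : a ∈ 𝒜 i) :
    zeroProj 𝒜 a ∈ trivGr k (degZero 𝒜) i := by
  by_cases hi : i = 0
  · simp [trivGr, hi]
  · have : zeroProj 𝒜 a = 0 := Subtype.ext (DirectSum.decompose_of_mem_ne 𝒜 ha hi)
    rw [this]; exact zero_mem _

/-- The grading of `R ⊗ Rᵒᵖ`, where `R = A⁰` sits in degree `0`. -/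
abbrev zeroEnvGr : ℤ → Submodule k (Env k (degZero 𝒜) (degZero 𝒜)) :=
  envGr (trivGr k (degZero 𝒜)) (trivGr k (degZero 𝒜))

/-- `A` as a graded `A`-`A`-bimodule. -/
def diagBimod : GrMod.{u, v, v} (envGr 𝒜 𝒜) :=
  bimod 𝒜 (AlgHom.id k A) (AlgHom.id k A) (fun _ _ h => h) (fun _ _ h => h)

/-- `A` as a graded `A`-`R`-bimodule. -/
def bimodAR : GrMod.{u, v, v} (envGr 𝒜 (trivGr k (degZero 𝒜))) :=
  bimod 𝒜 (AlgHom.id k A) (zeroIncl 𝒜) (fun _ _ h => h) (zeroIncl_mem 𝒜)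

/-- `A` as a graded `R`-`A`-bimodule. -/
def bimodRA : GrMod.{u, v, v} (envGr (trivGr k (degZero 𝒜)) 𝒜) :=
  bimod 𝒜 (zeroIncl 𝒜) (AlgHom.id k A) (zeroIncl_mem 𝒜) (fun _ _ h => h)

/-- `R = A/A⁺` as a graded `A`-`R`-bimodule. -/
def resAR [SeparablyAugmented 𝒜] : GrMod.{u, v, v} (envGr 𝒜 (trivGr k (degZero 𝒜))) :=
  bimod (trivGr k (degZero 𝒜)) (zeroProj 𝒜) (AlgHom.id k (degZero 𝒜)) (zeroProj_mem 𝒜) (fun _ _ h => h)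

/-- `R = A/A⁺` as a graded `R`-`A`-bimodule. -/
def resRA [SeparablyAugmented 𝒜] : GrMod.{u, v, v} (envGr (trivGr k (degZero 𝒜)) 𝒜) :=
  bimod (trivGr k (degZero 𝒜)) (AlgHom.id k (degZero 𝒜)) (zeroProj 𝒜) (fun _ _ h => h) (zeroProj_mem 𝒜)

variable {𝒜}
variable [SeparablyAugmented 𝒜] (Q : GrProjRes.{u, v, v, w} (resAR 𝒜))

/-- The term `R ⊗_A Q_m` of the complex `R ⊗_A Q`. -/
def torTerm (m : ℕ) : GrMod.{u, v, max v w} (zeroEnvGr 𝒜) := tens (resRA 𝒜) (Q.X m)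

/-- The differential of the complex `R ⊗_A Q`. -/
def torD (m : ℕ) :
    (torTerm Q (m + 1)).carrier →ₗ[Env k (degZero 𝒜) (degZero 𝒜)] (torTerm Q m).carrier :=
  tensMap (resRA 𝒜) (Q.d m)

theorem isGrHom_torD (m : ℕ) : GrMod.IsGrHom (torD Q m) := isGrHom_tensMap _ (Q.d_gr m)

/-- The `m`-cycles of the complex `R ⊗_A Q`. -/
def torCycles : ∀ m : ℕ, Submodule (Env k (degZero 𝒜) (degZero 𝒜)) (torTerm Q m).carrier
  | 0 => ⊤
  | m + 1 => LinearMap.ker (torD Q m)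

theorem isHomogeneous_torCycles : ∀ m, (torTerm Q m).IsHomogeneous (torCycles Q m)
  | 0 => GrMod.isHomogeneous_top
  | m + 1 => GrMod.isHomogeneous_ker _ (isGrHom_torD Q m)

/-- `Tor_m^A(R, R)` as a graded `R`-`R`-bimodule: the homology `H_m(R ⊗_A Q)` for a graded
projective resolution `Q` of `R`.  The resolution consists of graded `A`-`R`-bimodules, projective
over `A ⊗ Rᵒᵖ` (hence over `A`), so that the right action of `R` is visible on the homology. -/
def Tor (m : ℕ) : GrMod.{u, v, max v w} (zeroEnvGr 𝒜) :=
  (torTerm Q m).subquot (torCycles Q m) (LinearMap.range (torD Q m))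
    (isHomogeneous_torCycles Q m) (GrMod.isHomogeneous_range _ (isGrHom_torD Q m))

end Augmented

/-! ### The tensor algebra of a bimodule -/

section TensorRing

variable {k : Type u} [CommRing k] {R : Type v} [Ring R] [Algebra k R]
  (V : GrMod.{u, v, w} (envGr (trivGr k R) (trivGr k R)))

/-- The relations imposed on the free `k`-algebra on `R ⊕ V`: the multiplication of `R` and the two
actions of `R` on `V`. -/
inductive TRing.Rel : TensorAlgebra k (R × V.carrier) → TensorAlgebra k (R × V.carrier) → Prop
  | one : TRing.Rel (TensorAlgebra.ι k (1, 0)) 1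
  | mul (r s : R) : TRing.Rel
      (TensorAlgebra.ι k (r, 0) * TensorAlgebra.ι k (s, 0)) (TensorAlgebra.ι k (r * s, 0))
  | left (r : R) (v : V.carrier) : TRing.Rel
      (TensorAlgebra.ι k (r, 0) * TensorAlgebra.ι k (0, v))
      (TensorAlgebra.ι k (0, (r ⊗ₜ[k] 1 : Env k R R) • v))
  | right (r : R) (v : V.carrier) : TRing.Rel
      (TensorAlgebra.ι k (0, v) * TensorAlgebra.ι k (r, 0))
      (TensorAlgebra.ι k (0, (1 ⊗ₜ[k] op r : Env k R R) • v))

/-- The tensor algebra `T(V) = R ⊕ V ⊕ (V ⊗_R V) ⊕ ⋯` of the `R`-`R`-bimodule `V`, presented as the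
free algebra under `R` and `V` (see `TRing.lift`). -/
def TRing : Type (max u v w) := RingQuot (TRing.Rel V)

namespace TRing

instance : Ring (TRing V) := inferInstanceAs (Ring (RingQuot (TRing.Rel V)))

instance : Algebra k (TRing V) := inferInstanceAs (Algebra k (RingQuot (TRing.Rel V)))

/-- The quotient map from the free `k`-algebra on `R ⊕ V`. -/
def mk : TensorAlgebra k (R × V.carrier) →ₐ[k] TRing V := RingQuot.mkAlgHom k (TRing.Rel V)

/-- The inclusion `R → T(V)`. -/
def incl : R →ₐ[k] TRing V :=
  AlgHom.ofLinearMap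
    ((mk V).toLinearMap ∘ₗ TensorAlgebra.ι k ∘ₗ LinearMap.inl k R V.carrier)
    ((RingQuot.mkAlgHom_rel k (TRing.Rel.one)).trans (map_one _))
    (fun r s => (RingQuot.mkAlgHom_rel k (TRing.Rel.mul r s)).symm.trans (map_mul _ _ _))

/-- The inclusion `V → T(V)`. -/
def ι : V.carrier →ₗ[k] TRing V :=
  (mk V).toLinearMap ∘ₗ TensorAlgebra.ι k ∘ₗ LinearMap.inr k R V.carrier

theorem incl_mul_ι (r : R) (v : V.carrier) :
    incl V r * ι V v = ι V ((r ⊗ₜ[k] 1 : Env k R R) • v) :=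
  (map_mul (mk V) _ _).symm.trans (RingQuot.mkAlgHom_rel k (TRing.Rel.left r v))

theorem ι_mul_incl (r : R) (v : V.carrier) :
    ι V v * incl V r = ι V ((1 ⊗ₜ[k] op r : Env k R R) • v) :=
  (map_mul (mk V) _ _).symm.trans (RingQuot.mkAlgHom_rel k (TRing.Rel.right r v))

/-- The universal property of `T(V)`. -/
def lift {S : Type w₁} [Ring S] [Algebra k S] (f : R →ₐ[k] S) (g : V.carrier →ₗ[k] S)
    (hl : ∀ r v, g ((r ⊗ₜ[k] 1 : Env k R R) • v) = f r * g v)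
    (hr : ∀ r v, g ((1 ⊗ₜ[k] op r : Env k R R) • v) = g v * f r) : TRing V →ₐ[k] S :=
  RingQuot.liftAlgHom k ⟨TensorAlgebra.lift k (f.toLinearMap.coprod g), by
    intro x y h
    induction h with
    | one => simp
    | mul r s => simp
    | left r v => simp [hl]
    | right r v => simp [hr]⟩

section
variable {S : Type w₁} [Ring S] [Algebra k S] (f : R →ₐ[k] S) (g : V.carrier →ₗ[k] S)
    (hl : ∀ r v, g ((r ⊗ₜ[k] 1 : Env k R R) • v) = f r * g v)
    (hr : ∀ r v, g ((1 ⊗ₜ[k] op r : Env k R R) • v) = g v * f r)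

theorem lift_incl (r : R) : lift V f g hl hr (incl V r) = f r := by
  refine (RingQuot.liftAlgHom_mkAlgHom_apply k _ _ _).trans ?_
  simp

theorem lift_ι (v : V.carrier) : lift V f g hl hr (ι V v) = g v := by
  refine (RingQuot.liftAlgHom_mkAlgHom_apply k _ _ _).trans ?_
  simp

end

theorem hom_ext {S : Type w₁} [Ring S] [Algebra k S] {φ ψ : TRing V →ₐ[k] S}
    (h₁ : ∀ r, φ (incl V r) = ψ (incl V r)) (h₂ : ∀ v, φ (ι V v) = ψ (ι V v)) : φ = ψ := by
  refine RingQuot.ringQuot_ext' k φ ψ (TensorAlgebra.hom_ext (LinearMap.ext fun x => ?_))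
  obtain ⟨r, v⟩ := x
  have : ((r, v) : R × V.carrier) = (r, 0) + (0, v) := by simp
  rw [this, map_add, map_add]
  exact congrArg₂ (· + ·) (h₁ r) (h₂ v)

/-- `x` is a product `v₁ ⋯ vₙ r` with homogeneous `vⱼ ∈ V` of total degree `i` and `r ∈ R`. -/
inductive IsMonomial : ℤ → TRing V → Prop
  | base (r : R) : IsMonomial 0 (incl V r)
  | cons {i j : ℤ} {v : V.carrier} {x : TRing V} (hv : v ∈ V.deg i) (hx : IsMonomial j x) :
      IsMonomial (i + j) (ι V v * x)

/-- The grading of `T(V)` with `deg (v₁ ⊗ ⋯ ⊗ vₙ) = deg v₁ + ⋯ + deg vₙ` and `R` in degree `0`. -/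
def deg (i : ℤ) : Submodule k (TRing V) := Submodule.span k {x | IsMonomial V i x}

variable {V}

theorem left_smul_mem (r : R) {i : ℤ} {v : V.carrier} (hv : v ∈ V.deg i) :
    (r ⊗ₜ[k] 1 : Env k R R) • v ∈ V.deg i := by
  have h := V.smul_mem (tmul_mem_envGr (𝒜 := trivGr k R) (ℬ := trivGr k R) (p := 0) (q := 0)
    (a := r) (b := 1) (by simp [trivGr]) (by simp [trivGr])) hv
  simpa using h

theorem right_smul_mem (r : R) {i : ℤ} {v : V.carrier} (hv : v ∈ V.deg i) :
    (1 ⊗ₜ[k] op r : Env k R R) • v ∈ V.deg i := by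
  have h := V.smul_mem (tmul_mem_envGr (𝒜 := trivGr k R) (ℬ := trivGr k R) (p := 0) (q := 0)
    (a := 1) (b := r) (by simp [trivGr]) (by simp [trivGr])) hv
  simpa using h

theorem IsMonomial.incl_mul (r : R) {i : ℤ} {x : TRing V} (hx : IsMonomial V i x) :
    IsMonomial V i (incl V r * x) := by
  cases hx with
  | base s => rw [← map_mul]; exact .base _
  | cons hv hx => rw [← mul_assoc, incl_mul_ι]; exact .cons (left_smul_mem r hv) hx

theorem IsMonomial.mul {i j : ℤ} {x y : TRing V} (hx : IsMonomial V i x) (hy : IsMonomial V j y) :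
    IsMonomial V (i + j) (x * y) := by
  induction hx with
  | base r => rw [zero_add]; exact hy.incl_mul r
  | cons hv _ ih => rw [mul_assoc, add_assoc]; exact .cons hv ih

instance : SetLike.GradedMonoid (deg V) where
  one_mem := Submodule.subset_span (by
    have := IsMonomial.base (V := V) 1
    rwa [map_one] at this)
  mul_mem := by
    intro i j x y hx hy
    have : deg V i * deg V j ≤ deg V (i + j) := by
      rw [deg, deg, Submodule.span_mul_span]
      refine Submodule.span_le.mpr ?_
      rintro _ ⟨x, hx, y, hy, rfl⟩
      exact Submodule.subset_span (hx.mul hy)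
    exact this (Submodule.mul_mem_mul hx hy)

theorem incl_mem (r : R) : incl V r ∈ deg V 0 := Submodule.subset_span (.base r)

theorem ι_mem {i : ℤ} {v : V.carrier} (hv : v ∈ V.deg i) : ι V v ∈ deg V i := by
  have := IsMonomial.cons hv (IsMonomial.base (V := V) 1)
  rw [map_one, mul_one, add_zero] at this
  exact Submodule.subset_span this

theorem iSup_deg : ⨆ i, deg V i = ⊤ := by
  let S : Subalgebra k (TRing V) :=
    { carrier := {x | x ∈ ⨆ i, deg V i}
      mul_mem' := by
        intro a b ha hb
        refine Submodule.iSup_induction (deg V) (motive := fun a => a * b ∈ ⨆ i, deg V i) ha ?_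
          (by simp) (fun x y hx hy => by rw [add_mul]; exact add_mem hx hy)
        intro i x hx
        refine Submodule.iSup_induction (deg V) (motive := fun b => x * b ∈ ⨆ i, deg V i) hb ?_
          (by simp) (fun x y hx hy => by rw [mul_add]; exact add_mem hx hy)
        intro j y hy
        exact Submodule.mem_iSup_of_mem (i + j) (SetLike.mul_mem_graded hx hy)
      add_mem' := fun {a b} ha hb => (⨆ i, deg V i).add_mem ha hb
      algebraMap_mem' := fun c => by
        refine Submodule.mem_iSup_of_mem 0 ?_
        rw [← (incl V).commutes]; exact incl_mem _ }
  have hinc : ∀ r, incl V r ∈ S := fun r => Submodule.mem_iSup_of_mem 0 (incl_mem r)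
  have hι : ∀ v, ι V v ∈ S := fun v => by
    induction v using mem_induction V.iSup_deg with
    | zero => rw [map_zero]; exact zero_mem _
    | add x y hx hy => rw [map_add]; exact add_mem hx hy
    | hom i v hv => exact Submodule.mem_iSup_of_mem i (ι_mem hv)
  let φ : TRing V →ₐ[k] S := lift V ((incl V).codRestrict S hinc)
    ((ι V).codRestrict (Subalgebra.toSubmodule S) hι)
    (fun r v => Subtype.ext (incl_mul_ι V r v).symm) (fun r v => Subtype.ext (ι_mul_incl V r v).symm)
  have hφ : S.val.comp φ = AlgHom.id k _ := by
    refine hom_ext V (fun r => ?_) (fun v => ?_)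
    · exact congrArg S.val (lift_incl V _ _ _ _ r)
    · exact congrArg S.val (lift_ι V _ _ _ _ v)
  refine eq_top_iff.mpr fun x _ => ?_
  have := DFunLike.congr_fun hφ x
  rw [← show (φ x : TRing V) = x from this]
  exact (φ x).2

/-- The map `x ↦ x t⁰`. -/
def coactionR : R →ₐ[k] AddMonoidAlgebra (TRing V) ℤ :=
  AlgHom.ofLinearMap ((AddMonoidAlgebra.lsingle (R := k) 0) ∘ₗ (incl V).toLinearMap)
    (by
      change AddMonoidAlgebra.single 0 (incl V 1) = 1
      rw [map_one]; rfl)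
    (fun r s => by
      change AddMonoidAlgebra.single 0 (incl V (r * s))
        = AddMonoidAlgebra.single 0 (incl V r) * AddMonoidAlgebra.single 0 (incl V s)
      rw [map_mul, AddMonoidAlgebra.single_mul_single, add_zero])

/-- The map `v ↦ ∑ᵢ vᵢ tⁱ`. -/
def coactionV : V.carrier →ₗ[k] AddMonoidAlgebra (TRing V) ℤ :=
  (AddMonoidAlgebra.coeffLinearEquiv k).symm.toLinearMap ∘ₗ
    Finsupp.mapRange.linearMap (ι V) ∘ₗ components V.internal

theorem coactionV_of_mem {i : ℤ} {v : V.carrier} (hv : v ∈ V.deg i) :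
    coactionV v = AddMonoidAlgebra.single i (ι V v) := by
  simp only [coactionV, LinearMap.comp_apply, components_of_mem _ hv]
  rw [Finsupp.mapRange.linearMap_apply, Finsupp.mapRange_single]
  rfl

/-- The algebra map `T(V) → T(V)[t, t⁻¹]` sending `v ∈ Vᵢ` to `v tⁱ`. -/
def coaction : TRing V →ₐ[k] AddMonoidAlgebra (TRing V) ℤ :=
  lift V coactionR coactionV
    (fun r v => by
      change _ = AddMonoidAlgebra.single 0 (incl V r) * _
      induction v using mem_induction V.iSup_deg with
      | zero => simp
      | add x y hx hy => rw [smul_add, map_add, map_add, mul_add, hx, hy]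
      | hom i v hv =>
        rw [coactionV_of_mem hv, coactionV_of_mem (left_smul_mem r hv),
          AddMonoidAlgebra.single_mul_single, incl_mul_ι, zero_add])
    (fun r v => by
      change _ = _ * AddMonoidAlgebra.single 0 (incl V r)
      induction v using mem_induction V.iSup_deg with
      | zero => simp
      | add x y hx hy => rw [smul_add, map_add, map_add, add_mul, hx, hy]
      | hom i v hv =>
        rw [coactionV_of_mem hv, coactionV_of_mem (right_smul_mem r hv),
          AddMonoidAlgebra.single_mul_single, ι_mul_incl, add_zero])

theorem coaction_of_mem {i : ℤ} {x : TRing V} (hx : x ∈ deg V i) :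
    coaction x = AddMonoidAlgebra.single i x := by
  induction hx using Submodule.span_induction with
  | zero => simp
  | add x y _ _ hx hy => rw [map_add, hx, hy, AddMonoidAlgebra.single_add]
  | smul c x _ hx => rw [map_smul, hx, AddMonoidAlgebra.smul_single]
  | mem x hx =>
    induction hx with
    | base r => exact lift_incl V _ _ _ _ r
    | cons hv _ ih =>
      have h1 : coaction (ι V _) = _ := (lift_ι V _ _ _ _ _).trans (coactionV_of_mem hv)
      rw [map_mul, ih, h1, AddMonoidAlgebra.single_mul_single]

instance : GradedAlgebra (deg V) where
  toDecomposition := (isInternal_of_components (ℳ := deg V) iSup_deg LinearMap.id (fun _ _ h => h)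
    ((AddMonoidAlgebra.coeffLinearEquiv k).toLinearMap ∘ₗ (coaction (V := V)).toLinearMap)
    (fun i x hx => by
      change (AddMonoidAlgebra.coeffLinearEquiv k) (coaction x) = _
      rw [coaction_of_mem hx]; rfl)).chooseDecomposition

end TRing
end TensorRing

/-! ### Homogeneous two-sided ideals and tensor presentations -/

section Ideals

variable {k : Type u} [CommRing k] {S : Type w} [Ring S] [Algebra k S]
  (𝒮 : ℤ → Submodule k S) [GradedAlgebra 𝒮]

theorem components_mul_left {p : ℤ} {s : S} (hs : s ∈ 𝒮 p) (x : S) (i : ℤ) :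
    components (DirectSum.Decomposition.isInternal 𝒮) (s * x) i
      = s * components (DirectSum.Decomposition.isInternal 𝒮) x (i - p) := by
  induction x using mem_induction (iSup_grading 𝒮) with
  | hom j x hx =>
    rw [components_of_mem _ hx, components_of_mem _ (SetLike.mul_mem_graded hs hx)]
    by_cases hij : i = p + j
    · subst hij; simp
    · rw [Finsupp.single_eq_of_ne hij, Finsupp.single_eq_of_ne (by omega), mul_zero]
  | zero => simp
  | add x y hx hy => simp only [mul_add, map_add, Finsupp.add_apply, hx, hy]

theorem components_mul_right {p : ℤ} {s : S} (hs : s ∈ 𝒮 p) (x : S) (i : ℤ) :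
    components (DirectSum.Decomposition.isInternal 𝒮) (x * s) i
      = components (DirectSum.Decomposition.isInternal 𝒮) x (i - p) * s := by
  induction x using mem_induction (iSup_grading 𝒮) with
  | hom j x hx =>
    rw [components_of_mem _ hx, components_of_mem _ (SetLike.mul_mem_graded hx hs)]
    by_cases hij : i = j + p
    · subst hij; simp
    · rw [Finsupp.single_eq_of_ne hij, Finsupp.single_eq_of_ne (by omega), zero_mul]
  | zero => simp
  | add x y hx hy => simp only [add_mul, map_add, Finsupp.add_apply, hx, hy]

/-- Homogeneous two-sided ideals of a graded algebra. -/
structure IsGrIdeal (I : Ideal S) : Prop where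
  twoSided : I.IsTwoSided
  homogeneous : ∀ x ∈ I, ∀ i, components (DirectSum.Decomposition.isInternal 𝒮) x i ∈ I

variable {𝒮}

namespace IsGrIdeal

variable {I J : Ideal S}

theorem top : IsGrIdeal 𝒮 (⊤ : Ideal S) := ⟨inferInstance, fun _ _ _ => trivial⟩

theorem inf (hI : IsGrIdeal 𝒮 I) (hJ : IsGrIdeal 𝒮 J) : IsGrIdeal 𝒮 (I ⊓ J) where
  twoSided := ⟨fun b h => ⟨hI.twoSided.mul_mem_of_left b h.1, hJ.twoSided.mul_mem_of_left b h.2⟩⟩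
  homogeneous x hx i := ⟨hI.homogeneous x hx.1 i, hJ.homogeneous x hx.2 i⟩

theorem sup (hI : IsGrIdeal 𝒮 I) (hJ : IsGrIdeal 𝒮 J) : IsGrIdeal 𝒮 (I ⊔ J) where
  twoSided := ⟨fun {a} b h => by
    obtain ⟨x, hx, y, hy, rfl⟩ := Submodule.mem_sup.mp h
    rw [add_mul]
    exact add_mem (Ideal.mem_sup_left (hI.twoSided.mul_mem_of_left b hx))
      (Ideal.mem_sup_right (hJ.twoSided.mul_mem_of_left b hy))⟩
  homogeneous z hz i := by
    obtain ⟨x, hx, y, hy, rfl⟩ := Submodule.mem_sup.mp hz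
    rw [map_add]
    exact add_mem (Ideal.mem_sup_left (hI.homogeneous x hx i))
      (Ideal.mem_sup_right (hJ.homogeneous y hy i))

theorem mul (hI : IsGrIdeal 𝒮 I) (hJ : IsGrIdeal 𝒮 J) : IsGrIdeal 𝒮 (I * J) where
  twoSided := by
    have := hJ.twoSided
    infer_instance
  homogeneous x hx := by
    induction hx using Submodule.smul_induction_on' with
    | smul x hx y hy =>
      rw [← sum_components (DirectSum.Decomposition.isInternal 𝒮) x]
      intro i
      rw [Finsupp.sum, Finset.sum_smul, map_sum, Finsupp.finsetSum_apply]
      refine Submodule.sum_mem _ fun p _ => ?_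
      rw [smul_eq_mul, components_mul_left 𝒮 (components_mem _ x p)]
      exact Ideal.mul_mem_mul (hI.homogeneous x hx p) (hJ.homogeneous y hy _)
    | add x _ y _ hx hy => intro i; rw [map_add]; exact add_mem (hx i) (hy i)

theorem pow (hI : IsGrIdeal 𝒮 I) : ∀ n : ℕ, IsGrIdeal 𝒮 (I ^ n)
  | 0 => by rw [Submodule.pow_zero, Ideal.one_eq_top]; exact top
  | n + 1 => by rw [Submodule.pow_succ]; exact (pow hI n).mul hI

end IsGrIdeal

theorem bimodAction_mem {R : Type v} [Ring R] [Algebra k R] (f : R →ₐ[k] S) (I : Ideal S)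
    (hI : IsGrIdeal 𝒮 I) (e : Env k R R) {x : S} (hx : x ∈ I) : bimodAction f f e x ∈ I := by
  induction e using TensorProduct.induction_on with
  | zero => simp
  | add e e' h h' => rw [map_add]; exact I.add_mem h h'
  | tmul a b =>
    obtain ⟨b, rfl⟩ := op_surjective b
    rw [bimodAction_tmul]
    exact hI.twoSided.mul_mem_of_left _ (I.mul_mem_left _ hx)

/-- A homogeneous two-sided ideal as a homogeneous sub-`R`-`R`-bimodule. -/
def Ideal.toBimod {R : Type v} [Ring R] [Algebra k R] (f : R →ₐ[k] S)
    (hf : ∀ i, ∀ r ∈ trivGr k R i, f r ∈ 𝒮 i) (I : Ideal S) (hI : IsGrIdeal 𝒮 I) :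
    Submodule (Env k R R) (bimod (𝒜 := trivGr k R) (ℬ := trivGr k R) 𝒮 f f hf hf).carrier where
  carrier := {x : S | x ∈ I}
  add_mem' := fun {a b} (ha : _ ∈ I) (hb : _ ∈ I) => I.add_mem ha hb
  zero_mem' := I.zero_mem
  smul_mem' := bimodAction_mem f I hI

end Ideals

section Presentation

variable {k : Type u} [CommRing k]

section
variable {R : Type v} [Ring R] [Algebra k R] (V : GrMod.{u, v, w} (envGr (trivGr k R) (trivGr k R)))

theorem TRing.incl_mem_deg (i : ℤ) (r : R) (hr : r ∈ trivGr k R i) :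
    TRing.incl V r ∈ TRing.deg V i := by
  by_cases hi : i = 0
  · subst hi; exact TRing.incl_mem r
  · have : r = 0 := by simpa [trivGr, hi] using hr
    rw [this, map_zero]; exact zero_mem _

/-- `T(V)` as a graded `R`-`R`-bimodule. -/
def TRing.toBimod : GrMod.{u, v, max u v w} (envGr (trivGr k R) (trivGr k R)) :=
  bimod (TRing.deg V) (TRing.incl V) (TRing.incl V) (TRing.incl_mem_deg V) (TRing.incl_mem_deg V)

/-- The graded `R`-`R`-bimodule `N / (D ∩ N)` for homogeneous two-sided ideals `N` and `D` of `T(V)`. -/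
def TRing.idealQuot (N D : Ideal (TRing V)) (hN : IsGrIdeal (TRing.deg V) N)
    (hD : IsGrIdeal (TRing.deg V) D) :
    GrMod.{u, v, max u v w} (envGr (trivGr k R) (trivGr k R)) :=
  (TRing.toBimod V).subquot
    (Ideal.toBimod (TRing.incl V) (TRing.incl_mem_deg V) N hN)
    (Ideal.toBimod (TRing.incl V) (TRing.incl_mem_deg V) D hD)
    hN.homogeneous hD.homogeneous

/-- The two-sided ideal `J` of `T(V)` generated by `V`. -/
def TRing.J : Ideal (TRing V) := (TwoSidedIdeal.span (Set.range (TRing.ι V))).asIdeal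

theorem TRing.isGrIdeal_J : IsGrIdeal (TRing.deg V) (TRing.J V) where
  twoSided := by unfold TRing.J; infer_instance
  homogeneous := by
    have hts : (TRing.J V).IsTwoSided := by unfold TRing.J; infer_instance
    let h := DirectSum.Decomposition.isInternal (TRing.deg V)
    let K : TwoSidedIdeal (TRing V) := TwoSidedIdeal.mk'
      {x | ∀ i, components h x i ∈ TRing.J V}
      (fun i => by rw [map_zero]; exact zero_mem _)
      (fun hx hy i => by rw [map_add]; exact add_mem (hx i) (hy i))
      (fun hx i => by rw [map_neg]; exact neg_mem (hx i))
      (fun {x y} hy => by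
        induction x using mem_induction (iSup_grading (TRing.deg V)) with
        | zero => intro i; simp
        | add x x' hx hx' => intro i; rw [add_mul, map_add]; exact add_mem (hx i) (hx' i)
        | hom p x hx =>
          intro i; rw [components_mul_left _ hx]; exact Ideal.mul_mem_left _ _ (hy _))
      (fun {x y} hx => by
        induction y using mem_induction (iSup_grading (TRing.deg V)) with
        | zero => intro i; simp
        | add y y' hy hy' => intro i; rw [mul_add, map_add]; exact add_mem (hy i) (hy' i)
        | hom p y hy =>
          intro i; rw [components_mul_right _ hy]; exact Ideal.mul_mem_right _ _ (hx _))
    have hK : TwoSidedIdeal.span (Set.range (TRing.ι V)) ≤ K := by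
      refine TwoSidedIdeal.span_le.mpr ?_
      rintro _ ⟨v, rfl⟩
      refine (TwoSidedIdeal.mem_mk' _ _ _ _ _ _ _).mpr ?_
      induction v using mem_induction V.iSup_deg with
      | zero => intro i; simp
      | add x y hx hy => intro i; rw [map_add, map_add]; exact add_mem (hx i) (hy i)
      | hom j v hv =>
        intro i
        rw [components_of_mem h (TRing.ι_mem hv)]
        by_cases hij : i = j
        · subst hij
          rw [Finsupp.single_eq_same]
          exact TwoSidedIdeal.subset_span ⟨v, rfl⟩
        · rw [Finsupp.single_eq_of_ne hij]; exact zero_mem _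
    intro x hx
    exact (TwoSidedIdeal.mem_mk' _ _ _ _ _ _ _).mp (hK hx)

variable {V} {I J : Ideal (TRing V)}

/-- The graded `R`-`R`-bimodule `(I^{p+1} ∩ J I^p J) / (J I^{p+1} + I^{p+1} J)`. -/
def TRing.evenQuot (hI : IsGrIdeal (TRing.deg V) I) (hJ : IsGrIdeal (TRing.deg V) J) (p : ℕ) :
    GrMod.{u, v, max u v w} (envGr (trivGr k R) (trivGr k R)) :=
  TRing.idealQuot V (I ^ (p + 1) ⊓ J * I ^ p * J) (J * I ^ (p + 1) ⊔ I ^ (p + 1) * J)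
    ((hI.pow (p + 1)).inf ((hJ.mul (hI.pow p)).mul hJ))
    ((hJ.mul (hI.pow (p + 1))).sup ((hI.pow (p + 1)).mul hJ))

/-- The graded `R`-`R`-bimodule `(J I^p ∩ I^p J) / (I^{p+1} + J I^p J)`. -/
def TRing.oddQuot (hI : IsGrIdeal (TRing.deg V) I) (hJ : IsGrIdeal (TRing.deg V) J) (p : ℕ) :
    GrMod.{u, v, max u v w} (envGr (trivGr k R) (trivGr k R)) :=
  TRing.idealQuot V (J * I ^ p ⊓ I ^ p * J) (I ^ (p + 1) ⊔ J * I ^ p * J)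
    ((hJ.mul (hI.pow p)).inf ((hI.pow p).mul hJ))
    ((hI.pow (p + 1)).sup ((hJ.mul (hI.pow p)).mul hJ))

end

variable {A : Type v} [Ring A] [Algebra k A]

/-- A tensor presentation `A ≅ T(V)/I` of a graded algebra with `A⁰ = R`: a positively graded
`R`-`R`-bimodule `V` and a surjective homomorphism `T(V) → A` of graded algebras that is the
identity on `R`. -/
structure TensorPresentation (𝒜 : ℤ → Submodule k A) [GradedAlgebra 𝒜] where
  V : GrMod.{u, v, w} (zeroEnvGr 𝒜)
  pos : ∀ i ≤ 0, V.deg i = ⊥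
  map : TRing V →ₐ[k] A
  map_incl : ∀ r : degZero 𝒜, map (TRing.incl V r) = r
  map_mem : ∀ i, ∀ x ∈ TRing.deg V i, map x ∈ 𝒜 i
  surjective : Function.Surjective map

namespace TensorPresentation

variable {𝒜 : ℤ → Submodule k A} [GradedAlgebra 𝒜] (T : TensorPresentation.{u, v, w} 𝒜)

/-- The ideal `J` of `T(V)` generated by `V`. -/
abbrev J : Ideal (TRing T.V) := TRing.J T.V

/-- The ideal `I` of relations of a tensor presentation. -/
def I : Ideal (TRing T.V) := RingHom.ker T.map

theorem isGrIdeal_I : IsGrIdeal (TRing.deg T.V) T.I where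
  twoSided := by unfold I; infer_instance
  homogeneous := by
    have key : ∀ x i, T.map (components (DirectSum.Decomposition.isInternal (TRing.deg T.V)) x i)
        = components (DirectSum.Decomposition.isInternal 𝒜) (T.map x) i := by
      intro x i
      induction x using mem_induction (iSup_grading (TRing.deg T.V)) with
      | hom j x hx =>
        rw [components_of_mem _ hx, components_of_mem _ (T.map_mem _ _ hx)]
        by_cases hij : i = j
        · subst hij; simp
        · rw [Finsupp.single_eq_of_ne hij, Finsupp.single_eq_of_ne hij, map_zero]
      | zero => simp
      | add x y hx hy => simp only [map_add, Finsupp.add_apply, hx, hy]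
    intro x hx i
    have hx' : T.map x = 0 := hx
    change T.map _ = 0
    rw [key, hx', map_zero, Finsupp.zero_apply]

end TensorPresentation

end Presentation

end

universe w₄

noncomputable section

/-! ### Generalities on graded modules -/

section GradedModules

variable {k : Type u} [CommRing k] {E : Type v} [Ring E] [Algebra k E] {ℰ : ℤ → Submodule k E}

namespace GrMod

/-! Write `E = A ⊗ Aᵒᵖ` and let `E⁺` be its part of positive degree. A separability idempotent of
`R` averages any `k`-linear splitting into an `R`-`R`-linear one, so over the field `k` every
`R`-`R`-bimodule is projective (`IsSeparableAlg.projective_env`). Induction `W ↦ A ⊗_R W ⊗_R A` is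
left adjoint to restriction, so it produces projective `E`-modules (`projective_ind`). An
`R`-`R`-section of `M → M / E⁺M` extends to a bimodule map `A ⊗_R (M / E⁺M) ⊗_R A → M`; for `M`
bounded below it is onto by the graded Nakayama lemma, and its kernel lies in the positive part
(`exists_minimal_cover`). Iterating on kernels gives a minimal resolution.

Now let `P → A` be any minimal resolution. As a complex of right `A`-modules it is contractible onto
`A`, so `P ⊗_A R = P / P A⁺` still resolves `R` (`GrProjRes.rightRes`). Since `R ⊗_A Y = Y / A⁺Y`,
minimality says that the differentials of `R ⊗_A P ⊗_A R` vanish, whence `Tor_m = P_m / E⁺P_m`. It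
remains to recover `P_m` from this quotient (`isomorphic_ind`). No lower bound on the degrees of
`P_m` is assumed, so Nakayama cannot be applied to `P_m` directly. Instead one maps `P_m` onto the
induced bimodule, splits this map, and notes that the kernel `K` satisfies `K = E⁺K` inside a
projective module, which forces `K = 0` (`eq_zero_of_le_positive`). The bound needed for the induced
bimodule is obtained by induction on `m` (`exists_deg_le_positivePart`).

For a presentation `A = T/I` with `T = T(V)`, consider the ideals `N_0, N_1, N_2, … = T, J, I, IJ,
I², I²J, …`, for which `N_{m+2} = I N_m`. The inclusions `N_{m+1} ⊆ N_m` induce a complex with terms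
`N_m / I N_m`, and its exactness is immediate from `I N_m = N_{m+2}`. The terms are projective over
`A ⊗ Rᵒᵖ` because a homogeneous two-sided ideal of a tensor algebra is projective relative to `R`
(`TRing.exists_ideal_section`, `projective_idealQuot`). Applying `R ⊗_A -` replaces the terms by
`N_m / J N_m`, so that `Tor_{m+1} = (N_{m+1} ∩ J N_m) / (J N_{m+1} + N_{m+2})`; the even and odd
cases of this are the two formulas. Comparison of resolutions (`tor_isomorphic`) transfers
everything to an arbitrary `Q`. -/

theorem sum_components_smul (M : GrMod.{u, v, w} ℰ) {N : Submodule E M.carrier} {x : M.carrier}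
    (h : ∀ i, components M.internal x i ∈ N) : x ∈ N := by
  rw [← sum_components M.internal x]
  exact Submodule.sum_mem _ fun i _ => h i

/-- A graded map commutes with taking homogeneous components, so its inverse is automatically
graded. -/
theorem Isomorphic.of_bijective {M : GrMod.{u, v, w₁} ℰ} {N : GrMod.{u, v, w₂} ℰ}
    (f : M.carrier →ₗ[E] N.carrier) (hf : IsGrHom f) (hb : Function.Bijective f) :
    M.Isomorphic N := by
  refine ⟨LinearEquiv.ofBijective f hb, fun i x => ⟨fun h => ?_, fun h => hf i x h⟩⟩
  have h1 : components N.internal (f x) i = f x := by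
    rw [components_of_mem N.internal (show f x ∈ N.deg i from h), Finsupp.single_eq_same]
  rw [← map_components f hf] at h1
  rw [← hb.1 h1]
  exact components_mem _ _ _

theorem Isomorphic.symm {M : GrMod.{u, v, w₁} ℰ} {N : GrMod.{u, v, w₂} ℰ} (h : M.Isomorphic N) :
    N.Isomorphic M := by
  obtain ⟨e, he⟩ := h
  exact ⟨e.symm, fun i x => by rw [← he, e.apply_symm_apply]⟩

theorem Isomorphic.trans {M : GrMod.{u, v, w₁} ℰ} {N : GrMod.{u, v, w₂} ℰ}
    {L : GrMod.{u, v, w₃} ℰ} (h : M.Isomorphic N) (h' : N.Isomorphic L) : M.Isomorphic L := by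
  obtain ⟨e, he⟩ := h
  obtain ⟨e', he'⟩ := h'
  exact ⟨e.trans e', fun i x => by rw [← he, ← he']; rfl⟩

/-- The degree-zero part of a linear map between graded modules. -/
theorem exists_degreeZeroPart (hE : ⨆ i, ℰ i = ⊤) {M : GrMod.{u, v, w₁} ℰ} {N : GrMod.{u, v, w₂} ℰ}
    (f : M.carrier →ₗ[E] N.carrier) :
    ∃ g : M.carrier →ₗ[E] N.carrier, ∀ i, ∀ x ∈ M.deg i, g x = components N.internal (f x) i := by
  -- The sum over `i` of the `i`-th component of `f` evaluated on the `i`-th component of the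
  -- argument. It commutes with a homogeneous `e` of degree `p` because `e` shifts both indices by
  -- `p`.
  let g : M.carrier →ₗ[k] N.carrier :=
    (Finsupp.lsum k fun i => Finsupp.lapply i ∘ₗ components N.internal ∘ₗ f.restrictScalars k) ∘ₗ
      components M.internal
  have hg : ∀ i, ∀ x ∈ M.deg i, g x = components N.internal (f x) i := by
    intro i x hx
    simp only [g, LinearMap.comp_apply, components_of_mem _ hx, Finsupp.lsum_single]
    rfl
  refine ⟨{ toFun := g, map_add' := map_add g, map_smul' := fun e x => ?_ }, hg⟩
  change g (e • x) = e • g x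
  induction e using mem_induction hE with
  | zero => simp
  | add e e' h h' => simp only [add_smul, map_add, h, h']
  | hom p e he =>
    induction x using mem_induction M.iSup_deg with
    | zero => simp
    | add x y h h' => simp only [smul_add, map_add, h, h']
    | hom i x hx =>
      rw [hg _ _ hx, hg _ _ (M.smul_mem he hx), map_smul, components_smul _ he]
      congr 2
      ring

/-- Graded lifting property of graded projective modules. -/
theorem exists_lift (hE : ⨆ i, ℰ i = ⊤) {X : GrMod.{u, v, w₁} ℰ} {Y : GrMod.{u, v, w₂} ℰ}
    {Z : GrMod.{u, v, w₃} ℰ} (hX : Module.Projective E X.carrier)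
    (p : Y.carrier →ₗ[E] Z.carrier) (hp : IsGrHom p) (f : X.carrier →ₗ[E] Z.carrier)
    (hf : IsGrHom f) (h : ∀ x, f x ∈ LinearMap.range p) :
    ∃ g : X.carrier →ₗ[E] Y.carrier, IsGrHom g ∧ ∀ x, p (g x) = f x := by
  obtain ⟨g, hg⟩ := Module.projective_lifting_property p.rangeRestrict (f.codRestrict _ h)
    p.surjective_rangeRestrict
  have hg' : ∀ x, p (g x) = f x := fun x => congrArg Subtype.val (LinearMap.congr_fun hg x)
  -- The degree-zero part of an ungraded lift is again a lift, since `p` and `f` are homogeneous of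
  -- degree `0`.
  obtain ⟨g₀, hg₀⟩ := exists_degreeZeroPart hE g
  refine ⟨g₀, fun i x hx => ?_, fun x => ?_⟩
  · rw [hg₀ _ _ hx]; exact components_mem _ _ _
  · induction x using mem_induction X.iSup_deg with
    | zero => simp
    | add x y h h' => simp only [map_add, h, h']
    | hom i x hx =>
      rw [hg₀ _ _ hx, map_components p hp, hg', components_of_mem _ (hf _ _ hx),
        Finsupp.single_eq_same]

/-- A graded map `Z → N` which is onto modulo `D` identifies `N / (D ∩ N)` with a quotient of
`Z`. -/
theorem subquot_isomorphic {X : GrMod.{u, v, w₁} ℰ} {Z : GrMod.{u, v, w₂} ℰ}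
    (N D : Submodule E X.carrier) (hN : X.IsHomogeneous N) (hD : X.IsHomogeneous D)
    (D' : Submodule E Z.carrier) (hD' : Z.IsHomogeneous D')
    (f : Z.carrier →ₗ[E] X.carrier) (hf : IsGrHom f) (h1 : ∀ z, f z ∈ N)
    (h2 : ∀ x ∈ N, ∃ z, f z - x ∈ D) (h3 : ∀ z, f z ∈ D ↔ z ∈ D') :
    (X.subquot N D hN hD).Isomorphic (Z.quot D' hD') := by
  refine Isomorphic.symm ?_
  let f₁ : Z.carrier →ₗ[E] (X.sub N hN).carrier := f.codRestrict N h1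
  let F : (Z.quot D' hD').carrier →ₗ[E] (X.subquot N D hN hD).carrier :=
    Submodule.mapQ D' (D.comap (X.subIncl N hN)) f₁ (fun z hz => (h3 z).2 hz)
  have hF : ∀ z, F (D'.mkQ z) = (D.comap (X.subIncl N hN)).mkQ (f₁ z) := fun z => rfl
  refine Isomorphic.of_bijective F ?_ ⟨?_, ?_⟩
  · rintro i _ ⟨z, hz, rfl⟩
    exact ⟨f₁ z, hf _ _ hz, rfl⟩
  · refine (injective_iff_map_eq_zero F).2 fun z hz => ?_
    obtain ⟨z, rfl⟩ := D'.mkQ_surjective z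
    rw [hF] at hz
    refine (Submodule.Quotient.mk_eq_zero D').2 ((h3 z).1 ?_)
    exact (Submodule.Quotient.mk_eq_zero (D.comap (X.subIncl N hN))).1 hz
  · intro y
    obtain ⟨x, rfl⟩ := (D.comap (X.subIncl N hN)).mkQ_surjective y
    obtain ⟨z, hz⟩ := h2 x.1 x.2
    refine ⟨D'.mkQ z, ?_⟩
    rw [hF]
    exact (Submodule.Quotient.eq _).2 hz

/-- Restriction of a graded module along a graded algebra homomorphism. -/
def restrict {E' : Type w₁} [Ring E'] [Algebra k E'] {ℰ' : ℤ → Submodule k E'} (φ : E' →ₐ[k] E)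
    (hφ : ∀ i, ∀ e ∈ ℰ' i, φ e ∈ ℰ i) (M : GrMod.{u, v, w} ℰ) : GrMod.{u, w₁, w} ℰ' where
  carrier := M.carrier
  module := Module.compHom _ φ.toRingHom
  tower := by
    let _ := Module.compHom M.carrier φ.toRingHom
    refine ⟨fun c e s => ?_⟩
    change φ (c • e) • s = c • φ e • s
    rw [map_smul, smul_assoc]
  deg := M.deg
  internal := M.internal
  smul_mem he hx := M.smul_mem (hφ _ _ he) hx

end GrMod

end GradedModules

/-! ### Chain maps and homotopies -/

section Complexes

/-- Dependent choice with an invariant `P` that guarantees the next step. Chain maps and homotopies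
are both built this way. -/
theorem exists_seq_of_step {α : ℕ → Type*} (P : ∀ m, α m → Prop) (r : ∀ m, α m → α (m + 1) → Prop)
    (a : α 0) (h0 : P 0 a) (hs : ∀ m a, P m a → ∃ b, P (m + 1) b ∧ r m a b) :
    ∃ f : ∀ m, α m, f 0 = a ∧ (∀ m, P m (f m)) ∧ ∀ m, r m (f m) (f (m + 1)) := by
  choose g hg using hs
  let F : ∀ m, {a : α m // P m a} := fun m =>
    Nat.rec ⟨a, h0⟩ (fun m a => ⟨g m a.1 a.2, (hg m a.1 a.2).1⟩) m
  exact ⟨fun m => (F m).1, rfl, fun m => (F m).2, fun m => (hg m (F m).1 (F m).2).2⟩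

/-- A chain map from a complex of projectives to an exact complex is null-homotopic if it lifts
zero. -/
theorem exists_nullHomotopy {S : Type v} [Ring S] {X : ℕ → Type w₁} {Y : ℕ → Type w₂}
    [∀ m, AddCommGroup (X m)] [∀ m, Module S (X m)] [∀ m, AddCommGroup (Y m)]
    [∀ m, Module S (Y m)] (dX : ∀ m, X (m + 1) →ₗ[S] X m) (dY : ∀ m, Y (m + 1) →ₗ[S] Y m)
    (hX : ∀ m, Module.Projective S (X m))
    (hY : ∀ m, Function.Exact (dY (m + 1)) (dY m))
    (hd : ∀ m x, dX m (dX (m + 1) x) = 0) (φ : ∀ m, X m →ₗ[S] Y m) (hφ : ∀ m x, dY m (φ (m + 1) x) = φ m (dX m x))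
    (h0 : ∀ x, φ 0 x ∈ LinearMap.range (dY 0)) :
    ∃ h : ∀ m, X m →ₗ[S] Y (m + 1), (∀ x, dY 0 (h 0 x) = φ 0 x) ∧
      ∀ m x, dY (m + 1) (h (m + 1) x) + h m (dX m x) = φ (m + 1) x := by
  have lift : ∀ m (ψ : X m →ₗ[S] Y m), (∀ x, ψ x ∈ LinearMap.range (dY m)) →
      ∃ h : X m →ₗ[S] Y (m + 1), ∀ x, dY m (h x) = ψ x := by
    intro m ψ hψ
    have := hX m
    obtain ⟨g, hg⟩ := Module.projective_lifting_property (dY m).rangeRestrict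
      (ψ.codRestrict _ hψ) (dY m).surjective_rangeRestrict
    exact ⟨g, fun x => congrArg Subtype.val (LinearMap.congr_fun hg x)⟩
  obtain ⟨a, ha⟩ := lift 0 (φ 0) h0
  -- The invariant `d h d = φ d` says that `φ - h d` takes values in the cycles one degree higher,
  -- hence can be lifted through the next differential.
  obtain ⟨h, rfl, hh, hs⟩ := exists_seq_of_step (α := fun m => X m →ₗ[S] Y (m + 1))
    (fun m h => ∀ x, dY m (h (dX m x)) = φ m (dX m x))
    (fun m h h' => ∀ x, dY (m + 1) (h' x) + h (dX m x) = φ (m + 1) x) a (fun x => ha _) (by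
      intro m h hh
      obtain ⟨h', hh'⟩ := lift (m + 1) (φ (m + 1) - h ∘ₗ dX m) (fun x => by
        refine (hY m _).1 ?_
        simp [hφ, hh])
      refine ⟨h', fun x => ?_, fun x => by rw [hh']; simp⟩
      rw [hh']
      simp [hd])
  exact ⟨h, ha, hs⟩

namespace GrProjRes

variable {k : Type u} [CommRing k] {E : Type v} [Ring E] [Algebra k E] {ℰ : ℤ → Submodule k E}
  {M : GrMod.{u, v, w} ℰ}

theorem d_d (P : GrProjRes.{u, v, w, w₁} M) (m : ℕ) (x : (P.X (m + 1 + 1)).carrier) :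
    P.d m (P.d (m + 1) x) = 0 :=
  (P.exact m _).2 ⟨x, rfl⟩

theorem aug_d (P : GrProjRes.{u, v, w, w₁} M) (x : (P.X 1).carrier) : P.aug (P.d 0 x) = 0 :=
  (P.exact_aug _).2 ⟨x, rfl⟩

/-- Two resolutions of the same module are connected by a graded chain map. -/
theorem exists_chainMap (hE : ⨆ i, ℰ i = ⊤) (P : GrProjRes.{u, v, w, w₁} M)
    (Q : GrProjRes.{u, v, w, w₂} M) :
    ∃ f : ∀ m, (P.X m).carrier →ₗ[E] (Q.X m).carrier, (∀ x, Q.aug (f 0 x) = P.aug x) ∧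
      (∀ m, GrMod.IsGrHom (f m)) ∧ ∀ m x, Q.d m (f (m + 1) x) = f m (P.d m x) := by
  obtain ⟨a, ha, ha'⟩ := GrMod.exists_lift hE (P.projective 0) Q.aug Q.aug_gr P.aug P.aug_gr
    (fun x => Q.surjective_aug _)
  -- The invariant: `f` is graded and sends boundaries to boundaries, which is what lets `f ∘ d` be
  -- lifted through the differential of `Q`.
  obtain ⟨f, rfl, h1, h2⟩ := exists_seq_of_step
    (α := fun m => (P.X m).carrier →ₗ[E] (Q.X m).carrier)
    (fun m f => GrMod.IsGrHom f ∧ ∀ x, f (P.d m x) ∈ LinearMap.range (Q.d m))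
    (fun m f g => ∀ x, Q.d m (g x) = f (P.d m x)) a
    ⟨ha, fun x => (Q.exact_aug _).1 (by rw [ha', P.aug_d])⟩ (by
      rintro m f ⟨hf, hr⟩
      obtain ⟨g, hg, hg'⟩ := GrMod.exists_lift hE (P.projective (m + 1)) (Q.d m) (Q.d_gr m)
        (f ∘ₗ P.d m) (fun i x hx => hf _ _ (P.d_gr m _ _ hx)) hr
      refine ⟨g, ⟨hg, fun x => (Q.exact m _).1 ?_⟩, hg'⟩
      rw [hg', LinearMap.comp_apply, P.d_d, map_zero])
  exact ⟨f, ha', fun m => (h1 m).1, h2⟩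

/-- A chain map of resolutions lifting the identity is homotopic to the identity. -/
theorem exists_homotopy (P : GrProjRes.{u, v, w, w₁} M)
    (f : ∀ m, (P.X m).carrier →ₗ[E] (P.X m).carrier) (h0 : ∀ x, P.aug (f 0 x) = P.aug x)
    (hf : ∀ m x, P.d m (f (m + 1) x) = f m (P.d m x)) :
    ∃ h : ∀ m, (P.X m).carrier →ₗ[E] (P.X (m + 1)).carrier, (∀ x, P.d 0 (h 0 x) = f 0 x - x) ∧
      ∀ m x, P.d (m + 1) (h (m + 1) x) + h m (P.d m x) = f (m + 1) x - x :=
  exists_nullHomotopy P.d P.d P.projective P.exact P.d_d (fun m => f m - LinearMap.id)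
    (fun m x => by simp [hf]) (fun x => (P.exact_aug _).1 (by simp [h0]))

end GrProjRes

end Complexes

/-! ### The tensor product `M ⊗_B N` -/

section Tensor

variable {k : Type u} [CommRing k]
variable {A : Type v} {B : Type w} {C : Type w₁} [Ring A] [Algebra k A] [Ring B] [Algebra k B]
  [Ring C] [Algebra k C]
  {𝒜 : ℤ → Submodule k A} {ℬ : ℤ → Submodule k B} {𝒞 : ℤ → Submodule k C}
  [GradedAlgebra 𝒜] [GradedAlgebra ℬ] [GradedAlgebra 𝒞]

variable (M : GrMod.{u, max v w, w₂} (envGr 𝒜 ℬ)) (N : GrMod.{u, max w w₁, w₃} (envGr ℬ 𝒞))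

/-- The elementary tensors of `M ⊗_B N`. -/
def tt : M.carrier →ₗ[k] N.carrier →ₗ[k] (tens M N).carrier :=
  LinearMap.compr₂ (tm M N) ((balancingSubmodule M N).mkQ.restrictScalars k)

variable {M N}

omit [GradedAlgebra 𝒜] [GradedAlgebra 𝒞] in
theorem smul_tm (a : A) (c : C) (m : M.carrier) (n : N.carrier) :
    (a ⊗ₜ[k] op c : Env k A C) • tm M N m n
      = tm M N ((a ⊗ₜ[k] (1 : Bᵐᵒᵖ)) • m) (((1 : B) ⊗ₜ[k] op c) • n) :=
  tensAction_tmul a c m n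

theorem smul_tt (a : A) (c : C) (m : M.carrier) (n : N.carrier) :
    (a ⊗ₜ[k] op c : Env k A C) • tt M N m n
      = tt M N ((a ⊗ₜ[k] (1 : Bᵐᵒᵖ)) • m) (((1 : B) ⊗ₜ[k] op c) • n) :=
  congrArg (balancingSubmodule M N).mkQ (smul_tm a c m n)

theorem tt_balance (m : M.carrier) (b : B) (n : N.carrier) :
    tt M N (((1 : A) ⊗ₜ[k] op b) • m) n = tt M N m ((b ⊗ₜ[k] (1 : Cᵐᵒᵖ)) • n) :=
  (Submodule.Quotient.eq (balancingSubmodule M N)).2 (Submodule.subset_span ⟨m, b, n, rfl⟩)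

theorem tt_mem {p q n : ℤ} (h : p + q = n) {x : M.carrier} {y : N.carrier} (hx : x ∈ M.deg p)
    (hy : y ∈ N.deg q) : tt M N x y ∈ (tens M N).deg n :=
  ⟨tm M N x y, tm_mem h hx hy, rfl⟩

theorem tens_induction {p : (tens M N).carrier → Prop} (tt : ∀ m n, p (tt M N m n)) (zero : p 0)
    (add : ∀ x y, p x → p y → p (x + y)) (x : (tens M N).carrier) : p x := by
  obtain ⟨z, rfl⟩ := (balancingSubmodule M N).mkQ_surjective x
  induction z using TensorProduct.induction_on with
  | zero => exact zero
  | add x y hx hy => exact add _ _ hx hy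
  | tmul m n => exact tt m n

theorem tens_deg_le {n : ℤ} {S : Submodule k (tens M N).carrier}
    (h : ∀ p q, p + q = n → ∀ x ∈ M.deg p, ∀ y ∈ N.deg q, tt M N x y ∈ S) :
    (tens M N).deg n ≤ S := by
  rintro _ ⟨z, hz, rfl⟩
  have : (ktens M N).deg n ≤ S.comap ((balancingSubmodule M N).mkQ.restrictScalars k) := by
    refine Submodule.span_le.mpr ?_
    rintro _ ⟨p, q, hpq, x, hx, y, hy, rfl⟩
    exact h p q hpq x hx y hy
  exact this hz

omit [GradedAlgebra 𝒜] [GradedAlgebra 𝒞] in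
-- The element `a ⊗ cᵒᵖ` carries the balancing element of `(m, b, n)` to that of `(a m, b, n c)`.
-- The sub-bimodule generated by the balancing elements is therefore already their additive span, so
-- that maps which are only `k`-linear can be defined on `M ⊗_B N`.
theorem balancingSubmodule_le {S : Submodule k (ktens M N).carrier}
    (h : ∀ m b n, balancing M N m b n ∈ S) {z : (ktens M N).carrier}
    (hz : z ∈ balancingSubmodule M N) : z ∈ S := by
  have key : ∀ (e : Env k A C) m b n, e • balancing M N m b n ∈ S := by
    intro e m b n
    induction e using TensorProduct.induction_on with
    | zero => exact (zero_smul (Env k A C) (balancing M N m b n)).symm ▸ zero_mem S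
    | add x y hx hy => exact (add_smul x y (balancing M N m b n)).symm ▸ add_mem hx hy
    | tmul a c =>
      obtain ⟨c, rfl⟩ := op_surjective c
      have : (a ⊗ₜ[k] op c : Env k A C) • balancing M N m b n
          = balancing M N ((a ⊗ₜ[k] (1 : Bᵐᵒᵖ)) • m) b (((1 : B) ⊗ₜ[k] op c) • n) := by
        simp only [balancing, smul_sub, smul_tm, smul_smul, Algebra.TensorProduct.tmul_mul_tmul,
          mul_one, one_mul]
      rw [this]; exact h _ _ _
  induction hz using Submodule.closure_induction with
  | zero => exact zero_mem _
  | add x y _ _ hx hy => exact add_mem hx hy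
  | smul_mem e x hx =>
    obtain ⟨m, b, n, rfl⟩ := hx
    exact key _ _ _ _

/-- The map out of `M ⊗_B N` given by a balanced bilinear map. -/
def tensLift {L : Type*} [AddCommGroup L] [Module k L] (f : M.carrier →ₗ[k] N.carrier →ₗ[k] L)
    (hf : ∀ (m : M.carrier) (b : B) (n : N.carrier),
      f (((1 : A) ⊗ₜ[k] op b) • m) n = f m ((b ⊗ₜ[k] (1 : Cᵐᵒᵖ)) • n)) :
    (tens M N).carrier →ₗ[k] L :=
  let g : (ktens M N).carrier →ₗ[k] L := TensorProduct.lift f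
  have hg : ∀ m n, g (tm M N m n) = f m n := fun m n => TensorProduct.lift.tmul m n
  { (QuotientAddGroup.lift (balancingSubmodule M N).toAddSubgroup g.toAddMonoidHom (by
      intro z hz
      refine balancingSubmodule_le (S := LinearMap.ker g) (fun m b n => ?_) hz
      rw [LinearMap.mem_ker, balancing, map_sub, hg, hg, hf, sub_self])) with
    map_smul' := fun c x => by
      obtain ⟨z, rfl⟩ := (balancingSubmodule M N).mkQ_surjective x
      exact map_smul g c z }

theorem tensLift_tt {L : Type*} [AddCommGroup L] [Module k L]
    (f : M.carrier →ₗ[k] N.carrier →ₗ[k] L)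
    (hf : ∀ (m : M.carrier) (b : B) (n : N.carrier),
      f (((1 : A) ⊗ₜ[k] op b) • m) n = f m ((b ⊗ₜ[k] (1 : Cᵐᵒᵖ)) • n))
    (m : M.carrier) (n : N.carrier) : tensLift f hf (tt M N m n) = f m n :=
  TensorProduct.lift.tmul m n

variable (M) {N' : GrMod.{u, max w w₁, w₃} (envGr ℬ 𝒞)}

variable {N'' : GrMod.{u, max w w₁, w₄} (envGr ℬ 𝒞)}

theorem compl₂_balanced (f : N.carrier →ₗ[Env k B C] N''.carrier) (m : M.carrier) (b : B)
    (n : N.carrier) : (tt M N'').compl₂ (f.restrictScalars k) (((1 : A) ⊗ₜ[k] op b) • m) n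
        = (tt M N'').compl₂ (f.restrictScalars k) m ((b ⊗ₜ[k] (1 : Cᵐᵒᵖ)) • n) :=
  (tt_balance m b (f n)).trans (congrArg (tt M N'' m) (map_smul f _ n).symm)

/-- The map `m ⊗ n ↦ m ⊗ f n`, for modules in different universes. -/
def tensMapₕ (f : N.carrier →ₗ[Env k B C] N''.carrier) :
    (tens M N).carrier →ₗ[Env k A C] (tens M N'').carrier :=
  let g : (tens M N).carrier →ₗ[k] (tens M N'').carrier := tensLift _ (compl₂_balanced M f)
  { g with
    map_smul' := fun e x => by
      change g (e • x) = e • g x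
      have hg : ∀ m n, g (tt M N m n) = tt M N'' m (f n) := fun m n => tensLift_tt _ (compl₂_balanced M f) m n
      induction x using tens_induction with
      | zero => rw [smul_zero, map_zero, smul_zero]
      | add x y hx hy => rw [smul_add, map_add, hx, hy, map_add, smul_add]
      | tt m n =>
        induction e using TensorProduct.induction_on with
        | zero =>
          refine (congrArg g (zero_smul (Env k A C) (tt M N m n))).trans ?_
          exact (map_zero g).trans (zero_smul (Env k A C) (g (tt M N m n))).symm
        | add x y hx hy =>
          refine (congrArg g (add_smul x y (tt M N m n))).trans ?_
          rw [map_add, hx, hy]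
          exact (add_smul x y (g (tt M N m n))).symm
        | tmul a c =>
          obtain ⟨c, rfl⟩ := op_surjective c
          rw [smul_tt, hg, hg, smul_tt]
          exact congrArg (tt M N'' _) (map_smul f _ n) }

theorem tensMapₕ_tt (f : N.carrier →ₗ[Env k B C] N''.carrier) (m : M.carrier) (n : N.carrier) :
    tensMapₕ M f (tt M N m n) = tt M N'' m (f n) :=
  tensLift_tt _ (compl₂_balanced M f) m n

theorem isGrHom_tensMapₕ {f : N.carrier →ₗ[Env k B C] N''.carrier} (hf : GrMod.IsGrHom f) :
    GrMod.IsGrHom (tensMapₕ M f) := by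
  intro i x hx
  have : (tens M N).deg i ≤ ((tens M N'').deg i).comap ((tensMapₕ M f).restrictScalars k) :=
    tens_deg_le fun p q hpq x hx y hy => by
      rw [Submodule.mem_comap, LinearMap.coe_restrictScalars, tensMapₕ_tt]
      exact tt_mem hpq hx (hf _ _ hy)
  exact this hx

end Tensor

/-! ### Independence of `Tor` of the resolution -/

section Tor

variable {k : Type u} [CommRing k] {A : Type v} [Ring A] [Algebra k A]
  {𝒜 : ℤ → Submodule k A} [GradedAlgebra 𝒜] [SeparablyAugmented 𝒜]

section
variable (Q : GrProjRes.{u, v, v, w} (resAR 𝒜))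

/-- The elementary tensors of `R ⊗_A Q_m`. -/
def torTt (m : ℕ) : (resRA 𝒜).carrier →ₗ[k] (Q.X m).carrier →ₗ[k] (torTerm Q m).carrier :=
  tt (resRA 𝒜) (Q.X m)

theorem torTerm_induction {m : ℕ} {p : (torTerm Q m).carrier → Prop}
    (tt : ∀ r x, p (torTt Q m r x)) (zero : p 0) (add : ∀ x y, p x → p y → p (x + y))
    (x : (torTerm Q m).carrier) : p x :=
  tens_induction tt zero add x

theorem torD_tt (m : ℕ) (r : (resRA 𝒜).carrier) (x : (Q.X (m + 1)).carrier) :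
    torD Q m (torTt Q (m + 1) r x) = torTt Q m r (Q.d m x) := rfl

theorem torTerm_hom_ext {m : ℕ} {L : Type*} [AddCommGroup L]
    [Module (Env k (degZero 𝒜) (degZero 𝒜)) L]
    {f g : (torTerm Q m).carrier →ₗ[Env k (degZero 𝒜) (degZero 𝒜)] L}
    (h : ∀ r x, f (torTt Q m r x) = g (torTt Q m r x)) : f = g := by
  refine LinearMap.ext fun x => ?_
  induction x using torTerm_induction with
  | tt r x => exact h r x
  | zero => rw [map_zero, map_zero]
  | add x y hx hy => rw [map_add, map_add, hx, hy]

end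

section
variable (Q : GrProjRes.{u, v, v, w₁} (resAR 𝒜)) (Q' : GrProjRes.{u, v, v, w₂} (resAR 𝒜))

variable {Q Q'} in
/-- The map `R ⊗_A Q_m → R ⊗_A Q'_n` induced by a map `Q_m → Q'_n`. -/
def torMap {m n : ℕ} (f : (Q.X m).carrier →ₗ[Env k A (degZero 𝒜)] (Q'.X n).carrier) :
    (torTerm Q m).carrier →ₗ[Env k (degZero 𝒜) (degZero 𝒜)] (torTerm Q' n).carrier :=
  tensMapₕ (resRA 𝒜) f

variable {Q Q'} in
theorem torMap_tt {m n : ℕ} (f : (Q.X m).carrier →ₗ[Env k A (degZero 𝒜)] (Q'.X n).carrier)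
    (r : (resRA 𝒜).carrier) (x : (Q.X m).carrier) :
    torMap f (torTt Q m r x) = torTt Q' n r (f x) :=
  tensMapₕ_tt _ f r x

variable {f : ∀ m, (Q.X m).carrier →ₗ[Env k A (degZero 𝒜)] (Q'.X m).carrier}
  {g : ∀ m, (Q'.X m).carrier →ₗ[Env k A (degZero 𝒜)] (Q.X m).carrier}

theorem torD_torMap (hf : ∀ m x, Q'.d m (f (m + 1) x) = f m (Q.d m x)) (m : ℕ)
    (x : (torTerm Q (m + 1)).carrier) : torD Q' m (torMap (f (m + 1)) x)
      = torMap (f m) (torD Q m x) :=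
  LinearMap.congr_fun (f := torD Q' m ∘ₗ torMap (f (m + 1))) (g := torMap (f m) ∘ₗ torD Q m)
    (torTerm_hom_ext Q fun r x => by
      simp only [LinearMap.comp_apply, torMap_tt, torD_tt, hf]) x

theorem torMap_mem_torCycles (hf : ∀ m x, Q'.d m (f (m + 1) x) = f m (Q.d m x)) :
    ∀ m, ∀ x ∈ torCycles Q m, torMap (f m) x ∈ torCycles Q' m
  | 0, _, _ => trivial
  | m + 1, x, hx => by
    have hx' : torD Q m x = 0 := hx
    exact (torD_torMap Q Q' hf m x).trans (by rw [hx', map_zero])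

set_option maxHeartbeats 800000 in
-- A homotopy `h` from the identity to `g f` survives the functor `R ⊗_A -`, and on cycles the
-- summand `h d` vanishes; what remains is a boundary.
theorem torMap_torMap_sub_mem (f0 : ∀ x, Q'.aug (f 0 x) = Q.aug x)
    (g0 : ∀ x, Q.aug (g 0 x) = Q'.aug x) (hf : ∀ m x, Q'.d m (f (m + 1) x) = f m (Q.d m x))
    (hg : ∀ m x, Q.d m (g (m + 1) x) = g m (Q'.d m x)) (m : ℕ) (x : (torTerm Q m).carrier)
    (hx : x ∈ torCycles Q m) :
    torMap (g m) (torMap (f m) x) - x ∈ LinearMap.range (torD Q m) := by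
  obtain ⟨h, h0, hs⟩ := Q.exists_homotopy (fun m => g m ∘ₗ f m) (by simp [f0, g0])
    (by simp [hf, hg])
  cases m with
  | zero =>
    refine ⟨torMap (h 0) x, eq_sub_of_add_eq ?_⟩
    clear hx
    induction x using torTerm_induction with
    | zero => simp only [LinearMap.map_zero, add_zero]
    | add x y hx hy => simp only [LinearMap.map_add, ← hx, ← hy]; abel
    | tt r x =>
      have e : torTt Q 0 r (Q.d 0 (h 0 x)) + torTt Q 0 r x = torTt Q 0 r (g 0 (f 0 x)) := by
        rw [← (torTt Q 0 r).map_add, h0, LinearMap.comp_apply, sub_add_cancel]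
      rw [torMap_tt, torD_tt, torMap_tt, torMap_tt, e]
  | succ m =>
    refine ⟨torMap (h (m + 1)) x, eq_sub_of_add_eq ?_⟩
    have key : torD Q (m + 1) (torMap (h (m + 1)) x) + torMap (h m) (torD Q m x) + x
        = torMap (g (m + 1)) (torMap (f (m + 1)) x) := by
      clear hx
      induction x using torTerm_induction with
      | zero => simp only [LinearMap.map_zero, add_zero]
      | add x y hx hy => simp only [LinearMap.map_add, ← hx, ← hy]; abel
      | tt r x =>
        have e : torTt Q (m + 1) r (Q.d (m + 1) (h (m + 1) x)) + torTt Q (m + 1) r (h m (Q.d m x))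
            + torTt Q (m + 1) r x = torTt Q (m + 1) r (g (m + 1) (f (m + 1) x)) := by
          rw [← (torTt Q (m + 1) r).map_add, hs, ← (torTt Q (m + 1) r).map_add,
            LinearMap.comp_apply, sub_add_cancel]
        rw [torMap_tt, torD_tt, torMap_tt, torMap_tt, torD_tt, torMap_tt, e]
    have hx' : torD Q m x = 0 := hx
    rwa [hx', LinearMap.map_zero, add_zero] at key

/-- `Tor^A(R, R)` does not depend on the resolution. -/
theorem tor_isomorphic (m : ℕ) : (Tor Q m).Isomorphic (Tor Q' m) := by
  have hE := iSup_envGr (iSup_grading 𝒜) (iSup_grading (trivGr k (degZero 𝒜)))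
  obtain ⟨f, f0, fgr, fd⟩ := Q'.exists_chainMap hE Q
  obtain ⟨g, g0, -, gd⟩ := Q.exists_chainMap hE Q'
  -- The cycles for `Q'` are mapped by `f : Q' → Q`. A cycle `x` for `Q` is reached, up to a
  -- boundary, from `g x`; and if `f z` is a boundary then so is `g f z`, hence so is `z`.
  refine GrMod.subquot_isomorphic (Z := (torTerm Q' m).sub (torCycles Q' m) _) _ _ _ _ _
    (GrMod.isHomogeneous_comap (GrMod.subIncl _ (torCycles Q' m) (isHomogeneous_torCycles Q' m))
      (fun _ _ h => h) (GrMod.isHomogeneous_range _ (isGrHom_torD Q' m)))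
    (torMap (f m) ∘ₗ GrMod.subIncl _ (torCycles Q' m) (isHomogeneous_torCycles Q' m))
    (fun i x hx => isGrHom_tensMapₕ _ (fgr m) _ _ hx)
    (fun z => torMap_mem_torCycles Q' Q fd _ _ z.2)
    (fun x hx => ⟨⟨torMap (g m) x, torMap_mem_torCycles Q Q' gd _ _ hx⟩,
      torMap_torMap_sub_mem Q Q' g0 f0 gd fd m x hx⟩) (fun z => ⟨fun hz => ?_, fun hz => ?_⟩)
  · obtain ⟨y, hy⟩ := hz
    have h1 : torMap (g m) (torMap (f m) z.1) ∈ LinearMap.range (torD Q' m) :=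
      ⟨torMap (g (m + 1)) y, by rw [torD_torMap Q Q' gd, hy]; rfl⟩
    have := sub_mem h1 (torMap_torMap_sub_mem Q' Q f0 g0 fd gd m z.1 z.2)
    rw [sub_sub_cancel] at this
    exact this
  · obtain ⟨y, hy⟩ := hz
    exact ⟨torMap (f (m + 1)) y, by rw [torD_torMap Q' Q fd, hy]; rfl⟩

end
end Tor

/-! ### Bimodules over separable algebras are projective -/

section Separable

variable {k : Type u} [CommRing k]

/-- Averaging a linear map over a separability idempotent makes it equivariant. -/
theorem IsSeparableAlg.exists_equivariant {R : Type v} [Ring R] [Algebra k R]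
    (h : IsSeparableAlg k R) {M : Type w₁} {N : Type w₂} [AddCommGroup M] [Module k M]
    [AddCommGroup N] [Module k N] (f : R →ₐ[k] Module.End k M) (f' : R →ₐ[k] Module.End k N)
    (g : M →ₗ[k] N) :
    ∃ g' : M →ₗ[k] N, (∀ r, g' ∘ₗ f r = f' r ∘ₗ g') ∧
      (∀ (C : Module.End k M) (D : Module.End k N), (∀ r, Commute (f r) C) →
        (∀ r, Commute (f' r) D) → g ∘ₗ C = D ∘ₗ g → g' ∘ₗ C = D ∘ₗ g') ∧
      ∀ q : N →ₗ[k] M, (∀ r, q ∘ₗ f' r = f r ∘ₗ q) → q ∘ₗ g = LinearMap.id →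
        q ∘ₗ g' = LinearMap.id := by
  obtain ⟨p, hp, hp1⟩ := h
  let B : R →ₗ[k] R →ₗ[k] (M →ₗ[k] N) :=
    LinearMap.mk₂ k (fun x y => f' x ∘ₗ g ∘ₗ f y)
      (fun x x' y => by simp [LinearMap.add_comp]) (fun c x y => by simp [LinearMap.smul_comp])
      (fun x y y' => by simp [LinearMap.comp_add]) (fun c x y => by simp [LinearMap.comp_smul])
  have hB : ∀ x y, TensorProduct.lift B (x ⊗ₜ y) = f' x ∘ₗ g ∘ₗ f y := fun x y => by
    rw [TensorProduct.lift.tmul]; rfl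
  have h1 : ∀ (r : R) (z : R ⊗[k] R), TensorProduct.lift B ((LinearMap.mulLeft k r).rTensor R z)
      = f' r ∘ₗ TensorProduct.lift B z := by
    intro r z
    induction z using TensorProduct.induction_on with
    | zero => simp
    | add x y hx hy => rw [map_add, map_add, hx, hy, map_add, LinearMap.comp_add]
    | tmul x y =>
      rw [LinearMap.rTensor_tmul, hB, hB, LinearMap.mulLeft_apply, map_mul]; rfl
  have h2 : ∀ (r : R) (z : R ⊗[k] R), TensorProduct.lift B ((LinearMap.mulRight k r).lTensor R z)
      = TensorProduct.lift B z ∘ₗ f r := by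
    intro r z
    induction z using TensorProduct.induction_on with
    | zero => simp
    | add x y hx hy => rw [map_add, map_add, hx, hy, map_add, LinearMap.add_comp]
    | tmul x y =>
      rw [LinearMap.lTensor_tmul, hB, hB, LinearMap.mulRight_apply, map_mul]; rfl
  -- The average is `∑ f'(xᵢ) g f(yᵢ)`. Equivariance is `r p = p r`, preservation of sections is `∑
  -- xᵢ yᵢ = 1`, and the clause about commuting operators allows a second averaging over another
  -- algebra without losing the first equivariance.
  refine ⟨TensorProduct.lift B p, fun r => ?_, fun C D hC hD hg => ?_, fun q hq hg => ?_⟩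
  · rw [← h1, ← h2, hp]
  · clear hp hp1
    induction p using TensorProduct.induction_on with
    | zero => simp
    | add x y hx hy => rw [map_add, LinearMap.add_comp, hx, hy, LinearMap.comp_add]
    | tmul x y =>
      rw [hB]
      ext m
      have e1 : f y (C m) = C (f y m) := LinearMap.congr_fun (hC y) m
      have e2 : ∀ n, f' x (D n) = D (f' x n) := fun n => LinearMap.congr_fun (hD x) n
      have e3 : ∀ m, g (C m) = D (g m) := fun m => LinearMap.congr_fun hg m
      simp only [LinearMap.comp_apply, e1, e3, e2]
  · have key : ∀ z : R ⊗[k] R, q ∘ₗ TensorProduct.lift B z = f (LinearMap.mul' k R z) := by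
      intro z
      induction z using TensorProduct.induction_on with
      | zero => simp
      | add x y hx hy => rw [map_add, LinearMap.comp_add, hx, hy, map_add, map_add]
      | tmul x y =>
        rw [hB, ← LinearMap.comp_assoc, hq, LinearMap.comp_assoc, ← LinearMap.comp_assoc _ g q, hg,
          LinearMap.mul'_apply, map_mul]
        rfl
    rw [key, hp1, map_one]; rfl

/-- Exchanging the two tensor factors of a separability idempotent exchanges left and right
multiplication, which is what passing to the opposite algebra requires. -/
theorem IsSeparableAlg.op {R : Type v} [Ring R] [Algebra k R] (h : IsSeparableAlg k R) :
    IsSeparableAlg k Rᵐᵒᵖ := by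
  obtain ⟨p, hp, hp1⟩ := h
  let φ : R ⊗[k] R →ₗ[k] Rᵐᵒᵖ ⊗[k] Rᵐᵒᵖ :=
    TensorProduct.map (opLinearEquiv k).toLinearMap (opLinearEquiv k).toLinearMap ∘ₗ
      (TensorProduct.comm k R R).toLinearMap
  have hφ : ∀ x y, φ (x ⊗ₜ y) = MulOpposite.op y ⊗ₜ MulOpposite.op x := fun x y => rfl
  refine ⟨φ p, fun a => ?_, ?_⟩
  · obtain ⟨a, rfl⟩ := op_surjective a
    have h1 : ∀ z : R ⊗[k] R, (LinearMap.mulLeft k (MulOpposite.op a)).rTensor Rᵐᵒᵖ (φ z)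
        = φ ((LinearMap.mulRight k a).lTensor R z) := by
      intro z
      induction z using TensorProduct.induction_on with
      | zero => simp
      | add x y hx hy => rw [map_add, map_add, hx, hy, map_add, map_add]
      | tmul x y => simp [hφ]
    have h2 : ∀ z : R ⊗[k] R, (LinearMap.mulRight k (MulOpposite.op a)).lTensor Rᵐᵒᵖ (φ z)
        = φ ((LinearMap.mulLeft k a).rTensor R z) := by
      intro z
      induction z using TensorProduct.induction_on with
      | zero => simp
      | add x y hx hy => rw [map_add, map_add, hx, hy, map_add, map_add]
      | tmul x y => simp [hφ]
    rw [h1, h2, hp]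
  · have h1 : ∀ z : R ⊗[k] R, LinearMap.mul' k Rᵐᵒᵖ (φ z) = MulOpposite.op (LinearMap.mul' k R z) := by
      intro z
      induction z using TensorProduct.induction_on with
      | zero => simp
      | add x y hx hy => rw [map_add, map_add, hx, hy, map_add, op_add]
      | tmul x y => simp [hφ]
    rw [h1, hp1, op_one]

end Separable

/-- Over a field a surjection from a free module onto `M` splits `k`-linearly; averaging over `R`
and then over `S` turns the splitting into an `R ⊗ S`-linear one. -/
theorem IsSeparableAlg.projective {k : Type u} [Field k] {R : Type v} [Ring R] [Algebra k R]
    (h : IsSeparableAlg k R) {S : Type w} [Ring S] [Algebra k S] (h' : IsSeparableAlg k S)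
    (M : Type w₁) [AddCommGroup M] [Module k M] [Module (R ⊗[k] S) M]
    [IsScalarTower k (R ⊗[k] S) M] : Module.Projective (R ⊗[k] S) M := by
  refine Module.Projective.of_lifting_property'' fun q hq => ?_
  let N := M →₀ (R ⊗[k] S)
  obtain ⟨g, hg⟩ := (q.restrictScalars k).exists_rightInverse_of_surjective
    (LinearMap.range_eq_top.2 hq)
  let lM : R →ₐ[k] Module.End k M :=
    (Algebra.lsmul k k M).comp (Algebra.TensorProduct.includeLeft : R →ₐ[k] R ⊗[k] S)
  let lN : R →ₐ[k] Module.End k N :=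
    (Algebra.lsmul k k N).comp (Algebra.TensorProduct.includeLeft : R →ₐ[k] R ⊗[k] S)
  let rM : S →ₐ[k] Module.End k M :=
    (Algebra.lsmul k k M).comp (Algebra.TensorProduct.includeRight : S →ₐ[k] R ⊗[k] S)
  let rN : S →ₐ[k] Module.End k N :=
    (Algebra.lsmul k k N).comp (Algebra.TensorProduct.includeRight : S →ₐ[k] R ⊗[k] S)
  have cM : ∀ r s, Commute (lM r) (rM s) := fun r s => by
    change lM r * rM s = rM s * lM r
    ext m
    change ((r ⊗ₜ[k] (1 : S)) • ((1 : R) ⊗ₜ[k] s) • m : M) = ((1 : R) ⊗ₜ[k] s) • (r ⊗ₜ[k] (1 : S)) • m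
    rw [smul_smul, smul_smul, Algebra.TensorProduct.tmul_mul_tmul,
      Algebra.TensorProduct.tmul_mul_tmul, mul_one, one_mul, mul_one, one_mul]
  have cN : ∀ r s, Commute (lN r) (rN s) := fun r s => by
    change lN r * rN s = rN s * lN r
    refine LinearMap.ext fun m => ?_
    change ((r ⊗ₜ[k] (1 : S)) • ((1 : R) ⊗ₜ[k] s) • m : N) = ((1 : R) ⊗ₜ[k] s) • (r ⊗ₜ[k] (1 : S)) • m
    rw [smul_smul, smul_smul, Algebra.TensorProduct.tmul_mul_tmul,
      Algebra.TensorProduct.tmul_mul_tmul, mul_one, one_mul, mul_one, one_mul]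
  obtain ⟨g₁, h1, -, h1q⟩ := h.exists_equivariant lM lN g
  obtain ⟨g₂, h2, h2c, h2q⟩ := h'.exists_equivariant rM rN g₁
  -- The actions of `R` and `S` commute, so averaging over `S` keeps the `R`-linearity gained
  -- before.
  have h3 := fun r => h2c (lM r) (lN r) (fun s => (cM r s).symm) (fun s => (cN r s).symm) (h1 r)
  have h4 := h2q (q.restrictScalars k)
    (fun s => LinearMap.ext fun x => map_smul q _ _)
    (h1q _ (fun s => LinearMap.ext fun x => map_smul q _ _) hg)
  refine ⟨{ toFun := g₂, map_add' := map_add g₂, map_smul' := fun e x => ?_ },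
    LinearMap.ext fun x => LinearMap.congr_fun h4 x⟩
  change g₂ (e • x) = e • g₂ x
  induction e using TensorProduct.induction_on with
  | zero =>
    refine (congrArg g₂ (zero_smul (R ⊗[k] S) x)).trans ?_
    exact (map_zero g₂).trans (zero_smul (R ⊗[k] S) (g₂ x)).symm
  | add e e' he he' => rw [add_smul, map_add, he, he', add_smul]
  | tmul r s =>
    have e1 : ∀ m, g₂ ((r ⊗ₜ[k] (1 : S)) • m) = (r ⊗ₜ[k] (1 : S)) • g₂ m :=
      fun m => LinearMap.congr_fun (h3 r) m
    have e2 : ∀ m, g₂ (((1 : R) ⊗ₜ[k] s) • m) = ((1 : R) ⊗ₜ[k] s) • g₂ m :=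
      fun m => LinearMap.congr_fun (h2 s) m
    have e3 : r ⊗ₜ[k] s = (r ⊗ₜ[k] (1 : S)) * ((1 : R) ⊗ₜ[k] s) := by
      rw [Algebra.TensorProduct.tmul_mul_tmul, mul_one, one_mul]
    rw [e3, mul_smul, e1, e2, mul_smul]

theorem IsSeparableAlg.projective_env {k : Type u} [Field k] {R : Type v} [Ring R] [Algebra k R]
    (h : IsSeparableAlg k R) (M : Type w₁) [AddCommGroup M] [Module k M] [Module (Env k R R) M]
    [IsScalarTower k (Env k R R) M] : Module.Projective (Env k R R) M :=
  h.projective h.op M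

/-! ### Graded Nakayama lemmas and minimal resolutions -/

section Nakayama

variable {k : Type u} [CommRing k] {E : Type v} [Ring E] [Algebra k E] {ℰ : ℤ → Submodule k E}

namespace GrMod

/-- The graded module `M` vanishes in small degrees. -/
def IsBoundedBelow (M : GrMod.{u, v, w} ℰ) : Prop := ∃ b, ∀ i < b, M.deg i = ⊥

theorem isHomogeneous_positivePart (hE : ⨆ i, ℰ i = ⊤) (M : GrMod.{u, v, w} ℰ) :
    M.IsHomogeneous M.positivePart := by
  intro x hx
  induction hx using Submodule.span_induction with
  | mem x hx =>
    obtain ⟨p, hp, e, he, x, rfl⟩ := hx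
    intro i
    rw [components_smul M he]
    exact Submodule.subset_span ⟨p, hp, e, he, _, rfl⟩
  | zero => intro i; simp
  | add x y _ _ hx hy => intro i; rw [map_add]; exact add_mem (hx i) (hy i)
  | smul e x _ hx =>
    induction e using mem_induction hE with
    | hom p e he => intro i; rw [components_smul M he]; exact Submodule.smul_mem _ _ (hx _)
    | zero => intro i; simp
    | add e f he hf => intro i; rw [add_smul, map_add]; exact add_mem (he i) (hf i)

theorem smul_mem_positivePart (M : GrMod.{u, v, w} ℰ) {i : ℤ} (hi : 0 < i) {e : E} (he : e ∈ ℰ i)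
    (x : M.carrier) : e • x ∈ M.positivePart :=
  Submodule.subset_span ⟨i, hi, e, he, x, rfl⟩

/-- In `e x` with `e` of positive degree, the component of degree `l` uses only components of `x` of
degree smaller than `l`. Outer coefficients cannot lower the degree, since `E` lives in degrees at
least `0`. -/
theorem components_mem_of_mem_positivePart (hE : ⨆ i, ℰ i = ⊤) (h0 : ∀ i < 0, ℰ i = ⊥)
    {M : GrMod.{u, v, w} ℰ} {N : Submodule E M.carrier} {i : ℤ}
    (h : ∀ j < i, ∀ x ∈ M.deg j, x ∈ N) {z : M.carrier} (hz : z ∈ M.positivePart) :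
    ∀ l ≤ i, components M.internal z l ∈ N := by
  induction hz using Submodule.span_induction with
  | mem x hx =>
    obtain ⟨p, hp, e, he, x, rfl⟩ := hx
    intro l hl
    rw [components_smul M he]
    exact N.smul_mem _ (h (l - p) (by omega) _ (components_mem _ _ _))
  | zero => intro l _; simp
  | add x y _ _ hx hy => intro l hl; rw [map_add]; exact add_mem (hx l hl) (hy l hl)
  | smul e x _ hx =>
    induction e using mem_induction hE with
    | hom p e he =>
      intro l hl
      rcases lt_or_ge p 0 with hp | hp
      · rw [h0 p hp, Submodule.mem_bot] at he
        simp [he]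
      · rw [components_smul M he]
        exact N.smul_mem _ (hx _ (by omega))
    | zero => intro l _; simp
    | add e f he hf => intro l hl; rw [add_smul, map_add]; exact add_mem (he l hl) (hf l hl)

/-- The graded Nakayama lemma. -/
theorem eq_top_of_sup_positivePart (hE : ⨆ i, ℰ i = ⊤) (h0 : ∀ i < 0, ℰ i = ⊥)
    {M : GrMod.{u, v, w} ℰ} (hM : M.IsBoundedBelow) {N : Submodule E M.carrier}
    (hN : M.IsHomogeneous N) (h : ∀ x, ∃ y ∈ N, x - y ∈ M.positivePart) : N = ⊤ := by
  obtain ⟨b, hb⟩ := hM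
  -- Induction on the degree, starting at the lower bound `b`: modulo `N`, an element of degree `i`
  -- is a combination of elements of lower degree.
  have key : ∀ n : ℕ, ∀ i, i < b + n → ∀ x ∈ M.deg i, x ∈ N := by
    intro n
    induction n with
    | zero =>
      intro i hi x hx
      rw [hb i (by simpa using hi), Submodule.mem_bot] at hx
      rw [hx]; exact zero_mem _
    | succ n ih =>
      intro i hi x hx
      obtain ⟨y, hy, hxy⟩ := h x
      have h1 := components_mem_of_mem_positivePart hE h0 (N := N) (i := i)
        (fun j hj => ih j (by push_cast at hi; omega)) hxy i le_rfl
      rw [map_sub, Finsupp.sub_apply, components_of_mem _ hx, Finsupp.single_eq_same] at h1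
      have := add_mem h1 (hN y hy i)
      rwa [sub_add_cancel] at this
  refine eq_top_iff.2 fun x _ => M.sum_components_smul fun i => ?_
  -- Truncation at `0` is harmless: if `i - b + 1` is negative then `i < b` holds anyway.
  exact key (i - b + 1).toNat i (by omega) _ (components_mem _ _ _)

/-- A submodule `K = E⁺K` of a projective module is zero. -/
theorem eq_zero_of_le_positive (hE : ⨆ i, ℰ i = ⊤) (h0 : ∀ i < 0, ℰ i = ⊥)
    (G : GrMod.{u, v, w₂} ℰ) (hG : G.IsBoundedBelow) (j : E →ₗ[E] G.carrier)
    (hj : Function.Injective j) {P : Type w} [AddCommGroup P] [Module E P]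
    (hP : Module.Projective E P) {K : Set P}
    (hK : ∀ x ∈ K, x ∈ Submodule.span E {y | ∃ i : ℤ, 0 < i ∧ ∃ e ∈ ℰ i, ∃ x ∈ K, y = e • x})
    {x : P} (hx : x ∈ K) : x = 0 := by
  obtain ⟨b, hb⟩ := hG
  -- `P` carries no grading here. Linear maps from `P` into the bounded below module `G` are used
  -- instead: their values on `K` have no component below `b`, and `K ⊆ E⁺K` pushes this vanishing
  -- up one degree at a time.
  have key : ∀ f : P →ₗ[E] G.carrier, ∀ n : ℕ, ∀ i, i < b + n → ∀ x ∈ K,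
      components G.internal (f x) i = 0 := by
    intro f n
    induction n with
    | zero =>
      intro i hi x hx
      have := components_mem G.internal (f x) i
      rwa [hb i (by simpa using hi), Submodule.mem_bot] at this
    | succ n ih =>
      intro i hi x hx
      have : ∀ z ∈ Submodule.span E {y | ∃ i : ℤ, 0 < i ∧ ∃ e ∈ ℰ i, ∃ x ∈ K, y = e • x},
          ∀ l ≤ i, components G.internal (f z) l = 0 := by
        intro z hz
        induction hz using Submodule.span_induction with
        | mem x hx =>
          obtain ⟨p, hp, e, he, x, hx, rfl⟩ := hx
          intro l hl
          rw [map_smul, components_smul G he, ih _ (by push_cast at hi; omega) x hx, smul_zero]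
        | zero => intro l _; simp
        | add x y _ _ hx hy => intro l hl; rw [map_add, map_add, Finsupp.add_apply, hx l hl,
            hy l hl, add_zero]
        | smul e x _ hx =>
          induction e using mem_induction hE with
          | hom p e he =>
            intro l hl
            rcases lt_or_ge p 0 with hp | hp
            · rw [h0 p hp, Submodule.mem_bot] at he
              simp [he]
            · rw [map_smul, components_smul G he, hx _ (by omega), smul_zero]
          | zero => intro l _; simp
          | add e e' he he' => intro l hl; rw [add_smul, map_add, map_add, Finsupp.add_apply,
              he l hl, he' l hl, add_zero]
      exact this x (hK x hx) i le_rfl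
  have key' : ∀ f : P →ₗ[E] E, f x = 0 := by
    intro f
    refine hj ?_
    rw [map_zero, ← sum_components G.internal (j (f x))]
    refine Finset.sum_eq_zero fun i _ => ?_
    exact key (j ∘ₗ f) (i - b + 1).toNat i (by omega) x hx
  -- A projective module embeds in a free one, and the coordinates of the embedding are linear maps
  -- `P → E`, which all vanish at `x`.
  obtain ⟨s, hs⟩ := hP
  rw [← hs x]
  have : s x = 0 := Finsupp.ext fun i => key' (Finsupp.lapply i ∘ₗ s)
  rw [this, map_zero]

theorem IsBoundedBelow.sub {M : GrMod.{u, v, w} ℰ} (h : M.IsBoundedBelow)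
    (N : Submodule E M.carrier) (hN : M.IsHomogeneous N) : (M.sub N hN).IsBoundedBelow := by
  obtain ⟨b, hb⟩ := h
  refine ⟨b, fun i hi => (Submodule.eq_bot_iff _).2 fun x hx => ?_⟩
  have hx' : M.subIncl N hN x ∈ M.deg i := hx
  rw [hb i hi, Submodule.mem_bot] at hx'
  exact N.injective_subtype hx'

theorem IsBoundedBelow.of_surjective {M : GrMod.{u, v, w} ℰ} {b : ℤ}
    (h : ∀ i < b, M.deg i = ⊥) {E' : Type w₃} [Ring E'] [Algebra k E'] {ℰ' : ℤ → Submodule k E'}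
    {N : GrMod.{u, w₃, w₁} ℰ'} (f : M.carrier →ₗ[k] N.carrier)
    (hf : ∀ i, ∀ x ∈ M.deg i, f x ∈ N.deg i) (hs : Function.Surjective f) :
    ∀ i < b, N.deg i = ⊥ := by
  intro i hi
  have h1 : components N.internal ∘ₗ f
      = Finsupp.mapRange.linearMap f ∘ₗ components M.internal := by
    refine LinearMap.ext fun x => ?_
    induction x using mem_induction M.iSup_deg with
    | hom j x hx =>
      simp [components_of_mem _ hx, components_of_mem _ (hf _ _ hx)]
    | zero => simp
    | add x y hx hy => rw [map_add, map_add, hx, hy]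
  refine (Submodule.eq_bot_iff _).2 fun y hy => ?_
  obtain ⟨x, rfl⟩ := hs y
  have h2 := DFunLike.congr_fun (LinearMap.congr_fun h1 x) i
  simp only [LinearMap.comp_apply, components_of_mem _ hy, Finsupp.single_eq_same,
    Finsupp.mapRange.linearMap_apply, Finsupp.mapRange_apply] at h2
  have h3 := components_mem M.internal x i
  rw [h i hi, Submodule.mem_bot] at h3
  rw [h2, h3, map_zero]

end GrMod

/-- Iterating projective covers gives a minimal resolution. -/
theorem exists_minimal_resolution
    (cov : ∀ M : GrMod.{u, v, w} ℰ, M.IsBoundedBelow → ∃ (F : GrMod.{u, v, w} ℰ)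
      (f : F.carrier →ₗ[E] M.carrier), F.IsBoundedBelow ∧ Module.Projective E F.carrier ∧
        GrMod.IsGrHom f ∧ Function.Surjective f ∧ LinearMap.ker f ≤ F.positivePart)
    (M : GrMod.{u, v, w} ℰ) (hM : M.IsBoundedBelow) :
    ∃ P : GrProjRes.{u, v, w, w} M, P.IsMinimal := by
  choose F f hb hp hg hs hk using cov
  -- The next syzygy is the kernel of the chosen cover. The lower bound travels along with it
  -- because covers are available only for modules bounded below.
  let next : {M : GrMod.{u, v, w} ℰ // M.IsBoundedBelow} →
      {M : GrMod.{u, v, w} ℰ // M.IsBoundedBelow} := fun M =>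
    ⟨(F M.1 M.2).sub (LinearMap.ker (f M.1 M.2)) (GrMod.isHomogeneous_ker _ (hg M.1 M.2)),
      (hb M.1 M.2).sub _ _⟩
  let Z : ℕ → {M : GrMod.{u, v, w} ℰ // M.IsBoundedBelow} := fun m =>
    Nat.rec ⟨M, hM⟩ (fun _ N => next N) m
  let d : ∀ m, (F (Z (m + 1)).1 (Z (m + 1)).2).carrier →ₗ[E] (F (Z m).1 (Z m).2).carrier :=
    fun m => (LinearMap.ker (f (Z m).1 (Z m).2)).subtype ∘ₗ f (Z (m + 1)).1 (Z (m + 1)).2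
  have hd : ∀ m, LinearMap.range (d m) = LinearMap.ker (f (Z m).1 (Z m).2) := fun m => by
    ext x
    constructor
    · rintro ⟨y, rfl⟩
      exact (f (Z (m + 1)).1 (Z (m + 1)).2 y).2
    · intro hx
      obtain ⟨y, hy⟩ := hs (Z (m + 1)).1 (Z (m + 1)).2 ⟨x, hx⟩
      exact ⟨y, congrArg (LinearMap.ker (f (Z m).1 (Z m).2)).subtype hy⟩
  have hd' : ∀ m, LinearMap.ker (d m) = LinearMap.ker (f (Z (m + 1)).1 (Z (m + 1)).2) :=
    fun m => LinearMap.ker_comp_of_ker_eq_bot _ (Submodule.ker_subtype _)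
  exact ⟨{
    X := fun m => F (Z m).1 (Z m).2
    d := d
    aug := f M hM
    d_gr := fun m i x hx => hg (Z (m + 1)).1 (Z (m + 1)).2 i x hx
    aug_gr := hg M hM
    projective := fun m => hp _ _
    exact := fun m => LinearMap.exact_iff.2 ((hd' m).trans (hd (m + 1)).symm)
    exact_aug := LinearMap.exact_iff.2 (hd 0).symm
    surjective_aug := hs M hM }, fun m => (hd m).le.trans (hk _ _)⟩

end Nakayama

/-! ### The enveloping algebra as a graded module -/

section EnvGraded

variable {k : Type u} [CommRing k] {A : Type v} {B : Type w} [Ring A] [Algebra k A]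
  [Ring B] [Algebra k B] (𝒜 : ℤ → Submodule k A) (ℬ : ℤ → Submodule k B)
  [GradedAlgebra 𝒜] [GradedAlgebra ℬ]

theorem isInternal_envGr : DirectSum.IsInternal (envGr 𝒜 ℬ) := by
  let δB : Bᵐᵒᵖ →ₗ[k] (ℤ →₀ Bᵐᵒᵖ) := Finsupp.mapRange.linearMap (opLinearEquiv k).toLinearMap ∘ₗ
    components (DirectSum.Decomposition.isInternal ℬ) ∘ₗ (opLinearEquiv k).symm.toLinearMap
  have hδB : ∀ i, ∀ b ∈ ℬ i, δB (op b) = Finsupp.single i (op b) := by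
    intro i b hb
    change Finsupp.mapRange.linearMap (opLinearEquiv k).toLinearMap
      (components (DirectSum.Decomposition.isInternal ℬ) b) = _
    rw [components_of_mem _ hb]
    simp
  refine isInternal_of_components (iSup_envGr (iSup_grading 𝒜) (iSup_grading ℬ)) LinearMap.id
    (fun _ _ h => h) (Finsupp.lmapDomain _ k (fun p : ℤ × ℤ => p.1 + p.2) ∘ₗ
        (finsuppTensorFinsupp k k A Bᵐᵒᵖ ℤ ℤ).toLinearMap ∘ₗ
        TensorProduct.map (components (DirectSum.Decomposition.isInternal 𝒜)) δB) ?_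
  intro i z hz
  induction hz using Submodule.span_induction with
  | zero => simp
  | add x y _ _ hx hy => rw [map_add, hx, hy, map_add, Finsupp.single_add]
  | smul c x _ hx => rw [map_smul, hx, map_smul, Finsupp.smul_single]
  | mem z hz =>
    obtain ⟨p, q, rfl, a, ha, b, hb, rfl⟩ := hz
    simp [components_of_mem _ ha, hδB _ _ hb, Finsupp.mapDomain_single]

/-- `A ⊗ Bᵒᵖ` as a graded module over itself. -/
def envReg : GrMod.{u, max v w, max v w} (envGr 𝒜 ℬ) where
  carrier := Env k A B
  deg := envGr 𝒜 ℬ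
  internal := isInternal_envGr 𝒜 ℬ
  smul_mem := by
    intro i j e x he hx
    have : envGr 𝒜 ℬ i * envGr 𝒜 ℬ j ≤ envGr 𝒜 ℬ (i + j) := by
      rw [envGr, envGr, Submodule.span_mul_span]
      refine Submodule.span_le.mpr ?_
      rintro _ ⟨_, ⟨p, q, rfl, a, ha, b, hb, rfl⟩, _, ⟨p', q', rfl, a', ha', b', hb', rfl⟩, rfl⟩
      refine Submodule.subset_span ⟨p + p', q' + q, by ring, _, SetLike.mul_mem_graded ha ha', _,
        SetLike.mul_mem_graded hb' hb, ?_⟩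
      simp
    exact this (Submodule.mul_mem_mul he hx)

variable {𝒜 ℬ}

omit [GradedAlgebra 𝒜] [GradedAlgebra ℬ] in
theorem envGr_eq_bot (hA : ∀ i < 0, 𝒜 i = ⊥) (hB : ∀ i < 0, ℬ i = ⊥) :
    ∀ i < 0, envGr 𝒜 ℬ i = ⊥ := by
  intro i hi
  refine (Submodule.span_eq_bot).2 ?_
  rintro _ ⟨p, q, rfl, a, ha, b, hb, rfl⟩
  rcases lt_or_ge p 0 with hp | hp
  · rw [hA p hp, Submodule.mem_bot] at ha
    rw [ha, TensorProduct.zero_tmul]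
  · rw [hB q (by omega), Submodule.mem_bot] at hb
    rw [hb, op_zero, TensorProduct.tmul_zero]

theorem isBoundedBelow_envReg (hA : ∀ i < 0, 𝒜 i = ⊥) (hB : ∀ i < 0, ℬ i = ⊥) :
    (envReg 𝒜 ℬ).IsBoundedBelow :=
  ⟨0, envGr_eq_bot hA hB⟩

end EnvGraded

/-! ### The induced bimodules `A ⊗_R W ⊗_R A` -/

section Induced

variable {k : Type u} [CommRing k] {A : Type v} [Ring A] [Algebra k A]
  {𝒜 : ℤ → Submodule k A} [GradedAlgebra 𝒜] {R : Type v} [Ring R] [Algebra k R]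

/-- The homomorphism `R ⊗ Rᵒᵖ → A ⊗ Aᵒᵖ` induced by `R → A`. -/
def envMap (f : R →ₐ[k] A) : Env k R R →ₐ[k] Env k A A :=
  Algebra.TensorProduct.map f (AlgHom.op f)

theorem envMap_tmul (f : R →ₐ[k] A) (r s : R) :
    envMap f (r ⊗ₜ op s) = f r ⊗ₜ op (f s) := rfl

variable (f : R →ₐ[k] A) (hf : ∀ i, ∀ r ∈ trivGr k R i, f r ∈ 𝒜 i)

omit [GradedAlgebra 𝒜] in
include hf in
theorem envMap_mem (i : ℤ) (e : Env k R R) (he : e ∈ envGr (trivGr k R) (trivGr k R) i) :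
    envMap f e ∈ envGr 𝒜 𝒜 i := by
  have : envGr (trivGr k R) (trivGr k R) i ≤ (envGr 𝒜 𝒜 i).comap (envMap f).toLinearMap := by
    refine Submodule.span_le.mpr ?_
    rintro _ ⟨p, q, rfl, a, ha, b, hb, rfl⟩
    exact tmul_mem_envGr (hf _ _ ha) (hf _ _ hb)
  exact this he

/-- `A` as a graded `A`-`R`-bimodule along `R → A`. -/
def bimodL : GrMod.{u, v, v} (envGr 𝒜 (trivGr k R)) :=
  bimod 𝒜 (AlgHom.id k A) f (fun _ _ h => h) hf

/-- `A` as a graded `R`-`A`-bimodule along `R → A`. -/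
def bimodR : GrMod.{u, v, v} (envGr (trivGr k R) 𝒜) :=
  bimod 𝒜 f (AlgHom.id k A) hf (fun _ _ h => h)

/-- The identity map of `A`, with values in the `A`-`R`-bimodule `A`. -/
def toL : A →ₗ[k] (bimodL f hf).carrier := (LinearMap.id : A →ₗ[k] A)

/-- The identity map of `A`, with values in the `R`-`A`-bimodule `A`. -/
def toR : A →ₗ[k] (bimodR f hf).carrier := (LinearMap.id : A →ₗ[k] A)

/-- The inverse of `toL`. -/
def ofL : (bimodL f hf).carrier →ₗ[k] A := (LinearMap.id : A →ₗ[k] A)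

/-- The inverse of `toR`. -/
def ofR : (bimodR f hf).carrier →ₗ[k] A := (LinearMap.id : A →ₗ[k] A)

theorem toL_surjective : Function.Surjective (toL f hf) := fun a => ⟨a, rfl⟩

theorem toR_surjective : Function.Surjective (toR f hf) := fun a => ⟨a, rfl⟩

theorem smul_toL (x : A) (r : R) (a : A) :
    (x ⊗ₜ[k] op r : Env k A R) • toL f hf a = toL f hf (x * a * f r) :=
  bimodAction_tmul (AlgHom.id k A) f x r a

theorem smul_toR (r : R) (x : A) (a : A) :
    (r ⊗ₜ[k] op x : Env k R A) • toR f hf a = toR f hf (f r * a * x) :=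
  bimodAction_tmul f (AlgHom.id k A) r x a

theorem smul_toL_left (x a : A) :
    (x ⊗ₜ[k] (1 : Rᵐᵒᵖ) : Env k A R) • toL f hf a = toL f hf (x * a) := by
  rw [← op_one, smul_toL, map_one, mul_one]

theorem smul_toL_right (r : R) (a : A) :
    ((1 : A) ⊗ₜ[k] op r : Env k A R) • toL f hf a = toL f hf (a * f r) := by
  rw [smul_toL, one_mul]

theorem smul_toR_left (r : R) (a : A) :
    (r ⊗ₜ[k] (1 : Aᵐᵒᵖ) : Env k R A) • toR f hf a = toR f hf (f r * a) := by
  rw [← op_one, smul_toR, mul_one]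

theorem smul_toR_right (x a : A) :
    ((1 : R) ⊗ₜ[k] op x : Env k R A) • toR f hf a = toR f hf (a * x) := by
  rw [smul_toR, map_one, one_mul]

variable (W : GrMod.{u, v, w} (envGr (trivGr k R) (trivGr k R)))

/-- The graded `A`-`R`-bimodule `A ⊗_R W`. -/
def indL : GrMod.{u, v, max v w} (envGr 𝒜 (trivGr k R)) := tens (bimodL f hf) W

/-- The elementary tensors of `A ⊗_R W`. -/
def indLTt : A →ₗ[k] W.carrier →ₗ[k] (indL f hf W).carrier := tt (bimodL f hf) W ∘ₗ toL f hf

/-- The graded `A`-`A`-bimodule `A ⊗_R W ⊗_R A`. -/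
def ind : GrMod.{u, v, max v w} (envGr 𝒜 𝒜) := tens (indL f hf W) (bimodR f hf)

/-- The elementary tensors of `A ⊗_R W ⊗_R A`, with the factors from `A ⊗_R W` and `A`. -/
def indRTt : (indL f hf W).carrier →ₗ[k] A →ₗ[k] (ind f hf W).carrier :=
  (tt (indL f hf W) (bimodR f hf)).compl₂ (toR f hf)

/-- The elementary tensors of `A ⊗_R W ⊗_R A`. -/
def indTt : A →ₗ[k] W.carrier →ₗ[k] A →ₗ[k] (ind f hf W).carrier :=
  LinearMap.compr₂ (indLTt f hf W) (indRTt f hf W)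

variable {W}

theorem indTt_eq (a : A) (w : W.carrier) (b : A) :
    indTt f hf W a w b = indRTt f hf W (indLTt f hf W a w) b := rfl

theorem smul_indLTt (x : A) (r : R) (a : A) (w : W.carrier) :
    (x ⊗ₜ[k] op r : Env k A R) • indLTt f hf W a w
      = indLTt f hf W (x * a) ((1 ⊗ₜ[k] op r : Env k R R) • w) := by
  refine (smul_tt x r (toL f hf a) w).trans ?_
  rw [smul_toL_left]; rfl

theorem indLTt_balance (a : A) (r : R) (w : W.carrier) :
    indLTt f hf W (a * f r) w = indLTt f hf W a ((r ⊗ₜ[k] 1 : Env k R R) • w) := by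
  have h := tt_balance (M := bimodL f hf) (N := W) (toL f hf a) r w
  rw [smul_toL_right] at h
  exact h

theorem smul_indRTt (x y : A) (z : (indL f hf W).carrier) (b : A) :
    (x ⊗ₜ[k] op y : Env k A A) • indRTt f hf W z b
      = indRTt f hf W ((x ⊗ₜ[k] (1 : Rᵐᵒᵖ) : Env k A R) • z) (b * y) := by
  refine (smul_tt x y z (toR f hf b)).trans ?_
  rw [smul_toR_right]; rfl

theorem indRTt_balance (z : (indL f hf W).carrier) (r : R) (b : A) :
    indRTt f hf W (((1 : A) ⊗ₜ[k] op r : Env k A R) • z) b = indRTt f hf W z (f r * b) := by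
  have h := tt_balance (M := indL f hf W) (N := bimodR f hf) z r (toR f hf b)
  rw [smul_toR_left] at h
  exact h

theorem smul_indTt (x y a : A) (w : W.carrier) (b : A) :
    (x ⊗ₜ[k] op y : Env k A A) • indTt f hf W a w b = indTt f hf W (x * a) w (b * y) := by
  rw [indTt_eq, smul_indRTt, ← op_one, smul_indLTt, op_one, indTt_eq]
  exact congrArg (fun s => indRTt f hf W (indLTt f hf W (x * a) s) (b * y))
    (one_smul (Env k R R) w)

theorem indTt_balanceL (a : A) (r : R) (w : W.carrier) (b : A) :
    indTt f hf W (a * f r) w b = indTt f hf W a ((r ⊗ₜ[k] 1 : Env k R R) • w) b := by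
  rw [indTt_eq, indLTt_balance, indTt_eq]

theorem indTt_balanceR (a : A) (w : W.carrier) (r : R) (b : A) :
    indTt f hf W a w (f r * b) = indTt f hf W a ((1 ⊗ₜ[k] op r : Env k R R) • w) b := by
  rw [indTt_eq, ← indRTt_balance, smul_indLTt, one_mul, indTt_eq]

theorem indL_induction {p : (indL f hf W).carrier → Prop} (tt : ∀ a w, p (indLTt f hf W a w))
    (zero : p 0) (add : ∀ x y, p x → p y → p (x + y)) (x : (indL f hf W).carrier) : p x :=
  tens_induction (fun a w => tt (ofL f hf a) w) zero add x

theorem ind_induction {p : (ind f hf W).carrier → Prop} (tt : ∀ a w b, p (indTt f hf W a w b))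
    (zero : p 0) (add : ∀ x y, p x → p y → p (x + y)) (x : (ind f hf W).carrier) : p x := by
  refine tens_induction (fun z b => ?_) zero add x
  obtain ⟨b, rfl⟩ := toR_surjective f hf b
  change p (indRTt f hf W z b)
  induction z using indL_induction with
  | tt a w => exact tt a w b
  | zero => rw [map_zero]; exact zero
  | add x y hx hy => rw [map_add]; exact add _ _ hx hy

theorem ind_deg_le {n : ℤ} {S : Submodule k (ind f hf W).carrier}
    (h : ∀ p q r, p + q + r = n → ∀ a ∈ 𝒜 p, ∀ w ∈ W.deg q, ∀ b ∈ 𝒜 r, indTt f hf W a w b ∈ S) :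
    (ind f hf W).deg n ≤ S := by
  refine tens_deg_le fun s r hsr z hz b hb => ?_
  have : (indL f hf W).deg s ≤ S.comap ((tt (indL f hf W) (bimodR f hf)).flip b) :=
    tens_deg_le fun p q hpq a ha w hw => h p q r (by omega) a ha w hw b hb
  exact this hz

theorem ind_deg_eq_bot (hA : ∀ i < 0, 𝒜 i = ⊥) {c : ℤ} (hW : ∀ i < c, W.deg i = ⊥) :
    ∀ i < c, (ind f hf W).deg i = ⊥ := by
  intro i hi
  refine eq_bot_iff.2 (ind_deg_le f hf fun p q r hpqr a ha w hw b hb => ?_)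
  rw [Submodule.mem_bot]
  rcases lt_or_ge p 0 with hp | hp
  · rw [hA p hp, Submodule.mem_bot] at ha
    rw [ha, map_zero]; rfl
  rcases lt_or_ge r 0 with hr | hr
  · rw [hA r hr, Submodule.mem_bot] at hb
    rw [hb, map_zero]
  · rw [hW q (by omega), Submodule.mem_bot] at hw
    rw [hw, map_zero]; rfl

section Ext

variable {M : Type w₁} [AddCommGroup M] [Module k M] [Module (Env k A A) M]
  [IsScalarTower k (Env k A A) M] (u : W.carrier →ₗ[k] M)

/-- The trilinear map `(a, w, b) ↦ (a ⊗ b) u(w)`. -/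
def indTri : A →ₗ[k] W.carrier →ₗ[k] A →ₗ[k] M :=
  LinearMap.mk₂ k
    (fun a w => ((LinearMap.toSpanSingleton (Env k A A) M (u w)).restrictScalars k) ∘ₗ
      TensorProduct.mk k A Aᵐᵒᵖ a ∘ₗ (opLinearEquiv k).toLinearMap)
    (fun a a' w => LinearMap.ext fun b => by
      change ((a + a') ⊗ₜ[k] op b : Env k A A) • u w
        = (a ⊗ₜ[k] op b : Env k A A) • u w + (a' ⊗ₜ[k] op b : Env k A A) • u w
      rw [TensorProduct.add_tmul, add_smul])
    (fun c a w => LinearMap.ext fun b => by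
      change ((c • a) ⊗ₜ[k] op b : Env k A A) • u w = c • (a ⊗ₜ[k] op b : Env k A A) • u w
      rw [← TensorProduct.smul_tmul', smul_assoc])
    (fun a w w' => LinearMap.ext fun b => by
      change (a ⊗ₜ[k] op b : Env k A A) • u (w + w')
        = (a ⊗ₜ[k] op b : Env k A A) • u w + (a ⊗ₜ[k] op b : Env k A A) • u w'
      rw [map_add, smul_add])
    (fun c a w => LinearMap.ext fun b => by
      change (a ⊗ₜ[k] op b : Env k A A) • u (c • w) = c • (a ⊗ₜ[k] op b : Env k A A) • u w
      rw [map_smul, smul_algebra_smul_comm])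

theorem indTri_apply (a : A) (w : W.carrier) (b : A) :
    indTri u a w b = (a ⊗ₜ[k] op b : Env k A A) • u w := rfl

variable (hu : ∀ (e : Env k R R) w, u (e • w) = envMap f e • u w)

include hu in
theorem indTri_balanced (a : A) (r : R) (w : W.carrier) :
    indTri u (a * f r) w = indTri u a ((r ⊗ₜ[k] (1 : Rᵐᵒᵖ) : Env k R R) • w) := by
  refine LinearMap.ext fun b => ?_
  rw [indTri_apply, indTri_apply, hu, smul_smul, ← op_one, envMap_tmul,
    Algebra.TensorProduct.tmul_mul_tmul, map_one, op_one, mul_one]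

/-- The map `A ⊗_R W → Hom(A, M)` with `a ⊗ w ↦ (b ↦ (a ⊗ b) u(w))`. -/
def indLLift : (indL f hf W).carrier →ₗ[k] A →ₗ[k] M :=
  tensLift (M := bimodL f hf) (N := W) (indTri u ∘ₗ ofL f hf) (fun a r w => by
    obtain ⟨a, rfl⟩ := toL_surjective f hf a
    rw [smul_toL_right]
    exact indTri_balanced f u hu a r w)

theorem indLLift_tt (a : A) (w : W.carrier) (b : A) :
    indLLift f hf u hu (indLTt f hf W a w) b = (a ⊗ₜ[k] op b : Env k A A) • u w := rfl

theorem indLLift_balanced (z : (indL f hf W).carrier) (r : R) (b : A) :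
    indLLift f hf u hu (((1 : A) ⊗ₜ[k] op r : Env k A R) • z) b
      = indLLift f hf u hu z (f r * b) := by
  induction z using indL_induction with
  | tt a w =>
    rw [smul_indLTt, indLLift_tt, indLLift_tt, hu, smul_smul, envMap_tmul,
      Algebra.TensorProduct.tmul_mul_tmul, map_one, mul_one, one_mul, op_mul]
  | zero => rw [smul_zero, map_zero]; rfl
  | add x y hx hy => rw [smul_add, map_add, map_add, LinearMap.add_apply, LinearMap.add_apply, hx, hy]

/-- The linear map underlying `indLift`. -/
def indLiftₖ : (ind f hf W).carrier →ₗ[k] M :=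
  tensLift (M := indL f hf W) (N := bimodR f hf) ((indLLift f hf u hu).compl₂ (ofR f hf)) (fun z r b => by
    obtain ⟨b, rfl⟩ := toR_surjective f hf b
    rw [smul_toR_left]
    exact indLLift_balanced f hf u hu z r b)

theorem indLiftₖ_tt (a : A) (w : W.carrier) (b : A) :
    indLiftₖ f hf u hu (indTt f hf W a w b) = (a ⊗ₜ[k] op b : Env k A A) • u w := rfl

theorem indLiftₖ_smul (e : Env k A A) (x : (ind f hf W).carrier) :
    indLiftₖ f hf u hu (e • x) = e • indLiftₖ f hf u hu x := by
  induction x using ind_induction with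
  | zero => rw [smul_zero, map_zero, smul_zero]
  | add x y hx hy => rw [smul_add, map_add, hx, hy, map_add, smul_add]
  | tt a w b =>
    induction e using TensorProduct.induction_on with
    | zero =>
      refine (congrArg (indLiftₖ f hf u hu) (zero_smul (Env k A A) _)).trans ?_
      exact (map_zero (indLiftₖ f hf u hu)).trans (zero_smul (Env k A A) (_ : M)).symm
    | add x y hx hy =>
      refine (congrArg (indLiftₖ f hf u hu) (add_smul x y _)).trans ?_
      rw [map_add, hx, hy]
      exact (add_smul x y _).symm
    | tmul x y =>
      obtain ⟨y, rfl⟩ := op_surjective y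
      rw [smul_indTt, indLiftₖ_tt, indLiftₖ_tt, smul_smul, Algebra.TensorProduct.tmul_mul_tmul,
        op_mul]

/-- The bimodule map `A ⊗_R W ⊗_R A → M` extending an `R`-`R`-bimodule map `W → M`. -/
def indLift : (ind f hf W).carrier →ₗ[Env k A A] M :=
  { indLiftₖ f hf u hu with map_smul' := indLiftₖ_smul f hf u hu }

theorem indLift_tt (a : A) (w : W.carrier) (b : A) :
    indLift f hf u hu (indTt f hf W a w b) = (a ⊗ₜ[k] op b : Env k A A) • u w := rfl

end Ext

end Induced

/-! ### Induced bimodules modulo their positive part, and their projectivity. -/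

section Induced

variable {k : Type u} [CommRing k] {A : Type v} [Ring A] [Algebra k A]
  {𝒜 : ℤ → Submodule k A} [GradedAlgebra 𝒜] {R : Type v} [Ring R] [Algebra k R]
  (f : R →ₐ[k] A) (hf : ∀ i, ∀ r ∈ trivGr k R i, f r ∈ 𝒜 i)
  {W : GrMod.{u, v, w} (envGr (trivGr k R) (trivGr k R))}

theorem one_tmul_op_one {A : Type v} {B : Type w} [Ring A] [Algebra k A] [Ring B] [Algebra k B] :
    ((1 : A) ⊗ₜ[k] op (1 : B) : Env k A B) = 1 := rfl

/-- For homogeneous `a` there are three cases: in negative degree `a = 0`, in degree `0` it comes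
from `R` and is absorbed into `w` by balancing, and in positive degree the tensor is `a` times
another one. With the mirror statement on the right, `A ⊗_R W ⊗_R A` is generated by `1 ⊗ W ⊗ 1`
modulo its positive part. -/
theorem exists_sub_indTt_mem_left (hA : ∀ i < 0, 𝒜 i = ⊥) (h0 : ∀ a ∈ 𝒜 0, ∃ r, f r = a)
    (a : A) (w : W.carrier) (b : A) :
    ∃ w', indTt f hf W a w b - indTt f hf W 1 w' b ∈ (ind f hf W).positivePart := by
  induction a using mem_induction (iSup_grading 𝒜) with
  | zero => exact ⟨0, by simp⟩
  | add x y hx hy =>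
    obtain ⟨w₁, h₁⟩ := hx
    obtain ⟨w₂, h₂⟩ := hy
    refine ⟨w₁ + w₂, ?_⟩
    have := add_mem h₁ h₂
    rw [sub_add_sub_comm] at this
    simpa only [map_add, LinearMap.add_apply] using this
  | hom p a ha =>
    rcases lt_trichotomy p 0 with hp | rfl | hp
    · rw [hA p hp, Submodule.mem_bot] at ha
      exact ⟨0, by simp [ha]⟩
    · obtain ⟨r, rfl⟩ := h0 a ha
      refine ⟨(r ⊗ₜ[k] 1 : Env k R R) • w, ?_⟩
      rw [← indTt_balanceL, one_mul, sub_self]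
      exact zero_mem _
    · refine ⟨0, ?_⟩
      have h1 : indTt f hf W a w b
          = (a ⊗ₜ[k] op (1 : A) : Env k A A) • indTt f hf W 1 w b := by
        rw [smul_indTt, mul_one, mul_one]
      rw [map_zero, LinearMap.zero_apply, sub_zero, h1]
      exact GrMod.smul_mem_positivePart _ (by omega)
        (tmul_mem_envGr ha (SetLike.one_mem_graded 𝒜)) _

theorem exists_sub_indTt_mem_right (hA : ∀ i < 0, 𝒜 i = ⊥) (h0 : ∀ a ∈ 𝒜 0, ∃ r, f r = a)
    (w : W.carrier) (b : A) :
    ∃ w', indTt f hf W 1 w b - indTt f hf W 1 w' 1 ∈ (ind f hf W).positivePart := by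
  induction b using mem_induction (iSup_grading 𝒜) with
  | zero => exact ⟨0, by simp⟩
  | add x y hx hy =>
    obtain ⟨w₁, h₁⟩ := hx
    obtain ⟨w₂, h₂⟩ := hy
    refine ⟨w₁ + w₂, ?_⟩
    have := add_mem h₁ h₂
    rw [sub_add_sub_comm] at this
    simpa only [map_add, LinearMap.add_apply] using this
  | hom p b hb =>
    rcases lt_trichotomy p 0 with hp | rfl | hp
    · rw [hA p hp, Submodule.mem_bot] at hb
      exact ⟨0, by simp [hb]⟩
    · obtain ⟨r, rfl⟩ := h0 b hb
      refine ⟨(1 ⊗ₜ[k] op r : Env k R R) • w, ?_⟩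
      rw [← indTt_balanceR, mul_one, sub_self]
      exact zero_mem _
    · refine ⟨0, ?_⟩
      have h1 : indTt f hf W 1 w b
          = ((1 : A) ⊗ₜ[k] op b : Env k A A) • indTt f hf W 1 w 1 := by
        rw [smul_indTt, mul_one, one_mul]
      rw [map_zero, LinearMap.zero_apply, sub_zero, h1]
      exact GrMod.smul_mem_positivePart _ (by omega)
        (tmul_mem_envGr (SetLike.one_mem_graded 𝒜) hb) _

theorem exists_sub_indTt_mem (hA : ∀ i < 0, 𝒜 i = ⊥) (h0 : ∀ a ∈ 𝒜 0, ∃ r, f r = a)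
    (x : (ind f hf W).carrier) :
    ∃ w, x - indTt f hf W 1 w 1 ∈ (ind f hf W).positivePart := by
  induction x using ind_induction with
  | zero => exact ⟨0, by simp⟩
  | add x y hx hy =>
    obtain ⟨w₁, h₁⟩ := hx
    obtain ⟨w₂, h₂⟩ := hy
    refine ⟨w₁ + w₂, ?_⟩
    have := add_mem h₁ h₂
    rw [sub_add_sub_comm] at this
    simpa only [map_add, LinearMap.add_apply] using this
  | tt a w b =>
    obtain ⟨w', hw'⟩ := exists_sub_indTt_mem_left f hf hA h0 a w b
    obtain ⟨w'', hw''⟩ := exists_sub_indTt_mem_right f hf hA h0 w' b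
    refine ⟨w'', ?_⟩
    have := add_mem hw' hw''
    rwa [sub_add_sub_cancel] at this

/-- Scalars from `R` cross both tensor signs, so the unit `w ↦ 1 ⊗ w ⊗ 1` of the adjunction is
`R`-`R`-linear. -/
theorem indTt_one_smul (e : Env k R R) (w : W.carrier) :
    indTt f hf W 1 (e • w) 1 = envMap f e • indTt f hf W 1 w 1 := by
  induction e using TensorProduct.induction_on with
  | zero =>
    have h1 : (0 : Env k R R) • w = 0 := zero_smul (Env k R R) w
    refine (congrArg (fun w => indTt f hf W 1 w 1) h1).trans ?_
    rw [map_zero, LinearMap.zero_apply]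
    exact ((congrArg (· • indTt f hf W 1 w 1) (map_zero (envMap f))).trans
      (zero_smul (Env k A A) (indTt f hf W 1 w 1))).symm
  | add x y hx hy => rw [add_smul, map_add, map_add, LinearMap.add_apply, hx, hy, add_smul]
  | tmul r s =>
    obtain ⟨s, rfl⟩ := op_surjective s
    rw [envMap_tmul, smul_indTt, mul_one, one_mul]
    have h1 : (r ⊗ₜ[k] op s : Env k R R) • w
        = (1 ⊗ₜ[k] op s : Env k R R) • (r ⊗ₜ[k] 1 : Env k R R) • w := by
      rw [smul_smul, Algebra.TensorProduct.tmul_mul_tmul, one_mul, mul_one]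
    rw [h1, ← indTt_balanceR, ← indTt_balanceL, one_mul, mul_one]

/-- Induction is left adjoint to restriction along `R ⊗ Rᵒᵖ → A ⊗ Aᵒᵖ`, and restriction preserves
surjections: lift `w ↦ 1 ⊗ w ⊗ 1` over `R ⊗ Rᵒᵖ` and extend the lift to the induced bimodule. -/
theorem projective_ind (hW : Module.Projective (Env k R R) W.carrier) :
    Module.Projective (Env k A A) (ind f hf W).carrier := by
  refine Module.Projective.of_lifting_property'' fun q hq => ?_
  let Y := (ind f hf W).carrier →₀ Env k A A
  let _ : Module (Env k R R) Y := Module.compHom Y (envMap f).toRingHom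
  let _ : Module (Env k R R) (ind f hf W).carrier := Module.compHom _ (envMap f).toRingHom
  let q' : Y →ₗ[Env k R R] (ind f hf W).carrier :=
    { q with map_smul' := fun e x => q.map_smul (envMap f e) x }
  let u₀ : W.carrier →ₗ[Env k R R] (ind f hf W).carrier :=
    { toFun := fun w => indTt f hf W 1 w 1
      map_add' := fun w w' => by rw [map_add, LinearMap.add_apply]
      map_smul' := indTt_one_smul f hf }
  obtain ⟨g, hg⟩ := Module.projective_lifting_property q' u₀ hq
  let u : W.carrier →ₗ[k] Y :=
    { toFun := g
      map_add' := map_add g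
      map_smul' := fun c w => by
        have h1 : c • w = (algebraMap k (Env k R R) c) • w := (algebraMap_smul _ c w).symm
        rw [h1, map_smul]
        change envMap f (algebraMap k (Env k R R) c) • g w = c • g w
        rw [AlgHom.commutes, algebraMap_smul] }
  refine ⟨indLift f hf (M := (ind f hf W).carrier →₀ Env k A A) u
    (fun e w => g.map_smul e w), LinearMap.ext fun x => ?_⟩
  rw [LinearMap.comp_apply, LinearMap.id_apply]
  induction x using ind_induction with
  | zero => rw [map_zero, map_zero]
  | add x y hx hy => rw [map_add, map_add, hx, hy]
  | tt a w b =>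
    have h1 : q (g w) = indTt f hf W 1 w 1 := LinearMap.congr_fun hg w
    rw [indLift_tt, map_smul]
    change (a ⊗ₜ[k] op b : Env k A A) • q (g w) = _
    rw [h1, smul_indTt, mul_one, one_mul]

section Graded

variable {M : GrMod.{u, v, w₁} (envGr 𝒜 𝒜)} (u : W.carrier →ₗ[k] M.carrier)
  (hu : ∀ (e : Env k R R) w, u (e • w) = envMap f e • u w)

theorem isGrHom_indLift (hg : ∀ i, ∀ w ∈ W.deg i, u w ∈ M.deg i) :
    GrMod.IsGrHom (indLift f hf u hu) := by
  intro i x hx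
  have : (ind f hf W).deg i ≤ (M.deg i).comap ((indLift f hf u hu).restrictScalars k) :=
    ind_deg_le f hf fun p q r hpqr a ha w hw b hb => by
      rw [Submodule.mem_comap, LinearMap.coe_restrictScalars, indLift_tt]
      have := M.smul_mem (tmul_mem_envGr ha hb) (hg _ _ hw)
      rwa [show p + r + q = i by omega] at this
  exact this hx

omit [GradedAlgebra 𝒜] in
theorem map_mem_positivePart {N : GrMod.{u, v, w₂} (envGr 𝒜 𝒜)}
    (g : M.carrier →ₗ[Env k A A] N.carrier) {x : M.carrier} (hx : x ∈ M.positivePart) :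
    g x ∈ N.positivePart := by
  have : M.positivePart ≤ N.positivePart.comap g := by
    refine Submodule.span_le.2 ?_
    rintro _ ⟨i, hi, e, he, x, rfl⟩
    exact Submodule.subset_span ⟨i, hi, e, he, g x, map_smul g e x⟩
  exact this hx

/-- Modulo the positive part `x` is some `1 ⊗ w ⊗ 1`, whose image is `u w`. Bimodule maps preserve
positive parts, so `u w` lies in `E⁺M` and `w = 0`. -/
theorem mem_positivePart_of_indLift (hA : ∀ i < 0, 𝒜 i = ⊥) (h0 : ∀ a ∈ 𝒜 0, ∃ r, f r = a)
    (h : ∀ w, u w ∈ M.positivePart → w = 0) {x : (ind f hf W).carrier}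
    (hx : indLift f hf u hu x ∈ M.positivePart) : x ∈ (ind f hf W).positivePart := by
  obtain ⟨w, hw⟩ := exists_sub_indTt_mem f hf hA h0 x
  have h1 := sub_mem hx (map_mem_positivePart (indLift f hf u hu) hw)
  rw [map_sub, sub_sub_cancel, indLift_tt, one_tmul_op_one, one_smul] at h1
  rwa [h w h1, map_zero, LinearMap.zero_apply, sub_zero] at hw

end Graded
end Induced

/-! ### Projective covers by induced bimodules. -/

section Covers

variable {k : Type u} [Field k] {A : Type v} [Ring A] [Algebra k A]
  {𝒜 : ℤ → Submodule k A} [GradedAlgebra 𝒜] {R : Type v} [Ring R] [Algebra k R]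
  (f : R →ₐ[k] A) (hf : ∀ i, ∀ r ∈ trivGr k R i, f r ∈ 𝒜 i)

/-- An `A`-`A`-bimodule as an `R`-`R`-bimodule. -/
abbrev GrMod.restrictEnv (M : GrMod.{u, v, w} (envGr 𝒜 𝒜)) :
    GrMod.{u, v, w} (envGr (trivGr k R) (trivGr k R)) :=
  M.restrict (envMap f) (envMap_mem f hf)

/-- A section of a surjection of graded bimodules over a separable algebra, extended to the induced
bimodule. -/
theorem exists_indLift (hR : IsSeparableAlg k R) (hA : ∀ i < 0, 𝒜 i = ⊥)
    (h0 : ∀ a ∈ 𝒜 0, ∃ r, f r = a) {M : GrMod.{u, v, w₁} (envGr 𝒜 𝒜)}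
    {W : GrMod.{u, v, w} (envGr (trivGr k R) (trivGr k R))}
    (q : (M.restrictEnv f hf).carrier →ₗ[Env k R R] W.carrier) (hq : GrMod.IsGrHom q)
    (hs : Function.Surjective q) (hk : ∀ x : M.carrier, q x = 0 ↔ x ∈ M.positivePart) :
    ∃ Φ : (ind f hf W).carrier →ₗ[Env k A A] M.carrier, GrMod.IsGrHom Φ ∧
      (∀ x, Φ x ∈ M.positivePart → x ∈ (ind f hf W).positivePart) ∧
      ∀ y, ∃ x, y - Φ x ∈ M.positivePart := by
  have hE := iSup_envGr (iSup_grading (trivGr k R)) (iSup_grading (trivGr k R))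
  -- Separability makes `W` projective over `R ⊗ Rᵒᵖ`, so `q` has a graded section `u`; this section
  -- is what gets extended.
  obtain ⟨u, hug, hu⟩ := GrMod.exists_lift (X := W) (Y := M.restrictEnv f hf) (Z := W) hE
    (hR.projective_env W.carrier) q hq LinearMap.id (fun _ _ h => h) (fun x => hs x)
  let u' : W.carrier →ₗ[k] M.carrier :=
    { toFun := u
      map_add' := map_add u
      map_smul' := fun c w => by
        have h1 : c • w = (algebraMap k (Env k R R) c) • w := (algebraMap_smul _ c w).symm
        rw [h1, map_smul]
        change envMap f (algebraMap k (Env k R R) c) • (show M.carrier from u w)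
          = c • (show M.carrier from u w)
        rw [AlgHom.commutes, algebraMap_smul] }
  have hu' : ∀ (e : Env k R R) w, u' (e • w) = envMap f e • u' w := fun e w => u.map_smul e w
  refine ⟨indLift f hf u' hu', isGrHom_indLift f hf u' hu' hug, fun x hx => ?_, fun y => ?_⟩
  · refine mem_positivePart_of_indLift f hf u' hu' hA h0 (fun w hw => ?_) hx
    exact (hu w).symm.trans ((hk (u' w)).2 hw)
  · refine ⟨indTt f hf W 1 (q y) 1, (hk _).1 ?_⟩
    rw [indLift_tt, one_tmul_op_one, one_smul]
    refine (map_sub q (y : (M.restrictEnv f hf).carrier) (u (q y))).trans ?_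
    exact sub_eq_zero.2 (hu (q y)).symm

end Covers

namespace GrMod

variable {k : Type u} [CommRing k] {E : Type v} [Ring E] [Algebra k E] {ℰ : ℤ → Submodule k E}
  {E' : Type w₁} [Ring E'] [Algebra k E'] {ℰ' : ℤ → Submodule k E'} (φ : E' →ₐ[k] E)
  (hφ : ∀ i, ∀ e ∈ ℰ' i, φ e ∈ ℰ i)

/-- A submodule, viewed as a submodule of the restriction along `φ`. -/
def restrictSubmodule {M : GrMod.{u, v, w} ℰ} (N : Submodule E M.carrier) :
    Submodule E' (M.restrict φ hφ).carrier where
  carrier := {x : M.carrier | x ∈ N}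
  add_mem' := N.add_mem
  zero_mem' := N.zero_mem
  smul_mem' := fun e _ hx => N.smul_mem (φ e) hx

theorem isHomogeneous_restrictSubmodule {M : GrMod.{u, v, w} ℰ} {N : Submodule E M.carrier}
    (hN : M.IsHomogeneous N) : (M.restrict φ hφ).IsHomogeneous (restrictSubmodule φ hφ N) :=
  hN

end GrMod

section Covers

variable {k : Type u} [Field k] {A : Type v} [Ring A] [Algebra k A]
  {𝒜 : ℤ → Submodule k A} [GradedAlgebra 𝒜] {R : Type v} [Ring R] [Algebra k R]
  (f : R →ₐ[k] A) (hf : ∀ i, ∀ r ∈ trivGr k R i, f r ∈ 𝒜 i)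

include hf in
-- The cover is induced from `W = M / E⁺M`. It is onto modulo `E⁺M`, hence onto by Nakayama. Modulo
-- positive parts it is injective, so its kernel lies in the positive part.
theorem exists_minimal_cover (hR : IsSeparableAlg k R) (hA : ∀ i < 0, 𝒜 i = ⊥)
    (h0 : ∀ a ∈ 𝒜 0, ∃ r, f r = a) (M : GrMod.{u, v, v} (envGr 𝒜 𝒜)) (hM : M.IsBoundedBelow) :
    ∃ (F : GrMod.{u, v, v} (envGr 𝒜 𝒜)) (p : F.carrier →ₗ[Env k A A] M.carrier),
      F.IsBoundedBelow ∧ Module.Projective (Env k A A) F.carrier ∧ GrMod.IsGrHom p ∧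
        Function.Surjective p ∧ LinearMap.ker p ≤ F.positivePart := by
  have hE := iSup_envGr (iSup_grading 𝒜) (iSup_grading 𝒜)
  have hE0 := envGr_eq_bot hA hA
  obtain ⟨c, hc⟩ := hM
  let D := GrMod.restrictSubmodule (envMap f) (envMap_mem f hf) M.positivePart
  have hD : (M.restrictEnv f hf).IsHomogeneous D :=
    GrMod.isHomogeneous_restrictSubmodule _ _ (GrMod.isHomogeneous_positivePart hE M)
  let W := (M.restrictEnv f hf).quot D hD
  have hWc : ∀ i < c, W.deg i = ⊥ := GrMod.IsBoundedBelow.of_surjective (M := M.restrictEnv f hf)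
    (N := W) hc (D.mkQ.restrictScalars k) (fun i x hx => ⟨x, hx, rfl⟩) D.mkQ_surjective
  obtain ⟨p, hpg, hp, hp'⟩ := exists_indLift f hf (W := W) hR hA h0 D.mkQ
    (fun i x hx => ⟨x, hx, rfl⟩) D.mkQ_surjective (fun x => Submodule.Quotient.mk_eq_zero D)
  refine ⟨ind f hf W, p, ⟨c, ind_deg_eq_bot f hf hA hWc⟩,
    projective_ind f hf (hR.projective_env W.carrier), hpg, ?_, fun x hx => hp x ?_⟩
  · refine LinearMap.range_eq_top.1 (GrMod.eq_top_of_sup_positivePart hE hE0 ⟨c, hc⟩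
      (GrMod.isHomogeneous_range p hpg) fun x => ?_)
    obtain ⟨y, hy⟩ := hp' x
    exact ⟨p y, ⟨y, rfl⟩, hy⟩
  · rw [LinearMap.mem_ker.1 hx]; exact zero_mem _

/-- A graded projective bimodule `P` with `P / E⁺P` bounded below is induced from `P / E⁺P`. -/
theorem isomorphic_ind (hR : IsSeparableAlg k R) (hA : ∀ i < 0, 𝒜 i = ⊥)
    (h0 : ∀ a ∈ 𝒜 0, ∃ r, f r = a) {P : GrMod.{u, v, w₁} (envGr 𝒜 𝒜)}
    (hP : Module.Projective (Env k A A) P.carrier)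
    {W : GrMod.{u, v, w} (envGr (trivGr k R) (trivGr k R))}
    (q : (P.restrictEnv f hf).carrier →ₗ[Env k R R] W.carrier) (hq : GrMod.IsGrHom q)
    (hs : Function.Surjective q) (hk : ∀ x : P.carrier, q x = 0 ↔ x ∈ P.positivePart)
    {c : ℤ} (hW : ∀ i < c, W.deg i = ⊥) : P.Isomorphic (ind f hf W) := by
  have hE := iSup_envGr (iSup_grading 𝒜) (iSup_grading 𝒜)
  have hE0 := envGr_eq_bot hA hA
  obtain ⟨p, hpg, hp, hp'⟩ := exists_indLift f hf (W := W) hR hA h0 q hq hs hk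
  let D := P.positivePart
  let Z := P.quot D (GrMod.isHomogeneous_positivePart hE P)
  have hmk : ∀ x y : P.carrier, D.mkQ x = D.mkQ y ↔ x - y ∈ D := fun x y =>
    Submodule.Quotient.eq D
  -- The comparison map goes from `P` to the induced bimodule: Nakayama for surjectivity needs a
  -- target bounded below, and such a bound is known only for `W`. It exists because `P` is
  -- projective and `p` is onto modulo `E⁺P`.
  obtain ⟨g, hgg, hg⟩ := GrMod.exists_lift (X := P) (Y := ind f hf W) (Z := Z) hE hP (D.mkQ ∘ₗ p)
    (fun i x hx => ⟨p x, hpg _ _ hx, rfl⟩) D.mkQ (fun i x hx => ⟨x, hx, rfl⟩) (fun x => by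
      obtain ⟨y, hy⟩ := hp' x
      exact ⟨y, ((hmk _ _).2 hy).symm⟩)
  have hg' : ∀ x, p (g x) - x ∈ D := fun x => (hmk _ _).1 (hg x)
  have hsurj : Function.Surjective g := by
    refine LinearMap.range_eq_top.1 (GrMod.eq_top_of_sup_positivePart hE hE0
      ⟨c, ind_deg_eq_bot f hf hA hW⟩ (GrMod.isHomogeneous_range g hgg) fun x => ?_)
    refine ⟨g (p x), ⟨p x, rfl⟩, hp _ ?_⟩
    rw [map_sub, ← neg_sub]
    exact neg_mem (hg' (p x))
  have hF : Module.Projective (Env k A A) (ind f hf W).carrier :=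
    projective_ind f hf (hR.projective_env W.carrier)
  obtain ⟨σ, hσ⟩ := Module.projective_lifting_property g LinearMap.id hsurj
  have hσ' : ∀ x, g (σ x) = x := fun x => LinearMap.congr_fun hσ x
  -- The projection of `P` onto `ker g` given by the splitting `σ`.
  let ρ : P.carrier →ₗ[Env k A A] P.carrier := LinearMap.id - σ ∘ₗ g
  have hρ : ∀ x, ρ x = x - σ (g x) := fun x => rfl
  refine GrMod.Isomorphic.of_bijective g hgg ⟨(injective_iff_map_eq_zero g).2 fun x hx => ?_, hsurj⟩
  -- Let `K = ker g`. Since `p g` is the identity modulo `E⁺P`, `K` lies in `E⁺P`; applying `ρ`,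
  -- which fixes `K` and maps `E⁺P` into `E⁺K`, yields `K ⊆ E⁺K`.
  refine GrMod.eq_zero_of_le_positive hE hE0 (envReg 𝒜 𝒜) (isBoundedBelow_envReg hA hA)
    (LinearMap.id : Env k A A →ₗ[Env k A A] Env k A A) (fun _ _ h => h) hP (K := {x | g x = 0})
    (fun x hx => ?_) hx
  have hx0 : g x = 0 := hx
  have hxD : x ∈ D := by
    have := hg' x
    rw [hx0, map_zero, zero_sub] at this
    simpa using this
  have hle : D ≤ (Submodule.span (Env k A A)
      {y | ∃ i : ℤ, 0 < i ∧ ∃ e ∈ envGr 𝒜 𝒜 i, ∃ x ∈ {x | g x = 0}, y = e • x}).comap ρ := by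
    refine Submodule.span_le.2 ?_
    rintro _ ⟨i, hi, e, he, z, rfl⟩
    refine Submodule.subset_span ⟨i, hi, e, he, ρ z, ?_, map_smul ρ e z⟩
    change g (ρ z) = 0
    rw [hρ, map_sub, hσ', sub_self]
  have h1 := hle hxD
  rwa [Submodule.mem_comap, hρ, hx0, map_zero, sub_zero] at h1

end Covers

/-! ### The bimodules `M ⊗_A R` for an augmentation `A → R` -/

/-- `R` is the degree `0` part of the nonnegatively graded algebra `A`. -/
structure IsAugmentation {k : Type u} [CommRing k] {A : Type v} [Ring A] [Algebra k A]
    (𝒜 : ℤ → Submodule k A) {R : Type v} [Ring R] [Algebra k R] (f : R →ₐ[k] A) (π : A →ₐ[k] R) :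
    Prop where
  incl_mem : ∀ i, ∀ r ∈ trivGr k R i, f r ∈ 𝒜 i
  proj_mem : ∀ i, ∀ a ∈ 𝒜 i, π a ∈ trivGr k R i
  proj_incl : ∀ r, π (f r) = r
  incl_proj : ∀ a ∈ 𝒜 0, f (π a) = a
  nonneg : ∀ i < 0, 𝒜 i = ⊥

section RightQuotient

variable {k : Type u} [CommRing k] {A : Type v} [Ring A] [Algebra k A]
  {𝒜 : ℤ → Submodule k A} {R : Type v} [Ring R] [Algebra k R] {f : R →ₐ[k] A} {π : A →ₐ[k] R}

variable (k A) in
/-- The map `id ⊗ gᵒᵖ`. -/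
def envRight {B C : Type v} [Ring B] [Algebra k B] [Ring C] [Algebra k C] (g : B →ₐ[k] C) :
    Env k A B →ₐ[k] Env k A C :=
  Algebra.TensorProduct.map (AlgHom.id k A) (AlgHom.op g)

theorem envRight_tmul {B C : Type v} [Ring B] [Algebra k B] [Ring C] [Algebra k C]
    (g : B →ₐ[k] C) (a : A) (b : B) :
    envRight k A g (a ⊗ₜ[k] op b) = a ⊗ₜ[k] op (g b) := by
  simp [envRight]

theorem envRight_mem {B C : Type v} [Ring B] [Algebra k B] [Ring C] [Algebra k C]
    {ℬ : ℤ → Submodule k B} {𝒞 : ℤ → Submodule k C} (g : B →ₐ[k] C)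
    (hg : ∀ i, ∀ b ∈ ℬ i, g b ∈ 𝒞 i) (i : ℤ) (e : Env k A B) (he : e ∈ envGr 𝒜 ℬ i) :
    envRight k A g e ∈ envGr 𝒜 𝒞 i := by
  have : envGr 𝒜 ℬ i ≤ (envGr 𝒜 𝒞 i).comap (envRight k A g).toLinearMap := by
    refine Submodule.span_le.2 ?_
    rintro _ ⟨p, q, rfl, a, ha, b, hb, rfl⟩
    change envRight k A g (a ⊗ₜ[k] op b) ∈ envGr 𝒜 𝒞 (p + q)
    rw [envRight_tmul]
    exact tmul_mem_envGr ha (hg _ _ hb)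
  exact this he

theorem envRight_envRight (h : IsAugmentation 𝒜 f π) (e : Env k A R) :
    envRight k A π (envRight k A f e) = e := by
  induction e using TensorProduct.induction_on with
  | zero => rw [map_zero, map_zero]
  | add x y hx hy => rw [map_add, map_add, hx, hy]
  | tmul a b =>
    obtain ⟨b, rfl⟩ := op_surjective b
    rw [envRight_tmul, envRight_tmul, h.proj_incl]

namespace GrMod

variable {M : GrMod.{u, v, w} (envGr 𝒜 𝒜)} {N : GrMod.{u, v, w₁} (envGr 𝒜 𝒜)}

theorem tmul_smul_comm (a b : A) (x : M.carrier) :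
    ((a ⊗ₜ[k] (1 : Aᵐᵒᵖ) : Env k A A)) • ((1 : A) ⊗ₜ[k] op b : Env k A A) • x
      = (a ⊗ₜ[k] op b : Env k A A) • x := by
  rw [smul_smul, Algebra.TensorProduct.tmul_mul_tmul, one_mul, mul_one]

variable [GradedAlgebra 𝒜]

/-- The part `M A⁺` of a bimodule. -/
def rightPart (h : IsAugmentation 𝒜 f π) (M : GrMod.{u, v, w} (envGr 𝒜 𝒜)) :
    Submodule (Env k A A) M.carrier where
  toAddSubmonoid := (Submodule.span k {y : M.carrier | ∃ i : ℤ, 0 < i ∧ ∃ a ∈ 𝒜 i,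
    ∃ x : M.carrier, y = ((1 : A) ⊗ₜ[k] op a : Env k A A) • x}).toAddSubmonoid
  smul_mem' e x hx := by
    change e • x ∈ Submodule.span k _
    change x ∈ Submodule.span k _ at hx
    induction e using TensorProduct.induction_on with
    | zero => rw [zero_smul (Env k A A) x]; exact zero_mem _
    | add e e' he he' => rw [add_smul]; exact add_mem he he'
    | tmul c b =>
      obtain ⟨b, rfl⟩ := op_surjective b
      induction hx using Submodule.span_induction with
      | zero => rw [smul_zero]; exact zero_mem _
      | add x y _ _ hx hy => rw [smul_add]; exact add_mem hx hy
      | smul t x _ hx => rw [smul_comm]; exact Submodule.smul_mem _ _ hx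
      | mem x hx =>
        obtain ⟨i, hi, a, ha, x, rfl⟩ := hx
        have h0 : (0 : Env k A A) • ((1 : A) ⊗ₜ[k] op a : Env k A A) • x = 0 :=
          zero_smul (Env k A A) (((1 : A) ⊗ₜ[k] op a : Env k A A) • x)
        induction b using mem_induction (iSup_grading 𝒜) with
        | zero => rw [op_zero, TensorProduct.tmul_zero, h0]; exact zero_mem _
        | add b b' hb hb' =>
          rw [op_add, TensorProduct.tmul_add, add_smul]; exact add_mem hb hb'
        | hom j b hb =>
          rcases lt_or_ge j 0 with hj | hj
          · rw [h.nonneg j hj, Submodule.mem_bot] at hb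
            rw [hb, op_zero, TensorProduct.tmul_zero, h0]
            exact zero_mem _
          -- `(x a) b = x (a b)`, and `a b` still has positive degree because `j` is nonnegative;
          -- the left factor `c` moves inside.
          · refine Submodule.subset_span ⟨i + j, by omega, a * b, SetLike.mul_mem_graded ha hb,
              (c ⊗ₜ[k] (1 : Aᵐᵒᵖ) : Env k A A) • x, ?_⟩
            rw [smul_smul, smul_smul, Algebra.TensorProduct.tmul_mul_tmul,
              Algebra.TensorProduct.tmul_mul_tmul, one_mul, mul_one, mul_one, op_mul]

theorem rightPart_le (h : IsAugmentation 𝒜 f π) {S : Submodule k M.carrier}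
    (hS : ∀ i : ℤ, 0 < i → ∀ a ∈ 𝒜 i, ∀ x : M.carrier, ((1 : A) ⊗ₜ[k] op a : Env k A A) • x ∈ S)
    {x : M.carrier} (hx : x ∈ M.rightPart h) : x ∈ S := by
  have : Submodule.span k {y : M.carrier | ∃ i : ℤ, 0 < i ∧ ∃ a ∈ 𝒜 i,
    ∃ x : M.carrier, y = ((1 : A) ⊗ₜ[k] op a : Env k A A) • x} ≤ S := by
    refine Submodule.span_le.2 ?_
    rintro _ ⟨i, hi, a, ha, x, rfl⟩
    exact hS i hi a ha x
  exact this hx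

theorem smul_mem_rightPart (h : IsAugmentation 𝒜 f π) {i : ℤ} (hi : 0 < i) {a : A} (ha : a ∈ 𝒜 i)
    (x : M.carrier) : ((1 : A) ⊗ₜ[k] op a : Env k A A) • x ∈ M.rightPart h :=
  Submodule.subset_span (R := k) (M := M.carrier) ⟨i, hi, a, ha, x, rfl⟩

theorem isHomogeneous_rightPart (h : IsAugmentation 𝒜 f π) : M.IsHomogeneous (M.rightPart h) := by
  intro x hx i
  refine rightPart_le h (S := ((M.rightPart h).restrictScalars k).comap
    ((Finsupp.lapply i) ∘ₗ components M.internal)) (fun j hj a ha x => ?_) hx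
  change components M.internal _ i ∈ M.rightPart h
  rw [M.components_smul (p := 0 + j) (tmul_mem_envGr (SetLike.one_mem_graded 𝒜) ha)]
  exact smul_mem_rightPart h hj ha _

theorem map_mem_rightPart (h : IsAugmentation 𝒜 f π) (g : M.carrier →ₗ[k] N.carrier)
    (hg : ∀ (a : A) x, g (((1 : A) ⊗ₜ[k] op a : Env k A A) • x)
      = ((1 : A) ⊗ₜ[k] op a : Env k A A) • g x) {x : M.carrier} (hx : x ∈ M.rightPart h) :
    g x ∈ N.rightPart h := by
  refine rightPart_le h (S := ((N.rightPart h).restrictScalars k).comap g) (fun j hj a ha x => ?_) hx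
  change g _ ∈ N.rightPart h
  rw [hg]
  exact smul_mem_rightPart h hj ha _

/-- On `M / M A⁺` the right action of `A` factors through `π`: the parts of positive degree of `b`
act as zero, and `f π` is the identity in degree `0`. -/
theorem smul_sub_smul_mem_rightPart (h : IsAugmentation 𝒜 f π) (b : A) (x : M.carrier) :
    ((1 : A) ⊗ₜ[k] op b : Env k A A) • x - ((1 : A) ⊗ₜ[k] op (f (π b)) : Env k A A) • x
      ∈ M.rightPart h := by
  induction b using mem_induction (iSup_grading 𝒜) with
  | zero => rw [map_zero, map_zero, sub_self]; exact zero_mem _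
  | add b b' hb hb' =>
    have := add_mem hb hb'
    rwa [sub_add_sub_comm, ← add_smul, ← add_smul, ← TensorProduct.tmul_add,
      ← TensorProduct.tmul_add, ← op_add, ← op_add, ← map_add, ← map_add] at this
  | hom j b hb =>
    rcases lt_trichotomy j 0 with hj | rfl | hj
    · rw [h.nonneg j hj, Submodule.mem_bot] at hb
      rw [hb, map_zero, map_zero, sub_self]; exact zero_mem _
    · rw [h.incl_proj b hb, sub_self]; exact zero_mem _
    · have : π b = 0 := by simpa [trivGr, hj.ne'] using h.proj_mem j b hb
      rw [this, map_zero, op_zero, TensorProduct.tmul_zero, zero_smul (Env k A A) x, sub_zero]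
      exact smul_mem_rightPart h hj hb _

theorem smul_sub_envRight_smul_mem (h : IsAugmentation 𝒜 f π) (e : Env k A A) (x : M.carrier) :
    e • x - envRight k A f (envRight k A π e) • x ∈ M.rightPart h := by
  induction e using TensorProduct.induction_on with
  | zero =>
    rw [map_zero, map_zero, sub_self]; exact zero_mem _
  | add e e' he he' =>
    have := add_mem he he'
    rwa [sub_add_sub_comm, ← add_smul, ← add_smul, ← map_add, ← map_add] at this
  | tmul c b =>
    obtain ⟨b, rfl⟩ := op_surjective b
    rw [envRight_tmul, envRight_tmul, ← tmul_smul_comm c b, ← tmul_smul_comm c (f (π b)),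
      ← smul_sub]
    exact Submodule.smul_mem _ _ (smul_sub_smul_mem_rightPart h b x)

/-- The graded `A`-`R`-bimodule `M / M A⁺`. -/
def rightQuot (h : IsAugmentation 𝒜 f π) (M : GrMod.{u, v, w} (envGr 𝒜 𝒜)) :
    GrMod.{u, v, w} (envGr 𝒜 (trivGr k R)) :=
  (M.quot (M.rightPart h) (isHomogeneous_rightPart h)).restrict (envRight k A f)
    (envRight_mem f h.incl_mem)

/-- The quotient map `M → M / M A⁺`. -/
def rightMk (h : IsAugmentation 𝒜 f π) (M : GrMod.{u, v, w} (envGr 𝒜 𝒜)) :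
    M.carrier →ₗ[k] (M.rightQuot h).carrier :=
  (M.rightPart h).mkQ.restrictScalars k

theorem rightMk_surjective (h : IsAugmentation 𝒜 f π) : Function.Surjective (rightMk h M) :=
  (M.rightPart h).mkQ_surjective

theorem rightMk_eq_zero (h : IsAugmentation 𝒜 f π) {x : M.carrier} :
    rightMk h M x = 0 ↔ x ∈ M.rightPart h :=
  Submodule.Quotient.mk_eq_zero _

theorem rightMk_mem (h : IsAugmentation 𝒜 f π) {i : ℤ} {x : M.carrier} (hx : x ∈ M.deg i) :
    rightMk h M x ∈ (M.rightQuot h).deg i := ⟨x, hx, rfl⟩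

theorem rightMk_smul (h : IsAugmentation 𝒜 f π) (e : Env k A A) (x : M.carrier) :
    rightMk h M (e • x) = envRight k A π e • rightMk h M x :=
  (Submodule.Quotient.eq _).2 (smul_sub_envRight_smul_mem h e x)

theorem smul_rightMk (h : IsAugmentation 𝒜 f π) (e : Env k A R) (x : M.carrier) :
    e • rightMk h M x = rightMk h M (envRight k A f e • x) := rfl

/-- Since `M A⁺ ⊆ E⁺M`, dividing by `M A⁺` loses no information about the positive part. This
transports minimality from `P` to `P ⊗_A R`. -/
theorem rightMk_mem_positivePart (h : IsAugmentation 𝒜 f π) {x : M.carrier} :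
    rightMk h M x ∈ (M.rightQuot h).positivePart ↔ x ∈ M.positivePart := by
  constructor
  · intro hx
    have hle : M.rightPart h ≤ M.positivePart := fun x hx =>
      rightPart_le h (S := M.positivePart.restrictScalars k) (fun i hi a ha x =>
        M.smul_mem_positivePart (i := 0 + i) (by omega)
          (tmul_mem_envGr (SetLike.one_mem_graded 𝒜) ha) x) hx
    have : ∀ y ∈ (M.rightQuot h).positivePart, ∃ x ∈ M.positivePart, y = rightMk h M x := by
      intro y hy
      induction hy using Submodule.span_induction with
      | zero => exact ⟨0, zero_mem _, (map_zero (rightMk h M)).symm⟩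
      | add y y' _ _ hy hy' =>
        obtain ⟨x, hx, rfl⟩ := hy
        obtain ⟨x', hx', rfl⟩ := hy'
        exact ⟨x + x', add_mem hx hx', ((rightMk h M).map_add x x').symm⟩
      | smul e y _ hy =>
        obtain ⟨x, hx, rfl⟩ := hy
        exact ⟨_, Submodule.smul_mem _ (envRight k A f e) hx, rfl⟩
      | mem y hy =>
        obtain ⟨i, hi, e, he, y, rfl⟩ := hy
        obtain ⟨x, rfl⟩ := rightMk_surjective h y
        exact ⟨envRight k A f e • x,
          M.smul_mem_positivePart hi (envRight_mem f h.incl_mem _ _ he) x, rfl⟩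
    obtain ⟨x', hx', hxx'⟩ := this _ hx
    have : x - x' ∈ M.rightPart h := (Submodule.Quotient.eq _).1 hxx'
    have := add_mem (hle this) hx'
    rwa [sub_add_cancel] at this
  · intro hx
    induction hx using Submodule.span_induction with
    | zero => rw [map_zero]; exact zero_mem _
    | add x y _ _ hx hy => rw [map_add]; exact add_mem hx hy
    | smul e x _ hx => rw [rightMk_smul]; exact Submodule.smul_mem _ _ hx
    | mem x hx =>
      obtain ⟨i, hi, e, he, x, rfl⟩ := hx
      rw [rightMk_smul]
      exact smul_mem_positivePart _ hi (envRight_mem π h.proj_mem _ _ he) _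

/-- The universal property of `M ⊗_A R`: a map that is semilinear along `id ⊗ π` kills `M A⁺`,
because `π` kills positive degrees. -/
theorem exists_rightQuot_map (h : IsAugmentation 𝒜 f π) {L : Type*} [AddCommGroup L]
    [Module (Env k A R) L] (g : M.carrier →+ L)
    (hg : ∀ (e : Env k A A) x, g (e • x) = envRight k A π e • g x) :
    ∃ g' : (M.rightQuot h).carrier →ₗ[Env k A R] L, ∀ x, g' (rightMk h M x) = g x := by
  let _ : Module (Env k A A) L := Module.compHom L (envRight k A π).toRingHom
  let g₁ : M.carrier →ₗ[Env k A A] L := { g with map_smul' := hg }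
  have hk : M.rightPart h ≤ LinearMap.ker g₁ := by
    intro x hx
    -- `M A⁺` is defined as a `k`-span, so `L` needs a `k`-structure for which `g` is linear.
    let _ : Module k L := Module.compHom L (algebraMap k (Env k A A))
    have hs : ∀ (c : k) (x : M.carrier), g (c • x) = c • g x := fun c x => by
      rw [← algebraMap_smul (Env k A A) c x]
      exact hg _ x
    refine rightPart_le h (S := LinearMap.ker ({ g with map_smul' := hs } : M.carrier →ₗ[k] L))
      (fun i hi a ha x => ?_) hx
    change g _ = 0
    have : π a = 0 := by simpa [trivGr, hi.ne'] using h.proj_mem i a ha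
    rw [hg, envRight_tmul, this, op_zero, TensorProduct.tmul_zero]
    exact zero_smul (Env k A R) (g x)
  let g₂ : (M.carrier ⧸ M.rightPart h) →ₗ[Env k A A] L := (M.rightPart h).liftQ g₁ hk
  have hg₂ : ∀ x, g₂ ((M.rightPart h).mkQ x) = g x := fun x => rfl
  refine ⟨{ toFun := g₂, map_add' := map_add g₂, map_smul' := fun e x => ?_ }, hg₂⟩
  obtain ⟨x, rfl⟩ := rightMk_surjective h x
  rw [smul_rightMk]
  change g (envRight k A f e • x) = e • g x
  rw [hg, envRight_envRight h]

/-- Base change preserves projectivity: lift the composite `M → M / M A⁺` using the projectivity of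
`M`, then factor the lift through `M / M A⁺`. -/
theorem projective_rightQuot (h : IsAugmentation 𝒜 f π)
    (hM : Module.Projective (Env k A A) M.carrier) :
    Module.Projective (Env k A R) (M.rightQuot h).carrier := by
  refine Module.Projective.of_lifting_property'' fun q hq => ?_
  let Y := (M.rightQuot h).carrier →₀ Env k A R
  let _ : Module (Env k A A) Y := Module.compHom Y (envRight k A π).toRingHom
  let _ : Module (Env k A A) (M.rightQuot h).carrier :=
    Module.compHom _ (envRight k A π).toRingHom
  let q' : Y →ₗ[Env k A A] (M.rightQuot h).carrier :=
    { q with map_smul' := fun e x => q.map_smul (envRight k A π e) x }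
  let p : M.carrier →ₗ[Env k A A] (M.rightQuot h).carrier :=
    { toFun := rightMk h M
      map_add' := (rightMk h M).map_add
      map_smul' := rightMk_smul h }
  obtain ⟨g, hg⟩ := Module.projective_lifting_property q' p hq
  obtain ⟨g', hg'⟩ := exists_rightQuot_map h (L := Y) g.toAddMonoidHom (fun e x => g.map_smul e x)
  refine ⟨g', LinearMap.ext fun x => ?_⟩
  obtain ⟨x, rfl⟩ := rightMk_surjective h x
  rw [LinearMap.comp_apply, hg']
  exact LinearMap.congr_fun hg x

/-- The map `M / M A⁺ → N / N A⁺` induced by a bimodule map. -/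
theorem exists_rightQuotMap (h : IsAugmentation 𝒜 f π) (g : M.carrier →ₗ[Env k A A] N.carrier) :
    ∃ g' : (M.rightQuot h).carrier →ₗ[Env k A R] (N.rightQuot h).carrier,
      ∀ x, g' (rightMk h M x) = rightMk h N (g x) :=
  exists_rightQuot_map h ((rightMk h N).toAddMonoidHom.comp g.toAddMonoidHom) fun e x => by
    change rightMk h N (g (e • x)) = _
    rw [map_smul, rightMk_smul]
    rfl

theorem isGrHom_of_rightMk (h : IsAugmentation 𝒜 f π) {L : GrMod.{u, v, w₂} (envGr 𝒜 (trivGr k R))}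
    (g : (M.rightQuot h).carrier →ₗ[Env k A R] L.carrier)
    (hg : ∀ i, ∀ x ∈ M.deg i, g (rightMk h M x) ∈ L.deg i) : IsGrHom g := by
  rintro i _ ⟨x, hx, rfl⟩
  exact hg i x hx

end GrMod
end RightQuotient

/-! ### Resolutions of the diagonal bimodule split on the right -/

section RightProjective

variable {k : Type u} [Field k] {A : Type v} {B : Type w} [Ring A] [Algebra k A] [Ring B]
  [Algebra k B]

/-- A projective `A ⊗ Bᵒᵖ`-module is projective as a right `B`-module. -/
theorem exists_right_section {M : Type w₁} [AddCommGroup M] [Module k M] [Module (Env k A B) M]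
    [IsScalarTower k (Env k A B) M] (hM : Module.Projective (Env k A B) M)
    {F : Type w₂} [AddCommGroup F] [Module k F] [Module Bᵐᵒᵖ F] [IsScalarTower k Bᵐᵒᵖ F]
    (q : F →ₗ[k] M) (hq : ∀ (b : Bᵐᵒᵖ) x, q (b • x) = ((1 : A) ⊗ₜ[k] b : Env k A B) • q x)
    (hs : Function.Surjective q) :
    ∃ g : M →ₗ[k] F, (∀ (b : Bᵐᵒᵖ) x, g (((1 : A) ⊗ₜ[k] b : Env k A B) • x) = b • g x) ∧
      ∀ x, q (g x) = x := by
  obtain ⟨σ, hσ⟩ := LinearMap.exists_rightInverse_of_surjective q (LinearMap.range_eq_top.2 hs)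
  have hσ' : ∀ x, q (σ x) = x := LinearMap.congr_fun hσ
  have hcomm : SMulCommClass k Bᵐᵒᵖ F := IsScalarTower.to_smulCommClass
  -- The map `a ⊗ b ↦ σ(a x) b`. It is linear over `Bᵒᵖ` even though `σ` is only `k`-linear, and it
  -- lies over `e ↦ e x`; in effect `A ⊗ Bᵒᵖ` is free over `Bᵒᵖ` on a `k`-basis of `A`.
  let ψ : M → Env k A B →ₗ[k] F := fun x => TensorProduct.lift
    (LinearMap.mk₂ k (fun (a : A) (b : Bᵐᵒᵖ) => b • σ ((a ⊗ₜ[k] (1 : Bᵐᵒᵖ) : Env k A B) • x))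
      (fun a a' b => by rw [TensorProduct.add_tmul, add_smul, map_add, smul_add])
      (fun c a b => by rw [← TensorProduct.smul_tmul', smul_assoc, map_smul, smul_comm])
      (fun a b b' => add_smul _ _ _)
      (fun c a b => smul_assoc _ _ _))
  have hψ : ∀ x a b, ψ x (a ⊗ₜ[k] b) = b • σ ((a ⊗ₜ[k] (1 : Bᵐᵒᵖ) : Env k A B) • x) :=
    fun x a b => rfl
  have hψq : ∀ x e, q (ψ x e) = e • x := fun x e => by
    induction e using TensorProduct.induction_on with
    | zero => rw [map_zero, map_zero]; exact (zero_smul (Env k A B) x).symm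
    | add e e' he he' => rw [map_add, map_add, he, he', add_smul]
    | tmul a b =>
      rw [hψ, hq, hσ', smul_smul, Algebra.TensorProduct.tmul_mul_tmul, one_mul, mul_one]
  have hψb : ∀ x (b : Bᵐᵒᵖ) e, ψ x (((1 : A) ⊗ₜ[k] b) * e) = b • ψ x e := fun x b e => by
    induction e using TensorProduct.induction_on with
    | zero => rw [mul_zero, map_zero, smul_zero]
    | add e e' he he' => rw [mul_add, map_add, map_add, he, he', smul_add]
    | tmul a b' =>
      rw [Algebra.TensorProduct.tmul_mul_tmul, one_mul, hψ, hψ, mul_smul]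
  let Ψ : (M →₀ Env k A B) →ₗ[k] F := Finsupp.lsum k ψ
  have hΨ : ∀ x e, Ψ (Finsupp.single x e) = ψ x e := fun x e => by
    simp only [Ψ, Finsupp.lsum_single]
  have hΨq : ∀ t, q (Ψ t) = Finsupp.linearCombination (Env k A B) id t := fun t => by
    induction t using Finsupp.induction_linear with
    | zero => rw [map_zero, map_zero, map_zero]
    | add t t' h h' => rw [map_add, map_add, map_add, h, h']
    | single x e => rw [hΨ, hψq, Finsupp.linearCombination_single, id]
  have hΨb : ∀ (b : Bᵐᵒᵖ) t, Ψ (((1 : A) ⊗ₜ[k] b : Env k A B) • t) = b • Ψ t := fun b t => by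
    induction t using Finsupp.induction_linear with
    | zero => rw [smul_zero, map_zero, smul_zero]
    | add t t' h h' => rw [smul_add, map_add, map_add, smul_add, h, h']
    | single x e => rw [Finsupp.smul_single, hΨ, hΨ, smul_eq_mul, hψb]
  -- `Ψ` lifts the canonical surjection from the free module on `M`; precomposing it with a
  -- splitting of that surjection gives the section.
  obtain ⟨i, hi⟩ := hM.out
  refine ⟨Ψ ∘ₗ i.restrictScalars k, fun b x => ?_, fun x => ?_⟩
  · rw [LinearMap.comp_apply, LinearMap.coe_restrictScalars, map_smul, hΨb]; rfl
  · rw [LinearMap.comp_apply, hΨq]; exact hi x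

theorem projective_right (M : Type w₁) [AddCommGroup M] [Module k M] [Module (Env k A B) M]
    [IsScalarTower k (Env k A B) M] (hM : Module.Projective (Env k A B) M) :
    let _ : Module Bᵐᵒᵖ M := Module.compHom M
      (Algebra.TensorProduct.includeRight : Bᵐᵒᵖ →ₐ[k] Env k A B).toRingHom
    Module.Projective Bᵐᵒᵖ M := by
  intro _
  refine Module.Projective.of_lifting_property'' fun q hq => ?_
  obtain ⟨g, hg, hg'⟩ := exists_right_section (k := k) (A := A) hM (F := M →₀ Bᵐᵒᵖ)
    { toFun := q
      map_add' := map_add q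
      map_smul' := fun c x => by
        rw [← algebraMap_smul Bᵐᵒᵖ c x, map_smul]
        change (Algebra.TensorProduct.includeRight (algebraMap k Bᵐᵒᵖ c) : Env k A B) • q x
          = c • q x
        rw [AlgHom.commutes, algebraMap_smul] }
    (fun b x => q.map_smul b x) hq
  exact ⟨{ g with map_smul' := hg }, LinearMap.ext hg'⟩

end RightProjective

/-! ### A contraction of resolutions of `A` that is linear over `A` on the right. -/

section Diagonal

variable {k : Type u} [Field k] {A : Type v} [Ring A] [Algebra k A]
  {𝒜 : ℤ → Submodule k A} [GradedAlgebra 𝒜]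

namespace GrProjRes

/-- The augmentation of a resolution of the diagonal bimodule. -/
def augₖ (P : GrProjRes.{u, v, v, w} (diagBimod 𝒜)) : (P.X 0).carrier →ₗ[k] A :=
  P.aug.restrictScalars k

theorem augₖ_smul (P : GrProjRes.{u, v, v, w} (diagBimod 𝒜)) (a b : A) (x : (P.X 0).carrier) :
    P.augₖ ((a ⊗ₜ[k] op b : Env k A A) • x) = a * P.augₖ x * b :=
  (P.aug.map_smul _ x).trans (bimodAction_tmul (AlgHom.id k A) (AlgHom.id k A) a b (P.augₖ x))

/-- As right modules the `P_m` are projective and `A` is free on `1`, so the augmented complex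
splits. Right linearity is essential: it makes the contraction compatible with the submodules `P_m
A⁺`. -/
theorem exists_contraction (P : GrProjRes.{u, v, v, w} (diagBimod 𝒜)) (p : (P.X 0).carrier)
    (hp : P.augₖ p = 1) :
    ∃ s : ∀ m, (P.X m).carrier →ₗ[k] (P.X (m + 1)).carrier,
      (∀ m (a : A) x, s m (((1 : A) ⊗ₜ[k] op a : Env k A A) • x)
        = ((1 : A) ⊗ₜ[k] op a : Env k A A) • s m x) ∧
      (∀ x, P.d 0 (s 0 x) = x - ((1 : A) ⊗ₜ[k] op (P.augₖ x) : Env k A A) • p) ∧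
      ∀ m x, P.d (m + 1) (s (m + 1) x) + s m (P.d m x) = x := by
  let _ : ∀ m, Module Aᵐᵒᵖ (P.X m).carrier := fun m => Module.compHom (P.X m).carrier
    (Algebra.TensorProduct.includeRight : Aᵐᵒᵖ →ₐ[k] Env k A A).toRingHom
  have hsmul : ∀ m (a : Aᵐᵒᵖ) (x : (P.X m).carrier),
      a • x = ((1 : A) ⊗ₜ[k] a : Env k A A) • x := fun m a x => rfl
  let dR : ∀ m, (P.X (m + 1)).carrier →ₗ[Aᵐᵒᵖ] (P.X m).carrier := fun m =>
    { toFun := P.d m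
      map_add' := map_add (P.d m)
      map_smul' := fun a x => (P.d m).map_smul _ x }
  let c : (P.X 0).carrier →ₗ[Aᵐᵒᵖ] (P.X 0).carrier :=
    { toFun := fun x => op (P.augₖ x) • p
      map_add' := fun x y => by rw [map_add, op_add, add_smul]
      map_smul' := fun a x => by
        obtain ⟨a, rfl⟩ := op_surjective a
        have : P.augₖ (op a • x) = P.augₖ x * a := (P.augₖ_smul 1 a x).trans (by rw [one_mul])
        rw [this, op_mul, mul_smul]; rfl }
  -- The chain map to be contracted is the identity except in degree `0`, where `x ↦ p ε(x)` is
  -- subtracted. Since `ε(p) = 1`, it lifts the zero map of `A`.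
  let φ : ∀ m, (P.X m).carrier →ₗ[Aᵐᵒᵖ] (P.X m).carrier := fun m =>
    match m with
    | 0 => LinearMap.id - c
    | _ + 1 => LinearMap.id
  have hφ : ∀ m x, dR m (φ (m + 1) x) = φ m (dR m x) := by
    rintro (_ | m) x
    · change P.d 0 x = P.d 0 x - op (P.augₖ (P.d 0 x)) • p
      have : P.augₖ (P.d 0 x) = 0 := P.aug_d x
      rw [this, op_zero, zero_smul, sub_zero]
    · rfl
  have h0 : ∀ x, φ 0 x ∈ LinearMap.range (dR 0) := fun x => by
    have : P.augₖ (φ 0 x) = 0 := by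
      change P.augₖ (x - ((1 : A) ⊗ₜ[k] op (P.augₖ x) : Env k A A) • p) = 0
      rw [map_sub, augₖ_smul, hp, one_mul, one_mul, sub_self]
    exact (P.exact_aug _).1 this
  obtain ⟨h, h1, h2⟩ := exists_nullHomotopy dR dR (fun m => projective_right _ (P.projective m))
    (fun m => P.exact m) (fun m x => P.d_d m x) φ hφ h0
  refine ⟨fun m =>
    { toFun := h m
      map_add' := map_add (h m)
      map_smul' := fun t x => ?_ }, fun m a x => (h m).map_smul (op a) x, h1, h2⟩
  have ht : ∀ m (x : (P.X m).carrier), t • x = algebraMap k Aᵐᵒᵖ t • x := fun m x => by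
    rw [hsmul]
    change t • x = (Algebra.TensorProduct.includeRight (algebraMap k Aᵐᵒᵖ t) : Env k A A) • x
    rw [AlgHom.commutes, algebraMap_smul]
  rw [ht, map_smul]
  exact (ht _ _).symm

end GrProjRes
end Diagonal

/-! ### The resolution `P ⊗_A R` of `R`. -/

section RightResolution

variable {k : Type u} [Field k] {A : Type v} [Ring A] [Algebra k A]
  {𝒜 : ℤ → Submodule k A} [GradedAlgebra 𝒜] {R : Type v} [Ring R] [Algebra k R] {f : R →ₐ[k] A}
  {π : A →ₐ[k] R}

/-- `R` as a graded `A`-`R`-bimodule along `π`. -/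
def resL (h : IsAugmentation 𝒜 f π) : GrMod.{u, v, v} (envGr 𝒜 (trivGr k R)) :=
  bimod (trivGr k R) π (AlgHom.id k R) h.proj_mem (fun _ _ h => h)

namespace GrProjRes

variable (h : IsAugmentation 𝒜 f π) (P : GrProjRes.{u, v, v, w} (diagBimod 𝒜))

/-- The differentials of `P ⊗_A R`. -/
def rightD (m : ℕ) :
    ((P.X (m + 1)).rightQuot h).carrier →ₗ[Env k A R] ((P.X m).rightQuot h).carrier :=
  (GrMod.exists_rightQuotMap h (P.d m)).choose

theorem rightD_mk (m : ℕ) (x : (P.X (m + 1)).carrier) :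
    P.rightD h m (GrMod.rightMk h _ x) = GrMod.rightMk h _ (P.d m x) :=
  (GrMod.exists_rightQuotMap h (P.d m)).choose_spec x

theorem exists_rightAug : ∃ g : ((P.X 0).rightQuot h).carrier →ₗ[Env k A R] (resL h).carrier,
    ∀ x, g (GrMod.rightMk h _ x) = (show (resL h).carrier from π (P.augₖ x)) := by
  refine GrMod.exists_rightQuot_map h (L := (resL h).carrier)
    (π.toLinearMap ∘ₗ P.augₖ).toAddMonoidHom fun e x => ?_
  change π (P.augₖ (e • x)) = bimodAction π (AlgHom.id k R) (envRight k A π e) (π (P.augₖ x))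
  induction e using TensorProduct.induction_on with
  | zero =>
    rw [map_zero, map_zero, LinearMap.zero_apply]
    refine (congrArg (fun y => π (P.augₖ y)) (zero_smul (Env k A A) x)).trans ?_
    rw [map_zero, map_zero]
  | add e e' he he' =>
    rw [add_smul, map_add, map_add, map_add, map_add, LinearMap.add_apply, he, he']
  | tmul a b =>
    obtain ⟨b, rfl⟩ := op_surjective b
    rw [augₖ_smul, envRight_tmul, bimodAction_tmul, map_mul, map_mul]
    rfl

/-- The augmentation of `P ⊗_A R`. -/
def rightAug : ((P.X 0).rightQuot h).carrier →ₗ[Env k A R] (resL h).carrier :=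
  (P.exists_rightAug h).choose

theorem rightAug_mk (x : (P.X 0).carrier) :
    P.rightAug h (GrMod.rightMk h _ x) = (show (resL h).carrier from π (P.augₖ x)) :=
  (P.exists_rightAug h).choose_spec x

theorem exists_aug_eq_one : ∃ p, P.augₖ p = 1 := P.surjective_aug (1 : A)

/-- If `d x` lies in `P A⁺`, then so does `s d x` because the contraction `s` is right linear, and
`x = d s x + s d x` is a boundary modulo `P A⁺`. -/
theorem rightD_exact (m : ℕ) : Function.Exact (P.rightD h (m + 1)) (P.rightD h m) := by
  obtain ⟨p, hp⟩ := P.exists_aug_eq_one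
  obtain ⟨s, hs, -, hsd⟩ := P.exists_contraction p hp
  intro x
  obtain ⟨x, rfl⟩ := GrMod.rightMk_surjective h x
  rw [rightD_mk]
  constructor
  · intro hx
    refine ⟨GrMod.rightMk h _ (s (m + 1) x), ?_⟩
    rw [rightD_mk]
    have h1 := GrMod.map_mem_rightPart h (s m) (hs m) ((GrMod.rightMk_eq_zero h).1 hx)
    have h2 : GrMod.rightMk h (P.X (m + 1)) (P.d (m + 1) (s (m + 1) x) + s m (P.d m x))
        = GrMod.rightMk h _ x := congrArg _ (hsd m x)
    rwa [map_add, (GrMod.rightMk_eq_zero h).2 h1, add_zero] at h2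
  · rintro ⟨y, hy⟩
    obtain ⟨y, rfl⟩ := GrMod.rightMk_surjective h y
    rw [rightD_mk] at hy
    rw [← rightD_mk, ← hy, rightD_mk, d_d, map_zero]

theorem rightD_exact_aug : Function.Exact (P.rightD h 0) (P.rightAug h) := by
  obtain ⟨p, hp⟩ := P.exists_aug_eq_one
  obtain ⟨s, -, hs, -⟩ := P.exists_contraction p hp
  intro x
  obtain ⟨x, rfl⟩ := GrMod.rightMk_surjective h x
  rw [rightAug_mk]
  constructor
  · intro hx
    refine ⟨GrMod.rightMk h _ (s 0 x), ?_⟩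
    -- In degree `0` the contraction leaves the defect `p ε(x)`, which vanishes modulo `P A⁺` as
    -- soon as `π(ε(x)) = 0`.
    rw [rightD_mk, hs, map_sub, sub_eq_self, GrMod.rightMk_smul, envRight_tmul]
    have hx' : π (P.augₖ x) = 0 := hx
    rw [hx', op_zero, TensorProduct.tmul_zero]
    exact zero_smul (Env k A R) (GrMod.rightMk h (P.X 0) p)
  · rintro ⟨y, hy⟩
    obtain ⟨y, rfl⟩ := GrMod.rightMk_surjective h y
    rw [rightD_mk] at hy
    rw [← rightAug_mk, ← hy, rightAug_mk]
    have : P.augₖ (P.d 0 y) = 0 := P.aug_d y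
    rw [this]
    exact map_zero π

/-- The resolution `P ⊗_A R → R`. -/
def rightRes : GrProjRes.{u, v, v, w} (resL h) where
  X m := (P.X m).rightQuot h
  d := P.rightD h
  aug := P.rightAug h
  d_gr m := GrMod.isGrHom_of_rightMk h _ fun i x hx => by
    rw [rightD_mk]
    exact GrMod.rightMk_mem h (P.d_gr m i x hx)
  aug_gr := GrMod.isGrHom_of_rightMk h _ fun i x hx => by
    rw [rightAug_mk]
    exact h.proj_mem i _ (P.aug_gr i x hx)
  projective m := GrMod.projective_rightQuot h (P.projective m)
  exact := P.rightD_exact h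
  exact_aug := P.rightD_exact_aug h
  surjective_aug r := by
    obtain ⟨x, hx⟩ := P.surjective_aug (f r)
    refine ⟨GrMod.rightMk h _ x, (P.rightAug_mk h x).trans ?_⟩
    exact (congrArg π hx).trans (h.proj_incl r)

end GrProjRes
end RightResolution

/-! ### The bimodule `R ⊗_A Y = Y / A⁺Y` -/

section LeftQuotient

variable {k : Type u} [CommRing k] {A : Type v} [Ring A] [Algebra k A]
  {𝒜 : ℤ → Submodule k A} {R : Type v} [Ring R] [Algebra k R] {f : R →ₐ[k] A}
  {π : A →ₐ[k] R}

variable (R) in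
/-- The map `g ⊗ id`. -/
def envLeft {B : Type w₁} {C : Type w₂} [Ring B] [Algebra k B] [Ring C] [Algebra k C] (g : B →ₐ[k] C) :
    Env k B R →ₐ[k] Env k C R :=
  Algebra.TensorProduct.map g (AlgHom.id k Rᵐᵒᵖ)

theorem envLeft_tmul {B : Type w₁} {C : Type w₂} [Ring B] [Algebra k B] [Ring C] [Algebra k C]
    (g : B →ₐ[k] C) (b : B) (r : Rᵐᵒᵖ) : envLeft R g (b ⊗ₜ[k] r) = g b ⊗ₜ[k] r := by
  simp [envLeft]

theorem envLeft_mem {B : Type w₁} {C : Type w₂} [Ring B] [Algebra k B] [Ring C] [Algebra k C]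
    {ℬ : ℤ → Submodule k B} {𝒞 : ℤ → Submodule k C} {ℛ : ℤ → Submodule k R} (g : B →ₐ[k] C)
    (hg : ∀ i, ∀ b ∈ ℬ i, g b ∈ 𝒞 i) (i : ℤ) (e : Env k B R) (he : e ∈ envGr ℬ ℛ i) :
    envLeft R g e ∈ envGr 𝒞 ℛ i := by
  have : envGr ℬ ℛ i ≤ (envGr 𝒞 ℛ i).comap (envLeft R g).toLinearMap := by
    refine Submodule.span_le.2 ?_
    rintro _ ⟨p, q, rfl, b, hb, r, hr, rfl⟩
    change envLeft R g (b ⊗ₜ[k] op r) ∈ envGr 𝒞 ℛ (p + q)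
    rw [envLeft_tmul]
    exact tmul_mem_envGr (hg _ _ hb) hr
  exact this he

theorem envGr_trivGr_eq_bot {i : ℤ} (hi : i ≠ 0) : envGr (trivGr k R) (trivGr k R) i = ⊥ := by
  refine eq_bot_iff.2 (Submodule.span_le.2 ?_)
  rintro _ ⟨p, q, hpq, a, ha, b, hb, rfl⟩
  by_cases hp : p = 0
  · have : b = 0 := by simpa [trivGr, show q ≠ 0 by omega] using hb
    simp [this]
  · have : a = 0 := by simpa [trivGr, hp] using ha
    simp [this]

variable [GradedAlgebra 𝒜] (h : IsAugmentation 𝒜 f π)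

/-- `R` as a graded `R`-`A`-bimodule along `π`. -/
def resR : GrMod.{u, v, v} (envGr (trivGr k R) 𝒜) :=
  bimod (trivGr k R) (AlgHom.id k R) π (fun _ _ h => h) h.proj_mem

/-- The identity `R → R`, with values in the bimodule `resR h`. -/
def toResR : R →ₗ[k] (resR h).carrier := (LinearMap.id : R →ₗ[k] R)

/-- The identity `R → R`, from the bimodule `resR h`. -/
def ofResR : (resR h).carrier →ₗ[k] R := (LinearMap.id : R →ₗ[k] R)

omit [GradedAlgebra 𝒜] in
theorem toResR_surjective : Function.Surjective (toResR h) := fun r => ⟨r, rfl⟩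

omit [GradedAlgebra 𝒜] in
theorem smul_toResR (s r : R) (a : A) :
    (s ⊗ₜ[k] op a : Env k R A) • toResR h r = toResR h (s * r * π a) :=
  bimodAction_tmul (AlgHom.id k R) π s a r

variable (Y : GrMod.{u, v, w} (envGr 𝒜 (trivGr k R)))

/-- An `A`-`R`-bimodule as an `R`-`R`-bimodule. -/
abbrev GrMod.restrictLeft : GrMod.{u, v, w} (envGr (trivGr k R) (trivGr k R)) :=
  Y.restrict (envLeft R f) (envLeft_mem f h.incl_mem)

variable {Y} in
theorem tt_toResR (r : R) (y : Y.carrier) :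
    tt (resR h) Y (toResR h r) y
      = tt (resR h) Y (toResR h 1) ((f r ⊗ₜ[k] (1 : Rᵐᵒᵖ) : Env k A R) • y) := by
  rw [← tt_balance, smul_toResR, one_mul, one_mul, h.proj_incl]

variable {Y} in
-- Moving `a` across the tensor sign turns it into `π a`, so `y ↦ 1 ⊗ y` is semilinear along `π ⊗
-- id`.
theorem tt_one_smul (e : Env k A R) (y : Y.carrier) :
    tt (resR h) Y (toResR h 1) (e • y) = envLeft R π e • tt (resR h) Y (toResR h 1) y := by
  induction e using TensorProduct.induction_on with
  | zero =>
    refine (congrArg _ (zero_smul (Env k A R) y)).trans ?_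
    rw [map_zero, map_zero]
    exact (zero_smul (Env k R R) (tt (resR h) Y (toResR h 1) y)).symm
  | add e e' he he' => rw [add_smul, map_add, map_add, he, he', add_smul]
  | tmul a r =>
    obtain ⟨r, rfl⟩ := op_surjective r
    have h1 : (a ⊗ₜ[k] op r : Env k A R) • y = (a ⊗ₜ[k] (1 : Rᵐᵒᵖ) : Env k A R) •
        ((1 : A) ⊗ₜ[k] op r : Env k A R) • y := by
      rw [smul_smul, Algebra.TensorProduct.tmul_mul_tmul, one_mul, mul_one]
    rw [h1, ← tt_balance, envLeft_tmul, smul_tt, smul_toResR]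
    have h2 : (π a ⊗ₜ[k] (1 : Aᵐᵒᵖ) : Env k R A) • toResR h 1 = toResR h (π a * 1 * π 1) :=
      smul_toResR h (π a) 1 1
    rw [h2, map_one, mul_one, mul_one, one_mul, mul_one]

/-- The map `y ↦ 1 ⊗ y`. -/
def tensOne : (Y.restrictLeft h).carrier →ₗ[Env k R R] (tens (resR h) Y).carrier where
  toFun y := tt (resR h) Y (toResR h 1) (show Y.carrier from y)
  map_add' x y := (tt (resR h) Y (toResR h 1)).map_add _ _
  map_smul' e y := by
    refine (tt_one_smul h (envLeft R f e) (show Y.carrier from y)).trans ?_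
    congr 1
    induction e using TensorProduct.induction_on with
    | zero => rw [map_zero, map_zero, map_zero]
    | add e e' he he' => rw [map_add, map_add, he, he', map_add]
    | tmul r s => rw [envLeft_tmul, envLeft_tmul, h.proj_incl, RingHom.id_apply]

theorem tensOne_apply (y : Y.carrier) :
    tensOne h Y y = tt (resR h) Y (toResR h 1) y := rfl

theorem tensOne_surjective : Function.Surjective (tensOne h Y) := fun z => by
  induction z using tens_induction with
  | zero => exact ⟨0, map_zero _⟩
  | add x y hx hy =>
    obtain ⟨x, rfl⟩ := hx
    obtain ⟨y, rfl⟩ := hy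
    exact ⟨x + y, map_add _ _ _⟩
  | tt r y =>
    obtain ⟨r, rfl⟩ := toResR_surjective h r
    exact ⟨(f r ⊗ₜ[k] (1 : Rᵐᵒᵖ) : Env k A R) • y, (tt_toResR h r y).symm⟩

theorem isGrHom_tensOne : GrMod.IsGrHom (tensOne h Y) := fun i y hy =>
  tt_mem (zero_add i) (show toResR h 1 ∈ (resR h).deg 0 from SetLike.one_mem_graded (trivGr k R)) hy

include h in
variable {Y} in
theorem smul_sub_smul_mem_positivePart (a : A) (y : Y.carrier) :
    (f (π a) ⊗ₜ[k] (1 : Rᵐᵒᵖ) : Env k A R) • y - (a ⊗ₜ[k] (1 : Rᵐᵒᵖ) : Env k A R) • y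
      ∈ Y.positivePart := by
  induction a using mem_induction (iSup_grading 𝒜) with
  | zero => rw [map_zero, map_zero, sub_self]; exact zero_mem _
  | add a a' ha ha' =>
    have := add_mem ha ha'
    rwa [sub_add_sub_comm, ← add_smul, ← add_smul, ← TensorProduct.add_tmul,
      ← TensorProduct.add_tmul, ← map_add, ← map_add] at this
  | hom j a ha =>
    rcases lt_trichotomy j 0 with hj | rfl | hj
    · rw [h.nonneg j hj, Submodule.mem_bot] at ha
      rw [ha, map_zero, map_zero, sub_self]; exact zero_mem _
    · rw [h.incl_proj a ha, sub_self]; exact zero_mem _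
    · have h1 : π a = 0 := by simpa [trivGr, hj.ne'] using h.proj_mem j a ha
      have h2 : (0 : Env k A R) • y = 0 := zero_smul (Env k A R) y
      rw [h1, map_zero, TensorProduct.zero_tmul, h2, zero_sub]
      refine neg_mem (Y.smul_mem_positivePart (i := j + 0) (by omega)
        (tmul_mem_envGr (b := (1 : R)) ha (SetLike.one_mem_graded (trivGr k R))) y)

/-- The map `r ⊗ y ↦ r y` from `R ⊗_A Y` to `Y / A⁺Y`. -/
def tensResLift : (tens (resR h) Y).carrier →ₗ[k] (Y.carrier ⧸ Y.positivePart) :=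
  tensLift (LinearMap.compr₂ ((Algebra.lsmul k k Y.carrier).toLinearMap ∘ₗ
    (Algebra.TensorProduct.includeLeft : A →ₐ[k] Env k A R).toLinearMap ∘ₗ f.toLinearMap ∘ₗ
      ofResR h) (Y.positivePart.mkQ.restrictScalars k)) (fun r a y => by
      refine (Submodule.Quotient.eq _).2 ?_
      have h1 : ((1 : R) ⊗ₜ[k] op a : Env k R A) • r = toResR h (1 * ofResR h r * π a) :=
        smul_toResR h 1 r a
      rw [h1, one_mul]
      change (f (ofResR h r * π a) ⊗ₜ[k] (1 : Rᵐᵒᵖ) : Env k A R) • y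
        - (f (ofResR h r) ⊗ₜ[k] (1 : Rᵐᵒᵖ) : Env k A R) • (a ⊗ₜ[k] (1 : Rᵐᵒᵖ) : Env k A R) • y
          ∈ Y.positivePart
      have h2 : (f (ofResR h r * π a) ⊗ₜ[k] (1 : Rᵐᵒᵖ) : Env k A R) • y
          = (f (ofResR h r) ⊗ₜ[k] (1 : Rᵐᵒᵖ) : Env k A R) •
            (f (π a) ⊗ₜ[k] (1 : Rᵐᵒᵖ) : Env k A R) • y := by
        rw [smul_smul, Algebra.TensorProduct.tmul_mul_tmul, mul_one, map_mul]
      rw [h2, ← smul_sub]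
      exact Submodule.smul_mem _ _ (smul_sub_smul_mem_positivePart h a y))

theorem tensResLift_tt (r : R) (y : Y.carrier) :
    tensResLift h Y (tt (resR h) Y (toResR h r) y)
      = Y.positivePart.mkQ ((f r ⊗ₜ[k] (1 : Rᵐᵒᵖ) : Env k A R) • y) := rfl

variable {Y} in
-- This is `R ⊗_A Y = Y / A⁺Y`. One direction uses the map `r ⊗ y ↦ r y` back to the quotient. For
-- the other, an element of positive degree of `A ⊗ Rᵒᵖ` acts on `1 ⊗ y` through a nonzero degree of
-- `R ⊗ Rᵒᵖ`, which is zero.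
theorem tensOne_eq_zero (y : Y.carrier) : tensOne h Y y = 0 ↔ y ∈ Y.positivePart := by
  constructor
  · intro hy
    have h1 := congrArg (tensResLift h Y) hy
    rw [tensOne_apply, tensResLift_tt, map_one, map_zero] at h1
    have h2 : ((1 : A) ⊗ₜ[k] (1 : Rᵐᵒᵖ) : Env k A R) • y = y := one_smul (Env k A R) y
    rw [h2] at h1
    exact (Submodule.Quotient.mk_eq_zero _).1 h1
  · intro hy
    rw [tensOne_apply]
    induction hy using Submodule.span_induction with
    | zero => rw [map_zero]
    | add x y _ _ hx hy => rw [map_add, hx, hy, add_zero]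
    | smul e x _ hx => rw [tt_one_smul, hx, smul_zero]
    | mem x hx =>
      obtain ⟨i, hi, e, he, x, rfl⟩ := hx
      have h1 := envLeft_mem (R := R) π h.proj_mem _ _ he
      rw [envGr_trivGr_eq_bot hi.ne', Submodule.mem_bot] at h1
      rw [tt_one_smul, h1]
      exact zero_smul (Env k R R) (tt (resR h) Y (toResR h 1) x)

end LeftQuotient

/-! ### `Tor^A(R, R)` in terms of quotients `Y / A⁺Y` -/

section Tor

variable {k : Type u} [CommRing k] {A : Type v} [Ring A] [Algebra k A]
  (𝒜 : ℤ → Submodule k A) [GradedAlgebra 𝒜] [SeparablyAugmented 𝒜]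

theorem SeparablyAugmented.isAugmentation : IsAugmentation 𝒜 (zeroIncl 𝒜) (zeroProj 𝒜) where
  incl_mem := zeroIncl_mem 𝒜
  proj_mem := zeroProj_mem 𝒜
  proj_incl r := Subtype.ext (DirectSum.decompose_of_mem_same 𝒜 r.2)
  incl_proj _ ha := DirectSum.decompose_of_mem_same 𝒜 ha
  nonneg := SeparablyAugmented.nonneg

variable {𝒜} (Q : GrProjRes.{u, v, v, w} (resAR 𝒜))

/-- The map `x ↦ 1 ⊗ x` from `Q_m` to `R ⊗_A Q_m`. -/
def torOne (m : ℕ) :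
    ((Q.X m).restrictLeft (SeparablyAugmented.isAugmentation 𝒜)).carrier
      →ₗ[Env k (degZero 𝒜) (degZero 𝒜)] (torTerm Q m).carrier :=
  tensOne (SeparablyAugmented.isAugmentation 𝒜) (Q.X m)

theorem torOne_surjective (m : ℕ) : Function.Surjective (torOne Q m) :=
  tensOne_surjective (SeparablyAugmented.isAugmentation 𝒜) (Q.X m)

theorem torOne_eq_zero {m : ℕ} (x : (Q.X m).carrier) :
    torOne Q m x = 0 ↔ x ∈ (Q.X m).positivePart :=
  tensOne_eq_zero (SeparablyAugmented.isAugmentation 𝒜) x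

theorem torD_torOne (m : ℕ) (x : (Q.X (m + 1)).carrier) :
    torD Q m (torOne Q (m + 1) x) = torOne Q m (Q.d m x) := rfl

theorem torOne_mem_torCycles_succ {m : ℕ} (x : (Q.X (m + 1)).carrier) :
    torOne Q (m + 1) x ∈ torCycles Q (m + 1) ↔ Q.d m x ∈ (Q.X m).positivePart := by
  rw [← torOne_eq_zero, ← torD_torOne]
  exact LinearMap.mem_ker

theorem torOne_mem_range_torD {m : ℕ} (x : (Q.X m).carrier) :
    torOne Q m x ∈ LinearMap.range (torD Q m) ↔ ∃ y, x - Q.d m y ∈ (Q.X m).positivePart := by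
  have key : ∀ y : (Q.X (m + 1)).carrier, x - Q.d m y ∈ (Q.X m).positivePart ↔
      torD Q m (torOne Q (m + 1) y) = torOne Q m x := fun y => by
    rw [← torOne_eq_zero, torD_torOne]
    refine (Eq.congr_left ((torOne Q m).map_sub x (Q.d m y))).trans ?_
    rw [sub_eq_zero, eq_comm]
  constructor
  · rintro ⟨y, hy⟩
    obtain ⟨y, rfl⟩ := torOne_surjective Q (m + 1) y
    exact ⟨y, (key y).2 hy⟩
  · rintro ⟨y, hy⟩
    exact ⟨_, (key y).1 hy⟩

/-- `Tor_m` is a quotient of any graded bimodule mapping onto the cycles modulo boundaries. -/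
theorem tor_isomorphic_quot (m : ℕ) {Z : GrMod.{u, v, w₁} (zeroEnvGr 𝒜)}
    (D : Submodule (Env k (degZero 𝒜) (degZero 𝒜)) Z.carrier) (hD : Z.IsHomogeneous D)
    (g : Z.carrier →ₗ[Env k (degZero 𝒜) (degZero 𝒜)]
      ((Q.X m).restrictLeft (SeparablyAugmented.isAugmentation 𝒜)).carrier)
    (hg : GrMod.IsGrHom g) (h1 : ∀ z, torOne Q m (g z) ∈ torCycles Q m)
    (h2 : ∀ x : (Q.X m).carrier, torOne Q m x ∈ torCycles Q m →
      ∃ z, (show (Q.X m).carrier from g z) - x ∈ (Q.X m).positivePart)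
    (h3 : ∀ z, (∃ y, (show (Q.X m).carrier from g z) - Q.d m y ∈ (Q.X m).positivePart) ↔ z ∈ D) :
    (Tor Q m).Isomorphic (Z.quot D hD) := by
  refine GrMod.subquot_isomorphic _ _ _ _ D hD (torOne Q m ∘ₗ g)
    (fun i z hz => isGrHom_tensOne (SeparablyAugmented.isAugmentation 𝒜) (Q.X m) i _ (hg i z hz))
    h1 (fun x hx => ?_) (fun z => (torOne_mem_range_torD Q _).trans (h3 z))
  obtain ⟨x, rfl⟩ := torOne_surjective Q m x
  obtain ⟨z, hz⟩ := h2 x hx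
  refine ⟨z, ?_⟩
  have h4 : torOne Q m (g z) - torOne Q m x = 0 :=
    ((torOne Q m).map_sub (g z) x).symm.trans ((torOne_eq_zero Q _).2 hz)
  rw [LinearMap.comp_apply, h4]
  exact zero_mem _

end Tor

/-! ### `Tor` computed from a minimal resolution. -/

section Minimal

variable {k : Type u} [Field k] {A : Type v} [Ring A] [Algebra k A]
  {𝒜 : ℤ → Submodule k A} [GradedAlgebra 𝒜] [SeparablyAugmented 𝒜]

/-- The resolution `P ⊗_A R → R`. -/
def GrProjRes.toRes (P : GrProjRes.{u, v, v, w₁} (diagBimod 𝒜)) : GrProjRes.{u, v, v, w₁} (resAR 𝒜) :=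
  P.rightRes (SeparablyAugmented.isAugmentation 𝒜)

variable (P : GrProjRes.{u, v, v, w₁} (diagBimod 𝒜))

/-- The quotient map `P_m → P_m / P_m A⁺`. -/
def GrProjRes.toResMk (m : ℕ) : (P.X m).carrier →ₗ[k] (P.toRes.X m).carrier :=
  GrMod.rightMk (SeparablyAugmented.isAugmentation 𝒜) (P.X m)

theorem GrProjRes.toResMk_surjective (m : ℕ) : Function.Surjective (P.toResMk m) :=
  GrMod.rightMk_surjective _

theorem GrProjRes.toResMk_mem_positivePart {m : ℕ} {x : (P.X m).carrier} :
    P.toResMk m x ∈ (P.toRes.X m).positivePart ↔ x ∈ (P.X m).positivePart :=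
  GrMod.rightMk_mem_positivePart (SeparablyAugmented.isAugmentation 𝒜)

theorem GrProjRes.toRes_d (m : ℕ) (x : (P.X (m + 1)).carrier) :
    P.toRes.d m (P.toResMk (m + 1) x) = P.toResMk m (P.d m x) :=
  P.rightD_mk (SeparablyAugmented.isAugmentation 𝒜) m x

/-- The `R`-`R`-bimodule underlying `P_m`. -/
abbrev GrProjRes.underlying (m : ℕ) : GrMod.{u, v, w₁} (zeroEnvGr 𝒜) :=
  (P.X m).restrictEnv (zeroIncl 𝒜) (zeroIncl_mem 𝒜)

theorem envRight_envLeft {R : Type v} [Ring R] [Algebra k R] (f : R →ₐ[k] A) (e : Env k R R) :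
    envRight k A f (envLeft R f e) = envMap f e := by
  induction e using TensorProduct.induction_on with
  | zero => rw [map_zero, map_zero, map_zero]
  | add x y hx hy => rw [map_add, map_add, map_add, hx, hy]
  | tmul a b =>
    obtain ⟨b, rfl⟩ := op_surjective b
    rw [envLeft_tmul, envRight_tmul, envMap_tmul]

/-- The quotient map `P_m → P_m / P_m A⁺` as a map of `R`-`R`-bimodules. -/
def GrProjRes.toResMkEnv (m : ℕ) :
    (P.underlying m).carrier →ₗ[Env k (degZero 𝒜) (degZero 𝒜)]
      ((P.toRes.X m).restrictLeft (SeparablyAugmented.isAugmentation 𝒜)).carrier where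
  toFun := P.toResMk m
  map_add' := (P.toResMk m).map_add
  map_smul' e x := by
    change P.toResMk m (envMap (zeroIncl 𝒜) e • (show (P.X m).carrier from x))
      = P.toResMk m (envRight k A (zeroIncl 𝒜) (envLeft (degZero 𝒜) (zeroIncl 𝒜) e) •
        (show (P.X m).carrier from x))
    rw [envRight_envLeft]

/-- The part `E⁺ P_m`, as an `R`-`R`-bimodule. -/
abbrev GrProjRes.underlyingPositive (m : ℕ) :
    Submodule (Env k (degZero 𝒜) (degZero 𝒜)) (P.underlying m).carrier :=
  GrMod.restrictSubmodule (envMap (zeroIncl 𝒜)) (envMap_mem (zeroIncl 𝒜) (zeroIncl_mem 𝒜))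
    (P.X m).positivePart

theorem GrProjRes.isHomogeneous_underlyingPositive (m : ℕ) :
    (P.underlying m).IsHomogeneous (P.underlyingPositive m) :=
  GrMod.isHomogeneous_restrictSubmodule _ _
    (GrMod.isHomogeneous_positivePart (iSup_envGr (iSup_grading 𝒜) (iSup_grading 𝒜)) (P.X m))

variable {P}

theorem GrProjRes.IsMinimal.toRes_d_mem (hP : P.IsMinimal) (m : ℕ) (y : (P.toRes.X (m + 1)).carrier) :
    P.toRes.d m y ∈ (P.toRes.X m).positivePart := by
  obtain ⟨y, rfl⟩ := P.toResMk_surjective (m + 1) y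
  rw [P.toRes_d, P.toResMk_mem_positivePart]
  exact hP m ⟨y, rfl⟩

/-- Minimality makes the differentials of `R ⊗_A P ⊗_A R` zero, so every chain is a cycle. -/
theorem GrProjRes.IsMinimal.torOne_mem (hP : P.IsMinimal) :
    ∀ (m : ℕ) (y : (P.toRes.X m).carrier), torOne P.toRes m y ∈ torCycles P.toRes m
  | 0, _ => trivial
  | m + 1, y => (torOne_mem_torCycles_succ P.toRes y).2 (hP.toRes_d_mem m y)

/-- With vanishing differentials the homology equals the term itself, and `R ⊗_A (P_m ⊗_A R)` is
`P_m / E⁺P_m`. -/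
theorem GrProjRes.IsMinimal.tor_isomorphic (hP : P.IsMinimal) (m : ℕ) :
    (Tor P.toRes m).Isomorphic
      ((P.underlying m).quot (P.underlyingPositive m) (P.isHomogeneous_underlyingPositive m)) := by
  refine tor_isomorphic_quot P.toRes m _ _ (P.toResMkEnv m) (fun i x hx => ⟨x, hx, rfl⟩)
    (fun z => hP.torOne_mem m _) (fun x _ => ?_) (fun z => ?_)
  · obtain ⟨z, rfl⟩ := P.toResMk_surjective m x
    refine ⟨z, ?_⟩
    rw [show (show (P.toRes.X m).carrier from P.toResMkEnv m z) = P.toResMk m z from rfl, sub_self]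
    exact zero_mem _
  · constructor
    · rintro ⟨y, hy⟩
      have := add_mem hy (hP.toRes_d_mem m y)
      rw [sub_add_cancel] at this
      exact P.toResMk_mem_positivePart.1 this
    · intro hz
      refine ⟨0, ?_⟩
      rw [map_zero, sub_zero]
      exact P.toResMk_mem_positivePart.2 hz

/-- The terms of a minimal resolution map onto `Tor` with kernel `E⁺ P_m`. -/
theorem GrProjRes.IsMinimal.exists_map_tor (hP : P.IsMinimal) (Q : GrProjRes.{u, v, v, w₂} (resAR 𝒜))
    (m : ℕ) : ∃ q : (P.underlying m).carrier →ₗ[Env k (degZero 𝒜) (degZero 𝒜)] (Tor Q m).carrier,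
      GrMod.IsGrHom q ∧ Function.Surjective q ∧
        ∀ x : (P.X m).carrier, q x = 0 ↔ x ∈ (P.X m).positivePart := by
  obtain ⟨e, he⟩ := ((hP.tor_isomorphic m).symm.trans (_root_.tor_isomorphic P.toRes Q m))
  refine ⟨e.toLinearMap ∘ₗ (P.underlyingPositive m).mkQ, fun i x hx => (he i _).2 ⟨x, hx, rfl⟩,
    e.surjective.comp (P.underlyingPositive m).mkQ_surjective, fun x => ?_⟩
  refine (e.map_eq_zero_iff).trans ?_
  exact Submodule.Quotient.mk_eq_zero (P.underlyingPositive m)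

end Minimal

/-! ### Existence and uniqueness of the terms of minimal resolutions. -/

section MinimalResolutions

variable {k : Type u} [Field k] {A : Type v} [Ring A] [Algebra k A]
  {𝒜 : ℤ → Submodule k A} [GradedAlgebra 𝒜] [SeparablyAugmented 𝒜]

variable (𝒜) in
theorem exists_minimal_diagBimod : ∃ P : GrProjRes.{u, v, v, v} (diagBimod 𝒜), P.IsMinimal :=
  exists_minimal_resolution
    (exists_minimal_cover (zeroIncl 𝒜) (zeroIncl_mem 𝒜) SeparablyAugmented.separable
      SeparablyAugmented.nonneg (fun a ha => ⟨⟨a, ha⟩, rfl⟩))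
    (diagBimod 𝒜) ⟨0, SeparablyAugmented.nonneg (𝒜 := 𝒜)⟩

namespace GrProjRes.IsMinimal

variable {P : GrProjRes.{u, v, v, w₁} (diagBimod 𝒜)} (hP : P.IsMinimal)
  (Q : GrProjRes.{u, v, v, w₂} (resAR 𝒜))

include hP in
-- The hypothesis says that `P_m / E⁺P_m` vanishes below `c`. This quotient is `Tor_m`, so the bound
-- carries over to it, and then `P_m` is induced from it.
theorem isomorphic_ind_tor {m : ℕ} {c : ℤ}
    (hc : ∀ i < c, ∀ x ∈ (P.X m).deg i, x ∈ (P.X m).positivePart) :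
    (∀ i < c, (Tor Q m).deg i = ⊥) ∧
      (P.X m).Isomorphic (ind (zeroIncl 𝒜) (zeroIncl_mem 𝒜) (Tor Q m)) := by
  obtain ⟨q, hq, hs, hk⟩ := hP.exists_map_tor Q m
  have hW : ∀ i < c, (Tor Q m).deg i = ⊥ := fun i hi => eq_bot_iff.2 fun y hy => by
    obtain ⟨x, rfl⟩ := hs y
    have h1 := GrMod.map_components q hq x i
    rw [components_of_mem _ hy, Finsupp.single_eq_same] at h1
    rw [Submodule.mem_bot, ← h1]
    exact (hk _).2 (hc i hi _ (components_mem (P.X m).internal x i))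
  exact ⟨hW, isomorphic_ind (zeroIncl 𝒜) (zeroIncl_mem 𝒜) SeparablyAugmented.separable
    SeparablyAugmented.nonneg (fun a ha => ⟨⟨a, ha⟩, rfl⟩) (P.projective m) q hq hs hk hW⟩

include hP in
-- Once `P_m` is known to be induced from a bimodule vanishing below `c`, it vanishes below `c`
-- itself. Elements of `P_{m+1}` of degree below `c` are then cycles, hence boundaries, hence in
-- `E⁺P_{m+1}` by minimality. The same `c` therefore serves at every stage.
theorem exists_deg_le_positivePart (m : ℕ) :
    ∃ c, ∀ i < c, ∀ x ∈ (P.X m).deg i, x ∈ (P.X m).positivePart := by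
  induction m with
  | zero =>
    -- `A` vanishes in negative degrees, so such an element is killed by the augmentation and is a
    -- boundary.
    refine ⟨0, fun i hi x hx => hP 0 ((P.exact_aug x).1 ?_)⟩
    have h1 : P.aug x ∈ 𝒜 i := P.aug_gr i x hx
    rw [SeparablyAugmented.nonneg (𝒜 := 𝒜) i hi] at h1
    exact h1
  | succ m ih =>
    obtain ⟨c, hc⟩ := ih
    obtain ⟨hW, e, he⟩ := hP.isomorphic_ind_tor P.toRes hc
    refine ⟨c, fun i hi x hx => hP (m + 1) ((P.exact m x).1 ?_)⟩
    have h1 := (he i _).2 (P.d_gr m i x hx)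
    rw [ind_deg_eq_bot (zeroIncl 𝒜) (zeroIncl_mem 𝒜) SeparablyAugmented.nonneg hW i hi,
      Submodule.mem_bot] at h1
    exact e.map_eq_zero_iff.1 h1

include hP in
theorem isomorphic_tens_tor (m : ℕ) :
    (P.X m).Isomorphic (tens (tens (bimodAR 𝒜) (Tor Q m)) (bimodRA 𝒜)) := by
  obtain ⟨c, hc⟩ := hP.exists_deg_le_positivePart m
  exact (hP.isomorphic_ind_tor Q hc).2

end GrProjRes.IsMinimal

variable (𝒜) in
theorem nonempty_grProjRes_resAR : Nonempty (GrProjRes.{u, v, v, v} (resAR 𝒜)) := by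
  obtain ⟨P, -⟩ := exists_minimal_diagBimod 𝒜
  exact ⟨P.toRes⟩

end MinimalResolutions

/-! ### Ideals of the tensor algebra are relatively projective -/

namespace TRing

section Lift

variable {k : Type u} [CommRing k] {R : Type v} [Ring R] [Algebra k R]
  {V : GrMod.{u, v, w} (envGr (trivGr k R) (trivGr k R))}

/-- Monomials are built by multiplying on the left by elements of `R` and `V`; scalars of `k` act
through `R`. -/
theorem left_induction {p : TRing V → Prop} (one : p 1) (add : ∀ x y, p x → p y → p (x + y))
    (incl_mul : ∀ r x, p x → p (incl V r * x)) (ι_mul : ∀ v x, p x → p (ι V v * x))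
    (x : TRing V) : p x := by
  have zero : p 0 := by
    have := incl_mul 0 1 one
    rwa [map_zero, zero_mul] at this
  induction x using mem_induction (TRing.iSup_deg (V := V)) with
  | zero => exact zero
  | add x y hx hy => exact add x y hx hy
  | hom i x hx =>
    induction hx using Submodule.span_induction with
    | zero => exact zero
    | add x y _ _ hx hy => exact add x y hx hy
    | smul c x _ hx =>
      rw [Algebra.smul_def, ← (incl V).commutes]
      exact incl_mul _ _ hx
    | mem x hx =>
      induction hx with
      | base r =>
        have := incl_mul r 1 one
        rwa [mul_one] at this
      | cons hv _ ih => exact ι_mul _ _ ih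

variable {A : Type w₁} [Ring A] [Algebra k A] (μ : TRing V →ₐ[k] A)
  {F : Type w₂} [AddCommGroup F] [Module k F] [Module (Env k A R) F] [IsScalarTower k (Env k A R) F]

/-- The left action of `T(V)` on an `A`-`R`-bimodule along `μ`. -/
def leftAction : TRing V →ₐ[k] Module.End k F :=
  (Algebra.lsmul k k F).comp ((Algebra.TensorProduct.includeLeft : A →ₐ[k] Env k A R).comp μ)

/-- The right action of `R` on an `A`-`R`-bimodule. -/
def rightAction : Rᵐᵒᵖ →ₐ[k] Module.End k F :=
  (Algebra.lsmul k k F).comp (Algebra.TensorProduct.includeRight : Rᵐᵒᵖ →ₐ[k] Env k A R)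

theorem rightAction_leftAction (r : Rᵐᵒᵖ) (t : TRing V) (x : F) :
    rightAction (k := k) (A := A) r (leftAction μ t x)
      = leftAction μ t (rightAction (k := k) (A := A) r x) := by
  change ((1 : A) ⊗ₜ[k] r : Env k A R) • (μ t ⊗ₜ[k] (1 : Rᵐᵒᵖ) : Env k A R) • x
    = (μ t ⊗ₜ[k] (1 : Rᵐᵒᵖ) : Env k A R) • ((1 : A) ⊗ₜ[k] r : Env k A R) • x
  rw [smul_smul, smul_smul, Algebra.TensorProduct.tmul_mul_tmul,
    Algebra.TensorProduct.tmul_mul_tmul, one_mul, mul_one, one_mul, mul_one]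

variable (P : TRing V →ₗ[k] TRing V) (η : TRing V →ₗ[k] F)

/-- The operators `(x, t) ↦ (y x + η (y (t - P t)), y t)` on `F × T(V)`. -/
def twist : TRing V →ₗ[k] Module.End k (F × TRing V) where
  toFun y := LinearMap.prod
    ((leftAction μ y) ∘ₗ LinearMap.fst k F (TRing V) +
      η ∘ₗ LinearMap.mulLeft k y ∘ₗ (LinearMap.id - P) ∘ₗ LinearMap.snd k F (TRing V))
    (LinearMap.mulLeft k y ∘ₗ LinearMap.snd k F (TRing V))
  map_add' y z := LinearMap.ext fun x => by
    refine Prod.ext ?_ (add_mul y z x.2)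
    change leftAction μ (y + z) x.1 + η ((y + z) * (x.2 - P x.2))
      = (leftAction μ y x.1 + η (y * (x.2 - P x.2))) + (leftAction μ z x.1 + η (z * (x.2 - P x.2)))
    rw [map_add, LinearMap.add_apply, add_mul, map_add]
    abel
  map_smul' c y := LinearMap.ext fun x => by
    refine Prod.ext ?_ (smul_mul_assoc c y x.2)
    change leftAction μ (c • y) x.1 + η ((c • y) * (x.2 - P x.2))
      = c • (leftAction μ y x.1 + η (y * (x.2 - P x.2)))
    rw [map_smul, LinearMap.smul_apply, smul_mul_assoc, map_smul, smul_add]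

theorem twist_apply (y : TRing V) (x : F) (t : TRing V) :
    twist μ P η y (x, t) = (leftAction μ y x + η (y * (t - P t)), y * t) := rfl

variable {P η} (hP : ∀ r t, P (incl V r * t) = incl V r * P t)
  (hη : ∀ r t, η (incl V r * t) = leftAction μ (incl V r) (η t)) (hηP : ∀ t, η (P t) = η t)

include hη hηP in
-- For elements of `R` the correction term is zero, because `η` is `R`-linear and `η P = η`. This is
-- why the twisted operators respect the relations of `T(V)`.
theorem twist_incl (r : R) (x : F) (t : TRing V) :
    twist μ P η (incl V r) (x, t) = (leftAction μ (incl V r) x, incl V r * t) := by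
  rw [twist_apply, hη, map_sub, hηP, sub_self, map_zero, add_zero]

/-- The left `T(V)`-module structure on `F × T(V)` in which `v ∈ V` acts by `twist`. -/
def twistLift : TRing V →ₐ[k] Module.End k (F × TRing V) :=
  lift V
    (AlgHom.ofLinearMap (twist μ P η ∘ₗ (incl V).toLinearMap)
      (LinearMap.ext fun ⟨x, t⟩ => by
        change twist μ P η (incl V 1) (x, t) = (x, t)
        rw [twist_incl μ hη hηP, map_one, map_one, one_mul]; rfl)
      (fun r s => LinearMap.ext fun ⟨x, t⟩ => by
        change twist μ P η (incl V (r * s)) (x, t)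
          = twist μ P η (incl V r) (twist μ P η (incl V s) (x, t))
        rw [twist_incl μ hη hηP, twist_incl μ hη hηP, twist_incl μ hη hηP, map_mul, map_mul,
          mul_assoc]; rfl))
    (twist μ P η ∘ₗ ι V)
    (fun r v => LinearMap.ext fun ⟨x, t⟩ => by
      change twist μ P η (ι V _) (x, t) = twist μ P η (incl V r) (twist μ P η (ι V v) (x, t))
      rw [← incl_mul_ι, twist_apply μ P η (ι V v), twist_incl μ hη hηP, twist_apply, map_mul,
        map_add, mul_assoc, mul_assoc, hη]; rfl)
    (fun r v => LinearMap.ext fun ⟨x, t⟩ => by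
      change twist μ P η (ι V _) (x, t) = twist μ P η (ι V v) (twist μ P η (incl V r) (x, t))
      rw [← ι_mul_incl, twist_incl μ hη hηP, twist_apply, twist_apply, map_mul, mul_assoc,
        mul_assoc, hP, mul_sub]; rfl)

theorem twistLift_incl (r : R) (x : F) (t : TRing V) :
    twistLift μ hP hη hηP (incl V r) (x, t) = (leftAction μ (incl V r) x, incl V r * t) :=
  (LinearMap.congr_fun (lift_incl V _ _ _ _ r) (x, t)).trans (twist_incl μ hη hηP r x t)

theorem twistLift_ι (v : V.carrier) (x : F) (t : TRing V) :
    twistLift μ hP hη hηP (ι V v) (x, t)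
      = (leftAction μ (ι V v) x + η (ι V v * (t - P t)), ι V v * t) :=
  LinearMap.congr_fun (lift_ι V _ _ _ _ v) (x, t)

theorem twistLift_mul (s t : TRing V) (y : F × TRing V) :
    twistLift μ hP hη hηP (s * t) y = twistLift μ hP hη hηP s (twistLift μ hP hη hηP t y) := by
  rw [map_mul]; rfl

theorem twistLift_snd (t : TRing V) (y : F × TRing V) : (twistLift μ hP hη hηP t y).2 = t * y.2 := by
  induction t using left_induction with
  | one => rw [map_one, one_mul]; rfl
  | add s t hs ht => rw [map_add, LinearMap.add_apply, Prod.snd_add, hs, ht, add_mul]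
  | incl_mul r t ht => rw [twistLift_mul, ← Prod.eta (twistLift μ hP hη hηP t y), twistLift_incl,
      ht, mul_assoc]
  | ι_mul v t ht => rw [twistLift_mul, ← Prod.eta (twistLift μ hP hη hηP t y), twistLift_ι,
      ht, mul_assoc]

/-- On `F × N` the correction `η(v (t - P t))` vanishes, since `P` fixes `N` and `N` is a left
ideal; there the twisted action is the ordinary one. -/
theorem twistLift_of_mem {N : Ideal (TRing V)} (hN : ∀ n ∈ N, P n = n) (t : TRing V) (x : F)
    {n : TRing V} (hn : n ∈ N) :
    twistLift μ hP hη hηP t (x, n) = (leftAction μ t x, t * n) := by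
  induction t using left_induction with
  | one => rw [map_one, map_one, one_mul]; rfl
  | add s t hs ht =>
    rw [map_add, LinearMap.add_apply, hs, ht, map_add, LinearMap.add_apply, add_mul]; rfl
  | incl_mul r t ht => rw [twistLift_mul, ht, twistLift_incl, map_mul, mul_assoc]; rfl
  | ι_mul v t ht =>
    rw [twistLift_mul, ht, twistLift_ι, hN _ (N.mul_mem_left t hn), sub_self, mul_zero, map_zero,
      add_zero, map_mul, mul_assoc]; rfl

/-- The operator `(x, t) ↦ (x r, t r)`. -/
def twistRight (r : R) : Module.End k (F × TRing V) :=
  (rightAction (k := k) (A := A) (op r)).prodMap (LinearMap.mulRight k (incl V r))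

theorem twistLift_twistRight (hP' : ∀ r t, P (t * incl V r) = P t * incl V r)
    (hη' : ∀ r t, η (t * incl V r) = rightAction (k := k) (A := A) (op r) (η t)) (t : TRing V)
    (r : R) (y : F × TRing V) :
    twistLift μ hP hη hηP t (twistRight (A := A) r y)
      = twistRight (A := A) r (twistLift μ hP hη hηP t y) := by
  have hr : ∀ x t, twistRight (A := A) (V := V) (F := F) r (x, t)
      = (rightAction (k := k) (A := A) (op r) x, t * incl V r) := fun x t => rfl
  induction t using left_induction with
  | one => rw [map_one]; rfl
  | add s t hs ht => rw [map_add, LinearMap.add_apply, LinearMap.add_apply, hs, ht, map_add]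
  | incl_mul s t ht =>
    rw [twistLift_mul, ht, twistLift_mul, ← Prod.eta (twistLift μ hP hη hηP t y), hr,
      twistLift_incl, twistLift_incl, hr, rightAction_leftAction, mul_assoc]
  | ι_mul v t ht =>
    rw [twistLift_mul, ht, twistLift_mul, ← Prod.eta (twistLift μ hP hη hηP t y), hr,
      twistLift_ι, twistLift_ι, hr, map_add, rightAction_leftAction, ← hη', hP', mul_assoc,
      mul_assoc, sub_mul]

include hP hη hηP in
/-- A bimodule map from an ideal of `T(V)` lifts along a surjection if it lifts `R`-linearly. -/
theorem exists_ideal_lift (hP' : ∀ r t, P (t * incl V r) = P t * incl V r)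
    (hη' : ∀ r t, η (t * incl V r) = rightAction (k := k) (A := A) (op r) (η t))
    {N : Ideal (TRing V)} (hN : ∀ n ∈ N, P n = n) (hPN : ∀ t, P t ∈ N)
    {X : Type w₃} [AddCommGroup X] [Module k X] [Module (Env k A R) X]
    [IsScalarTower k (Env k A R) X] (q : F →ₗ[Env k A R] X) (ξ : TRing V →ₗ[k] X)
    (hξ : ∀ t, ∀ n ∈ N, ξ (t * n) = leftAction μ t (ξ n)) (hq : ∀ t, q (η t) = ξ (P t)) :
    ∃ s : TRing V →ₗ[k] F, (∀ t, ∀ n ∈ N, s (t * n) = leftAction μ t (s n)) ∧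
      (∀ r t, s (t * incl V r) = rightAction (k := k) (A := A) (op r) (s t)) ∧
      ∀ n ∈ N, q (s n) = ξ n := by
  let L := twistLift μ hP hη hηP
  -- The orbit of `(η 1, 1)` is the graph of `s`, so that `s 1 = η 1` and `s(v t) = v s(t) + η(v (t
  -- - P t))`. This recursion is `T(V)`-linear on `N`. The twisted module structure is what makes
  -- `s` well defined without choosing normal forms in `T(V)`.
  let y : F × TRing V := (η 1, 1)
  let s : TRing V →ₗ[k] F := LinearMap.fst k F (TRing V) ∘ₗ
    (LinearMap.applyₗ (R := k) (M₂ := F × TRing V) y) ∘ₗ L.toLinearMap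
  have hs : ∀ t, L t y = (s t, t) := fun t =>
    Prod.ext rfl ((twistLift_snd μ hP hη hηP t y).trans (mul_one t))
  have hs' : ∀ t, s t = (L t y).1 := fun t => rfl
  have hqL : ∀ (t : TRing V) (x : F), q (leftAction μ t x) = leftAction μ t (q x) :=
    fun t x => q.map_smul _ x
  -- In the step for `v ∈ V` the sum telescopes: `v ξ(P t) + ξ(P(v t)) - ξ(P(v P t))` equals `ξ(P(v
  -- t))`, as `v P t` lies in `N` and is fixed by `P`.
  have hqs : ∀ t, q (s t) = ξ (P t) := fun t => by
    induction t using left_induction with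
    | one => rw [hs', map_one]; exact hq 1
    | add t t' ht ht' => rw [map_add, map_add, map_add, map_add, ht, ht']
    | incl_mul r t ht =>
      rw [hs', twistLift_mul, hs t, twistLift_incl, hqL, ht, hP, hξ _ _ (hPN t)]
    | ι_mul v t ht =>
      rw [hs', twistLift_mul, hs t, twistLift_ι, map_add, hqL, ht, hq, mul_sub, map_sub, map_sub,
        ← hξ _ _ (hPN t), hN _ (N.mul_mem_left (ι V v) (hPN t))]
      abel
  refine ⟨s, fun t n hn => ?_, fun r t => ?_, fun n hn => ?_⟩
  · rw [hs', twistLift_mul, hs n, twistLift_of_mem μ hP hη hηP hN t (s n) hn]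
  -- The left and right actions of `R` agree on `(η 1, 1)`, and the right action commutes with all
  -- of `T(V)`.
  · have h1 : L (incl V r) y = twistRight (A := A) r y := by
      refine (twistLift_incl μ hP hη hηP r (η 1) 1).trans ?_
      change _ = (rightAction (k := k) (A := A) (op r) (η 1), 1 * incl V r)
      rw [← hη, ← hη', one_mul, mul_one]
    rw [hs', twistLift_mul, h1, twistLift_twistRight μ hP hη hηP hP' hη']
    rfl
  · rw [hqs, hN n hn]

end Lift
end TRing

/-! ### Separability applied to ideals of the tensor algebra. -/

namespace TRing

section Section

variable {k : Type u} [Field k] {R : Type v} [Ring R] [Algebra k R]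
  {V : GrMod.{u, v, w} (envGr (trivGr k R) (trivGr k R))}

theorem smul_toBimod (r s : R) (t : TRing V) :
    (r ⊗ₜ[k] op s : Env k R R) • (show (toBimod V).carrier from t)
      = (show (toBimod V).carrier from incl V r * t * incl V s) :=
  bimodAction_tmul (incl V) (incl V) r s t

/-- An `R`-`R`-linear projection onto an ideal of `T(V)`. -/
theorem exists_ideal_projection (hR : IsSeparableAlg k R) {N : Ideal (TRing V)}
    (hN : IsGrIdeal (deg V) N) :
    ∃ P : (toBimod V).carrier →ₗ[Env k R R] (toBimod V).carrier,
      (∀ t : TRing V, (show TRing V from P t) ∈ N) ∧ ∀ n : TRing V, n ∈ N → P n = n := by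
  let D : Submodule (Env k R R) (toBimod V).carrier :=
    Ideal.toBimod (incl V) (incl_mem_deg V) N hN
  have hD : Module.Projective (Env k R R) ((toBimod V).carrier ⧸ D) := hR.projective_env _
  obtain ⟨j, hj⟩ := Module.projective_lifting_property D.mkQ LinearMap.id D.mkQ_surjective
  have hj' : ∀ x, D.mkQ (j x) = x := LinearMap.congr_fun hj
  let P : (toBimod V).carrier →ₗ[Env k R R] (toBimod V).carrier := LinearMap.id - j ∘ₗ D.mkQ
  refine ⟨P, fun t => ?_, fun n hn => ?_⟩
  · have : P t ∈ D := by
      rw [← Submodule.Quotient.mk_eq_zero]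
      change D.mkQ ((show (toBimod V).carrier from t) - j (D.mkQ t)) = 0
      rw [map_sub, hj', sub_self]
    exact this
  · have h1 : D.mkQ n = 0 := (Submodule.Quotient.mk_eq_zero D).2 hn
    change (show (toBimod V).carrier from n) - j (D.mkQ n) = n
    rw [h1, map_zero, sub_zero]

variable {A : Type w₁} [Ring A] [Algebra k A] (μ : TRing V →ₐ[k] A)
  {F : Type w₂} [AddCommGroup F] [Module k F] [Module (Env k A R) F] [IsScalarTower k (Env k A R) F]
  {X : Type w₃} [AddCommGroup X] [Module k X] [Module (Env k A R) X]
  [IsScalarTower k (Env k A R) X]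

/-- This is the relative projectivity of `N`: a map `N → X`, linear over `T(V)` on the left and `R`
on the right, lifts along surjections of `A`-`R`-bimodules. Separability supplies the two inputs of
`exists_ideal_lift`, an `R`-`R`-projection `P` onto `N` and an `R`-`R`-linear lift of `ξ P`. -/
theorem exists_ideal_section (hR : IsSeparableAlg k R) {N : Ideal (TRing V)}
    (hN : IsGrIdeal (deg V) N) (q : F →ₗ[Env k A R] X) (hq : Function.Surjective q)
    (ξ : N →ₗ[k] X) (hξ : ∀ (t : TRing V) (r : R) (n n' : N), (n' : TRing V) = t * n * incl V r →
      ξ n' = (μ t ⊗ₜ[k] op r : Env k A R) • ξ n) :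
    ∃ s : N →ₗ[k] F, (∀ (t : TRing V) (r : R) (n n' : N), (n' : TRing V) = t * n * incl V r →
      s n' = (μ t ⊗ₜ[k] op r : Env k A R) • s n) ∧ ∀ n, q (s n) = ξ n := by
  obtain ⟨P, hPN, hP⟩ := exists_ideal_projection hR hN
  have hPe : ∀ (r s : R) (t : TRing V), (show TRing V from P (incl V r * t * incl V s : TRing V))
      = incl V r * (show TRing V from P t) * incl V s := fun r s t => by
    have := P.map_smul (r ⊗ₜ[k] op s : Env k R R) (show (toBimod V).carrier from t)
    rw [smul_toBimod] at this
    exact this.trans (smul_toBimod r s _)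
  let P' : TRing V →ₗ[k] TRing V := P.restrictScalars k
  let ζ : TRing V →ₗ[k] X := ξ ∘ₗ P'.codRestrict (N.restrictScalars k) hPN
  have hζ : ∀ (r s : R) t, ζ (incl V r * t * incl V s)
      = (μ (incl V r) ⊗ₜ[k] op s : Env k A R) • ζ t := fun r s t => hξ _ _ _ _ (hPe r s t)
  let φ : Env k R R →ₐ[k] Env k A R := envLeft R (μ.comp (incl V))
  let _ : Module (Env k R R) F := Module.compHom F φ.toRingHom
  let _ : Module (Env k R R) X := Module.compHom X φ.toRingHom
  have hlin : ∀ (e : Env k R R) (t : (toBimod V).carrier), ζ (e • t) = e • ζ t := fun e t => by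
    induction e using TensorProduct.induction_on with
    | zero =>
      refine (congrArg ζ (zero_smul (Env k R R) t)).trans ((map_zero ζ).trans ?_)
      exact (zero_smul (Env k R R) (ζ t)).symm
    | add e e' he he' =>
      refine (congrArg ζ (add_smul e e' t)).trans ((map_add ζ _ _).trans ?_)
      rw [he, he']; exact (add_smul e e' (ζ t)).symm
    | tmul r s =>
      obtain ⟨s, rfl⟩ := op_surjective s
      refine (congrArg ζ (smul_toBimod r s t)).trans ((hζ r s t).trans ?_)
      change _ = φ (r ⊗ₜ[k] op s) • ζ t
      rw [envLeft_tmul]; rfl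
  let ζ' : (toBimod V).carrier →ₗ[Env k R R] X :=
    { toFun := ζ, map_add' := map_add ζ, map_smul' := hlin }
  let q' : F →ₗ[Env k R R] X := { q with map_smul' := fun e x => q.map_smul (φ e) x }
  have hT : Module.Projective (Env k R R) (toBimod V).carrier := hR.projective_env _
  obtain ⟨η₀, hη₀⟩ := Module.projective_lifting_property q' ζ' hq
  -- The lift `η₀` is precomposed with `P` to obtain the required identity `η P = η`.
  let η : TRing V →ₗ[k] F :=
    { toFun := fun t => η₀ (P t)
      map_add' := fun x y => (congrArg η₀ (P.map_add x y)).trans (η₀.map_add _ _)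
      map_smul' := fun c t => by
        have h1 : c • (show (toBimod V).carrier from t)
            = algebraMap k (Env k R R) c • (show (toBimod V).carrier from t) :=
          (algebraMap_smul _ c _).symm
        refine (congrArg (fun t => η₀ (P t)) h1).trans ?_
        rw [map_smul, map_smul]
        change φ (algebraMap k (Env k R R) c) • η₀ (P t) = c • η₀ (P t)
        rw [AlgHom.commutes, algebraMap_smul] }
  have hPP : ∀ t, P (P t) = P t := fun t => hP _ (hPN t)
  have hηe : ∀ (r s : R) t, η (incl V r * t * incl V s)
      = (μ (incl V r) ⊗ₜ[k] op s : Env k A R) • η t := fun r s t => by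
    change η₀ (P (incl V r * t * incl V s : TRing V)) = _
    have h1 : P (incl V r * t * incl V s : TRing V) = (r ⊗ₜ[k] op s : Env k R R) • P t :=
      (congrArg P (smul_toBimod r s t).symm).trans (P.map_smul _ _)
    rw [h1, map_smul]
    change φ (r ⊗ₜ[k] op s) • η₀ (P t) = _
    rw [envLeft_tmul]; rfl
  have hqη : ∀ t, q (η t) = ζ (P' t) := fun t => LinearMap.congr_fun hη₀ (P t)
  have hζN : ∀ n : N, ζ n = ξ n := fun n => congrArg ξ (Subtype.ext (hP n n.2))
  obtain ⟨s, hs, hs', hqs⟩ := exists_ideal_lift μ (P := P') (η := η)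
    (fun r t => by
      have := hPe r 1 t
      rwa [map_one, mul_one, mul_one] at this)
    (fun r t => by
      have := hηe r 1 t
      rwa [map_one, mul_one] at this)
    (fun t => congrArg η₀ (hPP t))
    (fun r t => by
      have := hPe 1 r t
      rwa [map_one, one_mul, one_mul] at this)
    (fun r t => by
      have := hηe 1 r t
      rwa [map_one, one_mul, map_one] at this)
    (N := N) hP hPN q ζ
    (fun t n hn => by
      have h1 := hζN ⟨t * n, N.mul_mem_left t hn⟩
      have h2 := hζN ⟨n, hn⟩
      refine h1.trans ((hξ t 1 ⟨n, hn⟩ _ ?_).trans (congrArg _ h2.symm))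
      rw [map_one, mul_one])
    hqη
  refine ⟨s ∘ₗ N.subtype.restrictScalars k, fun t r n n' hn => ?_, fun n => ?_⟩
  · change s n' = (μ t ⊗ₜ[k] op r : Env k A R) • s n
    rw [hn, hs', hs t n n.2, rightAction_leftAction]
    change (μ t ⊗ₜ[k] (1 : Rᵐᵒᵖ) : Env k A R) • ((1 : A) ⊗ₜ[k] op r : Env k A R) • s n = _
    rw [smul_smul, Algebra.TensorProduct.tmul_mul_tmul, one_mul, mul_one]
  · exact (hqs n n.2).trans (hζN n)

end Section
end TRing

/-! ### Descent of modules along surjections -/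

namespace GrMod

section Descent

variable {k : Type u} [CommRing k] {E : Type v} [Ring E] [Algebra k E] {ℰ : ℤ → Submodule k E}
  {E' : Type w₁} [Ring E'] [Algebra k E'] {ℰ' : ℤ → Submodule k E'} {φ : E →ₐ[k] E'}

/-- A surjection of graded algebras which is onto in each degree. -/
structure IsGrSurj (ℰ : ℤ → Submodule k E) (ℰ' : ℤ → Submodule k E') (φ : E →ₐ[k] E') : Prop where
  surjective : Function.Surjective φ
  mem : ∀ i, ∀ e ∈ ℰ i, φ e ∈ ℰ' i
  exists_mem : ∀ i, ∀ e' ∈ ℰ' i, ∃ e ∈ ℰ i, φ e = e'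

variable (hφ : IsGrSurj ℰ ℰ' φ) (M : GrMod.{u, v, w} ℰ)
  (hM : ∀ e, φ e = 0 → ∀ x : M.carrier, e • x = 0)

include hM in
theorem smul_eq_smul_of_map_eq {e₁ e₂ : E} (h : φ e₁ = φ e₂) (x : M.carrier) : e₁ • x = e₂ • x := by
  have := hM (e₁ - e₂) (by rw [map_sub, h, sub_self]) x
  rwa [sub_smul, sub_eq_zero] at this

/-- The module structure over the image of `φ` on a module on which the kernel acts as zero. -/
abbrev descendModule (h : Function.Surjective φ) : Module E' M.carrier :=
  have hs : ∀ e' : E', φ (Function.surjInv h e') = e' := Function.surjInv_eq h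
  { smul := fun e x => (Function.surjInv h e) • x
    one_smul := fun x => (smul_eq_smul_of_map_eq M hM (e₂ := 1)
      (by rw [hs, map_one]) x).trans (one_smul E x)
    mul_smul := fun e e' x => (smul_eq_smul_of_map_eq M hM
      (e₂ := Function.surjInv h e * Function.surjInv h e')
      (by rw [map_mul, hs, hs, hs]) x).trans (mul_smul _ _ x)
    smul_zero := fun e => smul_zero (Function.surjInv h e)
    smul_add := fun e x y => smul_add (Function.surjInv h e) x y
    add_smul := fun e e' x => (smul_eq_smul_of_map_eq M hM
      (e₂ := Function.surjInv h e + Function.surjInv h e')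
      (by rw [map_add, hs, hs, hs]) x).trans (add_smul _ _ x)
    zero_smul := fun x => hM _ (hs 0) x }

/-- A graded module on which the kernel of `φ` acts as zero, as a module over the image of `φ`. -/
def descend : GrMod.{u, w₁, w} ℰ' where
  carrier := M.carrier
  module := descendModule M hM hφ.surjective
  tower := by
    let _ := descendModule M hM hφ.surjective
    have hs : ∀ e' : E', φ (Function.surjInv hφ.surjective e') = e' :=
      Function.surjInv_eq hφ.surjective
    refine ⟨fun c e x => ?_⟩
    exact (smul_eq_smul_of_map_eq M hM (e₁ := Function.surjInv hφ.surjective (c • e))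
      (e₂ := c • Function.surjInv hφ.surjective e) (by rw [map_smul, hs, hs]) x).trans
        (smul_assoc c _ x)
  deg := M.deg
  internal := M.internal
  smul_mem := by
    intro i j e x he hx
    obtain ⟨e, he', rfl⟩ := hφ.exists_mem i e he
    have := M.smul_mem he' hx
    rwa [← smul_eq_smul_of_map_eq M hM (Function.surjInv_eq hφ.surjective (φ e)) x] at this

theorem descend_smul (e : E) (x : M.carrier) :
    φ e • (show (M.descend hφ hM).carrier from x) = (show (M.descend hφ hM).carrier from e • x) :=
  smul_eq_smul_of_map_eq M hM (Function.surjInv_eq hφ.surjective (φ e)) x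

end Descent
end GrMod

/-! ### Subquotients of the tensor algebra as modules over the presented algebra -/

/-- `μ` presents `A` as a quotient of `T(V)`, with `V` in positive degrees. -/
structure IsAugmentation.IsPresentation {k : Type u} [CommRing k] {A : Type v} [Ring A] [Algebra k A]
    {𝒜 : ℤ → Submodule k A} {R : Type v} [Ring R] [Algebra k R] {f : R →ₐ[k] A}
    {π : A →ₐ[k] R} (_ : IsAugmentation 𝒜 f π) {V : GrMod.{u, v, w} (envGr (trivGr k R) (trivGr k R))}
    (μ : TRing V →ₐ[k] A) : Prop where
  pos : ∀ i ≤ 0, V.deg i = ⊥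
  map_incl : ∀ r, μ (TRing.incl V r) = f r
  map_mem : ∀ i, ∀ x ∈ TRing.deg V i, μ x ∈ 𝒜 i
  surjective : Function.Surjective μ

section LeftBimodule

variable {k : Type u} [CommRing k] {R : Type v} [Ring R] [Algebra k R]
  (V : GrMod.{u, v, w} (envGr (trivGr k R) (trivGr k R)))

/-- `T(V)` as a graded `T(V)`-`R`-bimodule. -/
def TRing.leftBimod : GrMod.{u, max u v w, max u v w} (envGr (TRing.deg V) (trivGr k R)) :=
  bimod (TRing.deg V) (AlgHom.id k (TRing V)) (TRing.incl V) (fun _ _ h => h) (TRing.incl_mem_deg V)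

variable {V}

theorem TRing.smul_leftBimod (t : TRing V) (r : R) (x : TRing V) :
    (t ⊗ₜ[k] op r : Env k (TRing V) R) • (show (TRing.leftBimod V).carrier from x)
      = (show (TRing.leftBimod V).carrier from t * x * TRing.incl V r) :=
  bimodAction_tmul (AlgHom.id k (TRing V)) (TRing.incl V) t r x

/-- A homogeneous two-sided ideal as a sub-bimodule of `TRing.leftBimod V`. -/
def IsGrIdeal.toLeft {N : Ideal (TRing V)} (hN : IsGrIdeal (TRing.deg V) N) :
    Submodule (Env k (TRing V) R) (TRing.leftBimod V).carrier where
  carrier := {x : TRing V | x ∈ N}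
  add_mem' := N.add_mem
  zero_mem' := N.zero_mem
  smul_mem' e x hx := by
    have hx' : (show TRing V from x) ∈ N := hx
    change bimodAction (AlgHom.id k (TRing V)) (TRing.incl V) e (show TRing V from x) ∈ N
    induction e using TensorProduct.induction_on with
    | zero => rw [map_zero]; exact N.zero_mem
    | add e e' h h' => rw [map_add]; exact N.add_mem h h'
    | tmul a b =>
      obtain ⟨b, rfl⟩ := op_surjective b
      rw [bimodAction_tmul]
      exact hN.twoSided.mul_mem_of_left _ (N.mul_mem_left _ hx')

/-- The `T(V)`-`R`-bimodule `N / (D ∩ N)`. -/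
def IsGrIdeal.leftQuot {N D : Ideal (TRing V)} (hN : IsGrIdeal (TRing.deg V) N)
    (hD : IsGrIdeal (TRing.deg V) D) :
    GrMod.{u, max u v w, max u v w} (envGr (TRing.deg V) (trivGr k R)) :=
  (TRing.leftBimod V).subquot hN.toLeft hD.toLeft hN.homogeneous hD.homogeneous

variable {N D : Ideal (TRing V)} (hN : IsGrIdeal (TRing.deg V) N) (hD : IsGrIdeal (TRing.deg V) D)

/-- The quotient map `N → N / (D ∩ N)`. -/
def IsGrIdeal.leftMk : N →ₗ[k] (hN.leftQuot hD).carrier :=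
  let S : Submodule (Env k (TRing V) R) ((TRing.leftBimod V).sub hN.toLeft hN.homogeneous).carrier :=
    hD.toLeft.comap ((TRing.leftBimod V).subIncl hN.toLeft hN.homogeneous)
  S.mkQ.restrictScalars k

theorem IsGrIdeal.leftMk_surjective : Function.Surjective (hN.leftMk hD) :=
  (hD.toLeft.comap ((TRing.leftBimod V).subIncl hN.toLeft hN.homogeneous)).mkQ_surjective

theorem IsGrIdeal.leftMk_eq_zero {n : N} : hN.leftMk hD n = 0 ↔ (n : TRing V) ∈ D :=
  Submodule.Quotient.mk_eq_zero _

theorem IsGrIdeal.leftMk_smul (t : TRing V) (r : R) (n n' : N)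
    (h : (n' : TRing V) = t * n * TRing.incl V r) :
    (t ⊗ₜ[k] op r : Env k (TRing V) R) • hN.leftMk hD n = hN.leftMk hD n' := by
  have h1 : n' = (t ⊗ₜ[k] op r : Env k (TRing V) R) •
      (show ((TRing.leftBimod V).sub hN.toLeft hN.homogeneous).carrier from n) :=
    Subtype.ext (h.trans (TRing.smul_leftBimod t r n).symm)
  rw [h1]
  rfl

theorem IsGrIdeal.mem_leftQuot_deg {i : ℤ} {x : (hN.leftQuot hD).carrier} :
    x ∈ (hN.leftQuot hD).deg i ↔ ∃ n : N, (n : TRing V) ∈ TRing.deg V i ∧ hN.leftMk hD n = x :=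
  Iff.rfl

end LeftBimodule

namespace IsAugmentation.IsPresentation

section Basic

variable {k : Type u} [CommRing k] {A : Type v} [Ring A] [Algebra k A]
  {𝒜 : ℤ → Submodule k A} [GradedAlgebra 𝒜] {R : Type v} [Ring R] [Algebra k R] {f : R →ₐ[k] A}
  {π : A →ₐ[k] R} {h : IsAugmentation 𝒜 f π} {V : GrMod.{u, v, w} (envGr (trivGr k R) (trivGr k R))}
  {μ : TRing V →ₐ[k] A} (hμ : h.IsPresentation μ)

include hμ

theorem map_ι (v : V.carrier) : π (μ (TRing.ι V v)) = 0 := by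
  induction v using mem_induction V.iSup_deg with
  | zero => rw [map_zero, map_zero, map_zero]
  | add x y hx hy => rw [map_add, map_add, map_add, hx, hy, add_zero]
  | hom i v hv =>
    by_cases hi : i ≤ 0
    · rw [hμ.pos i hi, Submodule.mem_bot] at hv
      rw [hv, map_zero, map_zero, map_zero]
    · have := h.proj_mem i _ (hμ.map_mem i _ (TRing.ι_mem hv))
      simpa [trivGr, show i ≠ 0 by omega] using this

/-- `V` has positive degree, so `π μ` kills `J`. Conversely every `t` is congruent modulo `J` to the
element `π(μ t)` of `R`, by induction on products. -/
theorem mem_J_iff {t : TRing V} : t ∈ TRing.J V ↔ π (μ t) = 0 := by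
  constructor
  · intro ht
    have : TwoSidedIdeal.span (Set.range (TRing.ι V))
        ≤ TwoSidedIdeal.ker (π.comp μ : TRing V →ₐ[k] R) := by
      refine TwoSidedIdeal.span_le.2 ?_
      rintro _ ⟨v, rfl⟩
      exact (TwoSidedIdeal.mem_ker _).2 (hμ.map_ι v)
    exact (TwoSidedIdeal.mem_ker (π.comp μ : TRing V →ₐ[k] R)).1 (this ht)
  · intro ht
    have hJ := (TRing.isGrIdeal_J V).twoSided
    have key : ∀ t, t - TRing.incl V (π (μ t)) ∈ TRing.J V := fun t => by
      induction t using TRing.left_induction with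
      | one => rw [map_one, map_one, map_one, sub_self]; exact zero_mem _
      | add x y hx hy =>
        have := add_mem hx hy
        rwa [sub_add_sub_comm, ← map_add, ← map_add, ← map_add] at this
      | incl_mul r x hx =>
        have := (TRing.J V).mul_mem_left (TRing.incl V r) hx
        rwa [mul_sub, ← map_mul, ← h.proj_incl r, ← hμ.map_incl r, ← map_mul, ← map_mul,
          hμ.map_incl, h.proj_incl] at this
      | ι_mul v x _ =>
        rw [map_mul, map_mul, hμ.map_ι, zero_mul, map_zero, sub_zero]
        exact hJ.mul_mem_of_left _ (TwoSidedIdeal.subset_span ⟨v, rfl⟩)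
    have := key t
    rwa [ht, map_zero, sub_zero] at this

theorem exists_mem_deg {i : ℤ} {a : A} (ha : a ∈ 𝒜 i) : ∃ t ∈ TRing.deg V i, μ t = a := by
  obtain ⟨t, rfl⟩ := hμ.surjective a
  have key : ∀ x, μ (components (DirectSum.Decomposition.isInternal (TRing.deg V)) x i)
      = components (DirectSum.Decomposition.isInternal 𝒜) (μ x) i := fun x => by
    induction x using mem_induction (iSup_grading (TRing.deg V)) with
    | hom j x hx =>
      rw [components_of_mem _ hx, components_of_mem _ (hμ.map_mem _ _ hx)]
      by_cases hij : i = j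
      · subst hij; simp
      · rw [Finsupp.single_eq_of_ne hij, Finsupp.single_eq_of_ne hij, map_zero]
    | zero => simp
    | add x y hx hy => simp only [map_add, Finsupp.add_apply, hx, hy]
  refine ⟨_, components_mem _ t i, (key t).trans ?_⟩
  rw [components_of_mem _ ha, Finsupp.single_eq_same]

theorem isGrSurj : GrMod.IsGrSurj (envGr (TRing.deg V) (trivGr k R)) (envGr 𝒜 (trivGr k R))
    (envLeft R μ) where
  surjective := TensorProduct.map_surjective hμ.surjective Function.surjective_id
  mem := envLeft_mem μ hμ.map_mem
  exists_mem i e he := by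
    induction he using Submodule.span_induction with
    | zero => exact ⟨0, zero_mem _, map_zero _⟩
    | add x y _ _ hx hy =>
      obtain ⟨x', hx', rfl⟩ := hx
      obtain ⟨y', hy', rfl⟩ := hy
      exact ⟨x' + y', add_mem hx' hy', map_add _ _ _⟩
    | smul c x _ hx =>
      obtain ⟨x', hx', rfl⟩ := hx
      exact ⟨c • x', Submodule.smul_mem _ _ hx', map_smul _ _ _⟩
    | mem x hx =>
      obtain ⟨p, q, rfl, a, ha, r, hr, rfl⟩ := hx
      obtain ⟨t, ht, rfl⟩ := hμ.exists_mem_deg ha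
      exact ⟨t ⊗ₜ[k] op r, tmul_mem_envGr ht hr, envLeft_tmul μ t (op r)⟩

variable {N D : Ideal (TRing V)} (hN : IsGrIdeal (TRing.deg V) N) (hD : IsGrIdeal (TRing.deg V) D)

/-- The kernel of `T(V) ⊗ Rᵒᵖ → A ⊗ Rᵒᵖ` acts as zero on `N / D` if `I N ⊆ D`. -/
theorem smul_leftQuot_eq_zero (hND : RingHom.ker μ * N ≤ D) (e : Env k (TRing V) R)
    (he : envLeft R μ e = 0) (x : (hN.leftQuot hD).carrier) : e • x = 0 := by
  have h1 : Function.Exact (LinearMap.ker μ.toLinearMap).subtype μ.toLinearMap :=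
    LinearMap.exact_subtype_ker_map _
  -- Right exactness identifies the kernel of `T(V) ⊗ Rᵒᵖ → A ⊗ Rᵒᵖ` with the image of `I ⊗ Rᵒᵖ`.
  have h2 := rTensor_exact (Rᵐᵒᵖ) h1 hμ.surjective
  obtain ⟨z, rfl⟩ := (h2 e).1 he
  clear he
  obtain ⟨n, rfl⟩ := hN.leftMk_surjective hD x
  induction z using TensorProduct.induction_on with
  | zero => rw [map_zero]; exact zero_smul (Env k (TRing V) R) (hN.leftMk hD n)
  | add z z' hz hz' => rw [map_add, add_smul, hz, hz', add_zero]
  | tmul i r =>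
    obtain ⟨r, rfl⟩ := op_surjective r
    have hi : (i : TRing V) ∈ RingHom.ker μ := i.2
    have hm : (i : TRing V) * n * TRing.incl V r ∈ D :=
      hD.twoSided.mul_mem_of_left _ (hND (Ideal.mul_mem_mul hi n.2))
    have hm' : (i : TRing V) * n * TRing.incl V r ∈ N :=
      hN.twoSided.mul_mem_of_left _ (N.mul_mem_left _ n.2)
    refine (hN.leftMk_smul hD (i : TRing V) r n ⟨_, hm'⟩ rfl).trans ?_
    exact (hN.leftMk_eq_zero hD).2 hm

end Basic
end IsAugmentation.IsPresentation

/-! ### The `A`-`R`-bimodules `N / D`, their positive parts and their projectivity. -/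

namespace IsAugmentation.IsPresentation

section Quot

variable {k : Type u} [CommRing k] {A : Type v} [Ring A] [Algebra k A]
  {𝒜 : ℤ → Submodule k A} [GradedAlgebra 𝒜] {R : Type v} [Ring R] [Algebra k R] {f : R →ₐ[k] A}
  {π : A →ₐ[k] R} {h : IsAugmentation 𝒜 f π} {V : GrMod.{u, v, w} (envGr (trivGr k R) (trivGr k R))}
  {μ : TRing V →ₐ[k] A} (hμ : h.IsPresentation μ)
  {N D : Ideal (TRing V)} (hN : IsGrIdeal (TRing.deg V) N) (hD : IsGrIdeal (TRing.deg V) D)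
  (hND : RingHom.ker μ * N ≤ D)

/-- The graded `A`-`R`-bimodule `N / D`. -/
def idealQuot : GrMod.{u, v, max u v w} (envGr 𝒜 (trivGr k R)) :=
  (hN.leftQuot hD).descend hμ.isGrSurj (hμ.smul_leftQuot_eq_zero hN hD hND)

/-- The quotient map `N → N / D`. -/
def idealMk : N →ₗ[k] (hμ.idealQuot hN hD hND).carrier := hN.leftMk hD

theorem idealMk_surjective : Function.Surjective (hμ.idealMk hN hD hND) := hN.leftMk_surjective hD

theorem idealMk_eq_zero {n : N} : hμ.idealMk hN hD hND n = 0 ↔ (n : TRing V) ∈ D :=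
  hN.leftMk_eq_zero hD

theorem idealMk_smul (t : TRing V) (r : R) (n n' : N) (hn : (n' : TRing V) = t * n * TRing.incl V r) :
    hμ.idealMk hN hD hND n' = (μ t ⊗ₜ[k] op r : Env k A R) • hμ.idealMk hN hD hND n := by
  have h1 := GrMod.descend_smul hμ.isGrSurj (hN.leftQuot hD) (hμ.smul_leftQuot_eq_zero hN hD hND)
    (t ⊗ₜ[k] op r) (hN.leftMk hD n)
  rw [envLeft_tmul, hN.leftMk_smul hD t r n n' hn] at h1
  exact h1.symm

theorem mem_idealQuot_deg {i : ℤ} {x : (hμ.idealQuot hN hD hND).carrier} :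
    x ∈ (hμ.idealQuot hN hD hND).deg i ↔
      ∃ n : N, (n : TRing V) ∈ TRing.deg V i ∧ hμ.idealMk hN hD hND n = x :=
  hN.mem_leftQuot_deg hD

/-- Maps out of `N / D`. -/
theorem exists_idealQuot_lift {L : Type*} [AddCommGroup L] [Module (Env k A R) L] (g : N →+ L)
    (hg : ∀ (t : TRing V) (r : R) (n n' : N), (n' : TRing V) = t * n * TRing.incl V r →
      g n' = (μ t ⊗ₜ[k] op r : Env k A R) • g n) (hgD : ∀ n : N, (n : TRing V) ∈ D → g n = 0) :
    ∃ g' : (hμ.idealQuot hN hD hND).carrier →ₗ[Env k A R] L,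
      ∀ n, g' (hμ.idealMk hN hD hND n) = g n := by
  have hker : ∀ n, hμ.idealMk hN hD hND n = 0 → g n = 0 := fun n hn =>
    hgD n ((hμ.idealMk_eq_zero hN hD hND).1 hn)
  choose σ hσ using hμ.idealMk_surjective hN hD hND
  have hgσ : ∀ n, g (σ (hμ.idealMk hN hD hND n)) = g n := fun n => by
    rw [← sub_eq_zero, ← map_sub]
    refine hker _ ?_
    rw [map_sub, hσ, sub_self]
  have hadd : ∀ x y, g (σ (x + y)) = g (σ x) + g (σ y) := fun x y => by
    obtain ⟨n, rfl⟩ := hμ.idealMk_surjective hN hD hND x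
    obtain ⟨m, rfl⟩ := hμ.idealMk_surjective hN hD hND y
    rw [← map_add, hgσ, hgσ, hgσ, map_add]
  have hg0 : g (σ 0) = 0 := by
    have := hadd 0 0
    rwa [add_zero, left_eq_add] at this
  refine ⟨{ toFun := fun x => g (σ x), map_add' := hadd, map_smul' := fun e x => ?_ }, hgσ⟩
  rw [RingHom.id_apply]
  induction e using TensorProduct.induction_on with
  | zero =>
    refine (congrArg (fun x => g (σ x)) (zero_smul (Env k A R) x)).trans (hg0.trans ?_)
    exact (zero_smul (Env k A R) (g (σ x))).symm
  | add e e' he he' => rw [add_smul, hadd, he, he', add_smul]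
  | tmul a r =>
    obtain ⟨r, rfl⟩ := op_surjective r
    obtain ⟨t, rfl⟩ := hμ.surjective a
    obtain ⟨n, rfl⟩ := hμ.idealMk_surjective hN hD hND x
    have hm' : t * n * TRing.incl V r ∈ N :=
      hN.twoSided.mul_mem_of_left _ (N.mul_mem_left _ n.2)
    rw [← hμ.idealMk_smul hN hD hND t r n ⟨_, hm'⟩ rfl, hgσ, hgσ]
    exact hg t r n _ rfl

theorem isGrHom_of_idealMk {L : GrMod.{u, v, w₂} (envGr 𝒜 (trivGr k R))}
    (g : (hμ.idealQuot hN hD hND).carrier →ₗ[Env k A R] L.carrier)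
    (hg : ∀ i, ∀ n : N, (n : TRing V) ∈ TRing.deg V i → g (hμ.idealMk hN hD hND n) ∈ L.deg i) :
    GrMod.IsGrHom g := by
  intro i x hx
  obtain ⟨n, hn, rfl⟩ := (hμ.mem_idealQuot_deg hN hD hND).1 hx
  exact hg i n hn

include hμ in
theorem ker_le_J : RingHom.ker μ ≤ TRing.J V := fun t ht => hμ.mem_J_iff.2 (by
  rw [RingHom.mem_ker.1 ht, map_zero])

/-- A homogeneous element of `A` of positive degree lifts to `J`, and `J N` is zero in `N / JN`. -/
theorem idealQuot_J_smul_eq_zero (hJN : RingHom.ker μ * N ≤ TRing.J V * N) {i : ℤ} (hi : 0 < i)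
    {e : Env k A R} (he : e ∈ envGr 𝒜 (trivGr k R) i) (n : N) :
    e • hμ.idealMk hN ((TRing.isGrIdeal_J V).mul hN) hJN n = 0 := by
  induction he using Submodule.span_induction with
  | zero => exact zero_smul (Env k A R) (hμ.idealMk hN ((TRing.isGrIdeal_J V).mul hN) hJN n)
  | add x y _ _ hx hy => rw [add_smul, hx, hy, add_zero]
  | smul c x _ hx => rw [smul_assoc, hx, smul_zero]
  | mem x hx =>
    obtain ⟨p, q, rfl, a, ha, r, hr, rfl⟩ := hx
    by_cases hq : q = 0
    · obtain ⟨t, rfl⟩ := hμ.surjective a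
      have ht : t ∈ TRing.J V := hμ.mem_J_iff.2
        (by simpa [trivGr, show p ≠ 0 by omega] using h.proj_mem p _ ha)
      have hm' : t * n * TRing.incl V r ∈ N :=
        hN.twoSided.mul_mem_of_left _ (N.mul_mem_left _ n.2)
      rw [← hμ.idealMk_smul hN _ hJN t r n ⟨_, hm'⟩ rfl, idealMk_eq_zero]
      exact ((TRing.isGrIdeal_J V).mul hN).twoSided.mul_mem_of_left _ (Ideal.mul_mem_mul ht n.2)
    · have : r = 0 := by simpa [trivGr, hq] using hr
      rw [this, op_zero, TensorProduct.tmul_zero]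
      exact zero_smul (Env k A R) (hμ.idealMk hN ((TRing.isGrIdeal_J V).mul hN) hJN n)

/-- `J` maps onto `A⁺`, so the positive part of `N / D` is `JN / D`. For one inclusion one passes to
the further quotient `N / JN`, on which positive degrees act as zero; for the other, `t ∈ J` has
`π(μ t) = 0`, so `μ t` acts into the positive part. -/
theorem idealMk_mem_positivePart (hDJ : D ≤ TRing.J V * N) {n : N} :
    hμ.idealMk hN hD hND n ∈ (hμ.idealQuot hN hD hND).positivePart ↔
      (n : TRing V) ∈ TRing.J V * N := by
  have hJN := (TRing.isGrIdeal_J V).mul hN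
  have hI : RingHom.ker μ * N ≤ TRing.J V * N := hND.trans hDJ
  constructor
  · intro hn
    obtain ⟨g, hg⟩ := hμ.exists_idealQuot_lift hN hD hND (L := (hμ.idealQuot hN hJN hI).carrier)
      (hμ.idealMk hN hJN hI).toAddMonoidHom (fun t r n n' h => hμ.idealMk_smul hN hJN hI t r n n' h)
      (fun n hn => (hμ.idealMk_eq_zero hN hJN hI).2 (hDJ hn))
    have hle : (hμ.idealQuot hN hD hND).positivePart ≤ LinearMap.ker g := by
      refine Submodule.span_le.2 ?_
      rintro _ ⟨i, hi, e, he, x, rfl⟩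
      obtain ⟨m, rfl⟩ := hμ.idealMk_surjective hN hD hND x
      change g _ = 0
      rw [map_smul, hg]
      exact hμ.idealQuot_J_smul_eq_zero hN hI hi he m
    have h1 : g (hμ.idealMk hN hD hND n) = 0 := hle hn
    rw [hg] at h1
    exact (hμ.idealMk_eq_zero hN hJN hI).1 h1
  · intro hn
    have key : ∃ hm : (n : TRing V) ∈ N,
        hμ.idealMk hN hD hND ⟨n, hm⟩ ∈ (hμ.idealQuot hN hD hND).positivePart := by
      refine Submodule.smul_induction_on hn (fun t ht m hm => ⟨N.mul_mem_left t hm, ?_⟩) ?_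
      · have h1 := smul_sub_smul_mem_positivePart h (μ t) (hμ.idealMk hN hD hND ⟨m, hm⟩)
        have h2 := hμ.idealMk_smul hN hD hND t 1 ⟨m, hm⟩ ⟨t • m, N.mul_mem_left t hm⟩
          (by rw [map_one, mul_one]; rfl)
        have h3 : (0 : Env k A R) • hμ.idealMk hN hD hND ⟨m, hm⟩ = 0 :=
          zero_smul (Env k A R) (hμ.idealMk hN hD hND ⟨m, hm⟩)
        rw [hμ.mem_J_iff.1 ht, map_zero, TensorProduct.zero_tmul, h3, zero_sub] at h1
        rw [h2]
        exact neg_mem_iff.1 h1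
      · rintro x y ⟨hx, hx'⟩ ⟨hy, hy'⟩
        exact ⟨add_mem hx hy, add_mem hx' hy'⟩
    exact key.2

end Quot

section Projective

variable {k : Type u} [Field k] {A : Type v} [Ring A] [Algebra k A]
  {𝒜 : ℤ → Submodule k A} [GradedAlgebra 𝒜] {R : Type v} [Ring R] [Algebra k R] {f : R →ₐ[k] A}
  {π : A →ₐ[k] R} {h : IsAugmentation 𝒜 f π} {V : GrMod.{u, v, w} (envGr (trivGr k R) (trivGr k R))}
  {μ : TRing V →ₐ[k] A} (hμ : h.IsPresentation μ)
  {N D : Ideal (TRing V)} (hN : IsGrIdeal (TRing.deg V) N) (hD : IsGrIdeal (TRing.deg V) D)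
  (hND : RingHom.ker μ * N ≤ D)

/-- Given a surjection from a free module onto `N / IN`, the quotient map `N → N / IN` lifts by
`exists_ideal_section`. The lift kills `IN`, since it is `T(V)`-linear and `I` acts as zero on its
target; hence it descends to a section. -/
theorem projective_idealQuot (hR : IsSeparableAlg k R) (hDN : D ≤ RingHom.ker μ * N) :
    Module.Projective (Env k A R) (hμ.idealQuot hN hD hND).carrier := by
  refine Module.Projective.of_lifting_property'' fun q hq => ?_
  obtain ⟨s, hs, hqs⟩ := TRing.exists_ideal_section μ
    (F := (hμ.idealQuot hN hD hND).carrier →₀ Env k A R) (X := (hμ.idealQuot hN hD hND).carrier)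
    hR hN q hq (hμ.idealMk hN hD hND)
    (hμ.idealMk_smul hN hD hND)
  obtain ⟨g, hg⟩ := hμ.exists_idealQuot_lift hN hD hND s.toAddMonoidHom hs fun n hn => by
    have key : ∃ hm : (n : TRing V) ∈ N, s ⟨n, hm⟩ = 0 := by
      refine Submodule.smul_induction_on (hDN hn) (fun t ht m hm => ⟨N.mul_mem_left t hm, ?_⟩) ?_
      · have h1 := hs t 1 ⟨m, hm⟩ ⟨t • m, N.mul_mem_left t hm⟩ (by rw [map_one, mul_one]; rfl)
        rw [h1, RingHom.mem_ker.1 ht, TensorProduct.zero_tmul]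
        exact zero_smul (Env k A R) (s ⟨m, hm⟩)
      · rintro x y ⟨hx, hx'⟩ ⟨hy, hy'⟩
        refine ⟨add_mem hx hy, ?_⟩
        exact (s.map_add ⟨x, hx⟩ ⟨y, hy⟩).trans (by rw [hx', hy', add_zero])
    exact key.2
  refine ⟨g, LinearMap.ext fun x => ?_⟩
  obtain ⟨n, rfl⟩ := hμ.idealMk_surjective hN hD hND x
  rw [LinearMap.comp_apply, hg]
  exact hqs n

end Projective

end IsAugmentation.IsPresentation

/-! ### The resolution of `R` attached to a presentation -/

section Chain

variable {S : Type*} [Ring S] (I J : Ideal S)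

/-- The ideals `⊤, J, I, IJ, I², I²J, …`. -/
def idealChain : ℕ → Ideal S
  | 0 => ⊤
  | 1 => J
  | m + 2 => I * idealChain m

theorem idealChain_add_two (m : ℕ) : idealChain I J (m + 2) = I * idealChain I J m := rfl

variable {I J}

/-- Two-sidedness enters at `p = 0`, where the power is the unit ideal and `I * ⊤ = I` is needed. -/
theorem pow_mul_comm_of_isTwoSided [I.IsTwoSided] (p : ℕ) : I ^ p * I = I * I ^ p := by
  induction p with
  | zero => rw [Submodule.pow_zero, Ideal.one_eq_top, Ideal.top_mul, Ideal.mul_top]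
  | succ p ih => rw [Submodule.pow_succ, ← mul_assoc, ← ih, mul_assoc]

theorem idealChain_even [I.IsTwoSided] (p : ℕ) : idealChain I J (2 * p) = I ^ p := by
  induction p with
  | zero => rw [Submodule.pow_zero, Ideal.one_eq_top]; rfl
  | succ p ih =>
    rw [show 2 * (p + 1) = 2 * p + 2 from rfl, idealChain_add_two, ih, Submodule.pow_succ,
      pow_mul_comm_of_isTwoSided]

theorem idealChain_odd [I.IsTwoSided] (p : ℕ) : idealChain I J (2 * p + 1) = I ^ p * J := by
  induction p with
  | zero => rw [Submodule.pow_zero, Ideal.one_eq_top, Ideal.top_mul]; rfl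
  | succ p ih =>
    rw [show 2 * (p + 1) + 1 = 2 * p + 1 + 2 from rfl, idealChain_add_two, ih, Submodule.pow_succ,
      pow_mul_comm_of_isTwoSided, mul_assoc]

theorem idealChain_succ_le [I.IsTwoSided] (h : I ≤ J) :
    ∀ m, idealChain I J (m + 1) ≤ idealChain I J m
  | 0 => le_top
  | 1 => by
    change I * ⊤ ≤ J
    rwa [Ideal.mul_top]
  | m + 2 => Ideal.mul_mono le_rfl (idealChain_succ_le h m)

theorem isGrIdeal_idealChain {k : Type u} [CommRing k] {S : Type w} [Ring S] [Algebra k S]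
    {𝒮 : ℤ → Submodule k S} [GradedAlgebra 𝒮] {I J : Ideal S} (hI : IsGrIdeal 𝒮 I)
    (hJ : IsGrIdeal 𝒮 J) : ∀ m, IsGrIdeal 𝒮 (idealChain I J m)
  | 0 => .top
  | 1 => hJ
  | m + 2 => hI.mul (isGrIdeal_idealChain hI hJ m)

end Chain

namespace IsAugmentation.IsPresentation

section Resolution

variable {k : Type u} [Field k] {A : Type v} [Ring A] [Algebra k A]
  {𝒜 : ℤ → Submodule k A} [GradedAlgebra 𝒜] {R : Type v} [Ring R] [Algebra k R] {f : R →ₐ[k] A}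
  {π : A →ₐ[k] R} {h : IsAugmentation 𝒜 f π} {V : GrMod.{u, v, w} (envGr (trivGr k R) (trivGr k R))}
  {μ : TRing V →ₐ[k] A} (hμ : h.IsPresentation μ)
  (hI : IsGrIdeal (TRing.deg V) (RingHom.ker μ))

/-- The ideals `⊤, J, I, IJ, I², I²J, …` of `T(V)`. -/
abbrev chain (_ : h.IsPresentation μ) (m : ℕ) : Ideal (TRing V) :=
  idealChain (RingHom.ker μ) (TRing.J V) m

include hI in
theorem isGrIdeal_chain (m : ℕ) : IsGrIdeal (TRing.deg V) (hμ.chain m) :=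
  isGrIdeal_idealChain hI (TRing.isGrIdeal_J V) m

theorem chain_succ_le (m : ℕ) : hμ.chain (m + 1) ≤ hμ.chain m :=
  idealChain_succ_le hμ.ker_le_J m

theorem ker_mul_chain_le (m : ℕ) : RingHom.ker μ * hμ.chain m ≤ hμ.chain (m + 2) := le_rfl

/-- The term `N_m / I N_m` of the resolution. -/
def resX (m : ℕ) : GrMod.{u, v, max u v w} (envGr 𝒜 (trivGr k R)) :=
  hμ.idealQuot (hμ.isGrIdeal_chain hI m) (hμ.isGrIdeal_chain hI (m + 2)) (hμ.ker_mul_chain_le m)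

/-- The quotient map `N_m → N_m / I N_m`. -/
def resMk (m : ℕ) : hμ.chain m →ₗ[k] (hμ.resX hI m).carrier :=
  hμ.idealMk (hμ.isGrIdeal_chain hI m) (hμ.isGrIdeal_chain hI (m + 2)) (hμ.ker_mul_chain_le m)

theorem resMk_surjective (m : ℕ) : Function.Surjective (hμ.resMk hI m) :=
  hμ.idealMk_surjective _ _ _

theorem resMk_eq_zero {m : ℕ} {n : hμ.chain m} :
    hμ.resMk hI m n = 0 ↔ (n : TRing V) ∈ hμ.chain (m + 2) := hμ.idealMk_eq_zero _ _ _

theorem resMk_mem_positivePart {m : ℕ} {n : hμ.chain m} :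
    hμ.resMk hI m n ∈ (hμ.resX hI m).positivePart ↔ (n : TRing V) ∈ TRing.J V * hμ.chain m :=
  hμ.idealMk_mem_positivePart _ _ _ (Ideal.mul_mono hμ.ker_le_J le_rfl)

theorem resMk_mem_deg {m : ℕ} {i : ℤ} {n : hμ.chain m} (hn : (n : TRing V) ∈ TRing.deg V i) :
    hμ.resMk hI m n ∈ (hμ.resX hI m).deg i :=
  (hμ.mem_idealQuot_deg _ _ _).2 ⟨n, hn, rfl⟩

theorem exists_resD (m : ℕ) :
    ∃ g : (hμ.resX hI (m + 1)).carrier →ₗ[Env k A R] (hμ.resX hI m).carrier,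
      ∀ n : hμ.chain (m + 1), g (hμ.resMk hI (m + 1) n)
        = hμ.resMk hI m ⟨n, hμ.chain_succ_le m n.2⟩ := by
  refine hμ.exists_idealQuot_lift _ _ _
    ((hμ.resMk hI m).toAddMonoidHom.comp
      (Submodule.inclusion (hμ.chain_succ_le m)).toAddMonoidHom)
    (fun t r n n' hn => ?_) (fun n hn => ?_)
  · exact hμ.idealMk_smul _ _ _ t r ⟨n, hμ.chain_succ_le m n.2⟩ ⟨n', hμ.chain_succ_le m n'.2⟩ hn
  · exact (hμ.resMk_eq_zero hI).2 (hμ.chain_succ_le (m + 2) hn)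

/-- The differentials, induced by the inclusions `N_{m+1} ⊆ N_m`. -/
def resD (m : ℕ) : (hμ.resX hI (m + 1)).carrier →ₗ[Env k A R] (hμ.resX hI m).carrier :=
  (hμ.exists_resD hI m).choose

theorem resD_mk (m : ℕ) (n : hμ.chain (m + 1)) :
    hμ.resD hI m (hμ.resMk hI (m + 1) n) = hμ.resMk hI m ⟨n, hμ.chain_succ_le m n.2⟩ :=
  (hμ.exists_resD hI m).choose_spec n

theorem exists_resAug : ∃ g : (hμ.resX hI 0).carrier →ₗ[Env k A R] (resL h).carrier,
    ∀ n : hμ.chain 0, g (hμ.resMk hI 0 n) = (show (resL h).carrier from π (μ n)) := by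
  let g₀ : hμ.chain 0 →+ (resL h).carrier :=
    (π.toLinearMap ∘ₗ μ.toLinearMap ∘ₗ ((hμ.chain 0).subtype.restrictScalars k)).toAddMonoidHom
  refine hμ.exists_idealQuot_lift (L := (resL h).carrier) _ _ _ g₀
    (fun t r n n' hn => ?_) (fun n hn => ?_)
  · refine Eq.trans ?_ (bimodAction_tmul π (AlgHom.id k R) (μ t) r (π (μ n))).symm
    change π (μ n') = _
    rw [hn, map_mul, map_mul, map_mul, map_mul, hμ.map_incl, h.proj_incl]
    rfl
  · change π (μ n) = 0
    have h1 : (n : TRing V) ∈ RingHom.ker μ := by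
      have : (n : TRing V) ∈ RingHom.ker μ * ⊤ := hn
      rwa [Ideal.mul_top] at this
    rw [RingHom.mem_ker.1 h1, map_zero]

/-- The augmentation. -/
def resAug : (hμ.resX hI 0).carrier →ₗ[Env k A R] (resL h).carrier := (hμ.exists_resAug hI).choose

theorem resAug_mk (n : hμ.chain 0) :
    hμ.resAug hI (hμ.resMk hI 0 n) = (show (resL h).carrier from π (μ n)) :=
  (hμ.exists_resAug hI).choose_spec n

/-- An element of `N_{m+1}` is zero in `N_m / I N_m` exactly when it lies in `I N_m = N_{m+2}`, that
is, when it comes from the next term. -/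
theorem resD_exact (m : ℕ) : Function.Exact (hμ.resD hI (m + 1)) (hμ.resD hI m) := by
  intro x
  obtain ⟨n, rfl⟩ := hμ.resMk_surjective hI (m + 1) x
  rw [resD_mk, resMk_eq_zero]
  constructor
  · intro hn
    exact ⟨hμ.resMk hI (m + 2) ⟨n, hn⟩, hμ.resD_mk hI (m + 1) ⟨n, hn⟩⟩
  · rintro ⟨y, hy⟩
    obtain ⟨z, rfl⟩ := hμ.resMk_surjective hI (m + 2) y
    rw [resD_mk, ← sub_eq_zero, ← map_sub, resMk_eq_zero] at hy
    have := sub_mem z.2 (hμ.chain_succ_le (m + 2) hy)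
    rwa [Submodule.coe_sub, sub_sub_cancel] at this

theorem resD_exact_aug : Function.Exact (hμ.resD hI 0) (hμ.resAug hI) := by
  intro x
  obtain ⟨n, rfl⟩ := hμ.resMk_surjective hI 0 x
  rw [resAug_mk]
  -- The kernel of `T(V) → R` is `J = N_1`.
  refine hμ.mem_J_iff.symm.trans ?_
  constructor
  · intro hn
    exact ⟨hμ.resMk hI 1 ⟨n, hn⟩, hμ.resD_mk hI 0 ⟨n, hn⟩⟩
  · rintro ⟨y, hy⟩
    obtain ⟨z, rfl⟩ := hμ.resMk_surjective hI 1 y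
    rw [resD_mk, ← sub_eq_zero, ← map_sub, resMk_eq_zero] at hy
    have := sub_mem z.2 (hμ.chain_succ_le 1 hy)
    rwa [Submodule.coe_sub, sub_sub_cancel] at this

/-- The resolution of `R` with terms `N_m / I N_m`. -/
def res (hR : IsSeparableAlg k R) : GrProjRes.{u, v, v, max u v w} (resL h) where
  X := hμ.resX hI
  d := hμ.resD hI
  aug := hμ.resAug hI
  d_gr m := hμ.isGrHom_of_idealMk _ _ _ (hμ.resD hI m) fun i n hn => by
    have := hμ.resMk_mem_deg hI (m := m) (n := ⟨n, hμ.chain_succ_le m n.2⟩) hn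
    rw [← hμ.resD_mk] at this
    exact this
  aug_gr := hμ.isGrHom_of_idealMk _ _ _ (hμ.resAug hI) fun i n hn => by
    have h1 : π (μ n) ∈ trivGr k R i := h.proj_mem i _ (hμ.map_mem i _ hn)
    have h2 := hμ.resAug_mk hI n
    exact (congrArg (· ∈ trivGr k R i) h2).mpr h1
  projective m := hμ.projective_idealQuot _ _ _ hR le_rfl
  exact := hμ.resD_exact hI
  exact_aug := hμ.resD_exact_aug hI
  surjective_aug r := by
    refine ⟨hμ.resMk hI 0 ⟨TRing.incl V r, trivial⟩, (hμ.resAug_mk hI _).trans ?_⟩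
    exact (congrArg π (hμ.map_incl _)).trans (h.proj_incl _)

variable {S : Ideal (TRing V)} (hS : IsGrIdeal (TRing.deg V) S)

/-- A homogeneous ideal contained in `N_m`, mapped to `N_m / I N_m`. -/
def resIncl {m : ℕ} (hSN : S ≤ hμ.chain m) :
    ((TRing.toBimod V).sub (Ideal.toBimod (TRing.incl V) (TRing.incl_mem_deg V) S hS)
      hS.homogeneous).carrier →ₗ[Env k R R] ((hμ.resX hI m).restrictLeft h).carrier where
  toFun z := hμ.resMk hI m ⟨z.1, hSN z.2⟩
  map_add' x y := (hμ.resMk hI m).map_add ⟨x.1, hSN x.2⟩ ⟨y.1, hSN y.2⟩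
  map_smul' e z := by
    let g : S →ₗ[k] (hμ.resX hI m).carrier :=
      hμ.resMk hI m ∘ₗ (Submodule.inclusion hSN).restrictScalars k
    let B := (TRing.toBimod V).sub (Ideal.toBimod (TRing.incl V) (TRing.incl_mem_deg V) S hS)
      hS.homogeneous
    let g' : B.carrier →ₗ[k] (hμ.resX hI m).carrier :=
      { toFun := fun z => g ⟨z.1, z.2⟩
        map_add' := fun x y => g.map_add ⟨x.1, x.2⟩ ⟨y.1, y.2⟩
        map_smul' := fun c x => g.map_smul c ⟨x.1, x.2⟩ }
    change g' (e • z) = envLeft R f e • g' z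
    induction e using TensorProduct.induction_on with
    | zero =>
      rw [map_zero]
      refine (congrArg g' (zero_smul (Env k R R) z)).trans ((map_zero g').trans ?_)
      exact (zero_smul (Env k A R) (g' z)).symm
    | add e e' he he' =>
      rw [map_add]
      refine (congrArg g' (add_smul e e' z)).trans ((map_add g' _ _).trans ?_)
      rw [he, he', add_smul]
    | tmul r s =>
      obtain ⟨s, rfl⟩ := op_surjective s
      rw [envLeft_tmul, ← hμ.map_incl]
      let z' : B.carrier := (r ⊗ₜ[k] op s : Env k R R) • z
      exact hμ.idealMk_smul _ _ _ (TRing.incl V r) s ⟨z.1, hSN z.2⟩ ⟨z'.1, hSN z'.2⟩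
        (TRing.smul_toBimod r s z.1)

theorem isGrHom_resIncl {m : ℕ} (hSN : S ≤ hμ.chain m) : GrMod.IsGrHom (hμ.resIncl hI hS hSN) :=
  fun _ z hz => hμ.resMk_mem_deg hI (n := ⟨z.1, hSN z.2⟩) hz

end Resolution
end IsAugmentation.IsPresentation

/-! ### `Tor` of an algebra with a tensor presentation. -/

namespace TensorPresentation

variable {k : Type u} [Field k] {A : Type v} [Ring A] [Algebra k A]
  {𝒜 : ℤ → Submodule k A} [GradedAlgebra 𝒜] [SeparablyAugmented 𝒜]
  (T : TensorPresentation.{u, v, w} 𝒜)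

theorem isPresentation : (SeparablyAugmented.isAugmentation 𝒜).IsPresentation T.map where
  pos := T.pos
  map_incl := T.map_incl
  map_mem := T.map_mem
  surjective := T.surjective

/-- The resolution of `R` with terms `T/I, J/IJ, I/I², IJ/I²J, …`. -/
def res : GrProjRes.{u, v, v, max u v w} (resAR 𝒜) :=
  T.isPresentation.res T.isGrIdeal_I SeparablyAugmented.separable

theorem isGrIdeal_chain (m : ℕ) : IsGrIdeal (TRing.deg T.V) (idealChain T.I T.J m) :=
  isGrIdeal_idealChain T.isGrIdeal_I (TRing.isGrIdeal_J T.V) m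

/-- As `I ⊆ J`, applying `R ⊗_A -` to the resolution gives the terms `N_m / J N_m`. A class of
`N_{m+1}` is a cycle when it lies in `J N_m`, and a boundary when it lies in `N_{m+2} + J N_{m+1}`.
-/
theorem tor_res_isomorphic (m : ℕ) : (Tor T.res (m + 1)).Isomorphic
    (TRing.idealQuot T.V (idealChain T.I T.J (m + 1) ⊓ T.J * idealChain T.I T.J m)
      (T.J * idealChain T.I T.J (m + 1) ⊔ idealChain T.I T.J (m + 2))
      ((T.isGrIdeal_chain (m + 1)).inf ((TRing.isGrIdeal_J T.V).mul (T.isGrIdeal_chain m)))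
      (((TRing.isGrIdeal_J T.V).mul (T.isGrIdeal_chain (m + 1))).sup
        (T.isGrIdeal_chain (m + 2)))) := by
  have hS := (T.isGrIdeal_chain (m + 1)).inf ((TRing.isGrIdeal_J T.V).mul (T.isGrIdeal_chain m))
  have hμ := T.isPresentation
  have hI : IsGrIdeal (TRing.deg T.V) (RingHom.ker T.map) := T.isGrIdeal_I
  have hD := ((TRing.isGrIdeal_J T.V).mul (T.isGrIdeal_chain (m + 1))).sup (T.isGrIdeal_chain (m + 2))
  have hDh : (TRing.toBimod T.V).IsHomogeneous
    (Ideal.toBimod (TRing.incl T.V) (TRing.incl_mem_deg T.V) _ hD) := hD.homogeneous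
  refine tor_isomorphic_quot T.res (m + 1) _ (GrMod.isHomogeneous_comap
    (GrMod.subIncl (TRing.toBimod T.V) (Ideal.toBimod (TRing.incl T.V) (TRing.incl_mem_deg T.V) _ hS)
      hS.homogeneous) (fun _ _ hx => hx) hDh) (hμ.resIncl hI hS inf_le_left)
    (hμ.isGrHom_resIncl hI hS inf_le_left) (fun z => ?_) (fun x hx => ?_) (fun z => ?_)
  · refine (torOne_mem_torCycles_succ T.res _).2 ?_
    have h1 := hμ.resD_mk hI m ⟨z.1, z.2.1⟩
    exact h1 ▸ (hμ.resMk_mem_positivePart hI).2 z.2.2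
  · obtain ⟨n, rfl⟩ := hμ.resMk_surjective hI (m + 1) x
    have h1 := (torOne_mem_torCycles_succ T.res _).1 hx
    have h2 := (hμ.resMk_mem_positivePart hI).1 ((hμ.resD_mk hI m n) ▸ h1)
    refine ⟨⟨n.1, n.2, h2⟩, ?_⟩
    have h3 : hμ.resMk hI (m + 1) n - hμ.resMk hI (m + 1) n = 0 := sub_self _
    exact h3 ▸ zero_mem _
  · have key : ∀ n : hμ.chain (m + 2),
        hμ.resMk hI (m + 1) ⟨z.1, z.2.1⟩ - hμ.resD hI (m + 1) (hμ.resMk hI (m + 2) n)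
          ∈ (hμ.resX hI (m + 1)).positivePart
        ↔ (show TRing T.V from z.1) - n ∈ T.J * idealChain T.I T.J (m + 1) := fun n => by
      rw [hμ.resD_mk, ← map_sub]
      exact hμ.resMk_mem_positivePart hI
    constructor
    · rintro ⟨y, hy⟩
      obtain ⟨n, rfl⟩ := hμ.resMk_surjective hI (m + 2) y
      have h1 := (key n).1 hy
      have h2 := add_mem (Ideal.mem_sup_left h1) (Ideal.mem_sup_right n.2)
      rw [sub_add_cancel] at h2
      exact h2
    · intro hz
      have hz' : (show TRing T.V from z.1) ∈
        T.J * idealChain T.I T.J (m + 1) ⊔ idealChain T.I T.J (m + 2) := hz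
      obtain ⟨a, ha, n, hn, han⟩ := Submodule.mem_sup.1 hz'
      refine ⟨hμ.resMk hI (m + 2) ⟨n, hn⟩, (key ⟨n, hn⟩).2 ?_⟩
      rw [← han, add_sub_cancel_right]
      exact ha

theorem idealQuot_congr {N N' D D' : Ideal (TRing T.V)} (h₁ : N = N') (h₂ : D = D')
    (hN : IsGrIdeal (TRing.deg T.V) N) (hD : IsGrIdeal (TRing.deg T.V) D)
    (hN' : IsGrIdeal (TRing.deg T.V) N') (hD' : IsGrIdeal (TRing.deg T.V) D') :
    TRing.idealQuot T.V N D hN hD = TRing.idealQuot T.V N' D' hN' hD' := by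
  subst h₁ h₂
  rfl

theorem tor_even (Q : GrProjRes.{u, v, v, w₂} (resAR 𝒜)) (p : ℕ) :
    (Tor Q (2 * (p + 1))).Isomorphic
      (TRing.evenQuot T.isGrIdeal_I (TRing.isGrIdeal_J T.V) p) := by
  have hI := T.isGrIdeal_I.twoSided
  -- Here `N_{2p+2} = I^{p+1}`, `N_{2p+1} = I^p J` and `N_{2p+3} = I^{p+1} J`.
  have h1 := T.tor_res_isomorphic (2 * p + 1)
  refine (tor_isomorphic Q T.res _).trans ?_
  rw [T.idealQuot_congr (N' := T.I ^ (p + 1) ⊓ T.J * T.I ^ p * T.J)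
    (D' := T.J * T.I ^ (p + 1) ⊔ T.I ^ (p + 1) * T.J)] at h1
  · exact h1
  · rw [show 2 * p + 1 + 1 = 2 * (p + 1) from rfl, idealChain_even, idealChain_odd, mul_assoc]
  · rw [show 2 * p + 1 + 1 = 2 * (p + 1) from rfl,
      show 2 * p + 1 + 2 = 2 * (p + 1) + 1 from rfl, idealChain_even, idealChain_odd]

theorem tor_odd (Q : GrProjRes.{u, v, v, w₂} (resAR 𝒜)) (p : ℕ) :
    (Tor Q (2 * p + 1)).Isomorphic
      (TRing.oddQuot T.isGrIdeal_I (TRing.isGrIdeal_J T.V) p) := by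
  have hI := T.isGrIdeal_I.twoSided
  -- Here `N_{2p+1} = I^p J`, `N_{2p} = I^p` and `N_{2p+2} = I^{p+1}`.
  have h1 := T.tor_res_isomorphic (2 * p)
  refine (tor_isomorphic Q T.res _).trans ?_
  rw [T.idealQuot_congr (N' := T.J * T.I ^ p ⊓ T.I ^ p * T.J)
    (D' := T.I ^ (p + 1) ⊔ T.J * T.I ^ p * T.J)] at h1
  · exact h1
  · rw [idealChain_even, idealChain_odd, inf_comm]
  · rw [show 2 * p + 2 = 2 * (p + 1) from rfl, idealChain_even, idealChain_odd, sup_comm, mul_assoc]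

end TensorPresentation
end

theorem mainTheorem7 {k : Type u} [Field k] [IsAlgClosed k] {A : Type v} [Ring A] [Algebra k A]
    (𝒜 : ℤ → Submodule k A) [GradedAlgebra 𝒜] [SeparablyAugmented 𝒜] :
    (∃ P : GrProjRes.{u, v, v, v} (diagBimod 𝒜), P.IsMinimal) ∧
    Nonempty (GrProjRes.{u, v, v, v} (resAR 𝒜)) ∧
    (∀ P : GrProjRes.{u, v, v, w₁} (diagBimod 𝒜), P.IsMinimal →
      ∀ (Q : GrProjRes.{u, v, v, w₂} (resAR 𝒜)) (m : ℕ),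
        (P.X m).Isomorphic (tens (tens (bimodAR 𝒜) (Tor Q m)) (bimodRA 𝒜))) ∧
    (∀ T : TensorPresentation.{u, v, w₃} 𝒜,
      (∃ n ≥ 2, T.J ^ n ≤ T.I) → T.I ≤ T.J ^ 2 →
      ∀ (Q : GrProjRes.{u, v, v, w₂} (resAR 𝒜)) (p : ℕ),
        (Tor Q (2 * (p + 1))).Isomorphic (TRing.evenQuot T.isGrIdeal_I (TRing.isGrIdeal_J T.V) p) ∧
        (Tor Q (2 * p + 1)).Isomorphic (TRing.oddQuot T.isGrIdeal_I (TRing.isGrIdeal_J T.V) p)) := by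
  exact ⟨exists_minimal_diagBimod 𝒜, nonempty_grProjRes_resAR 𝒜,
    fun P hP Q m => hP.isomorphic_tens_tor Q m, fun T _ _ Q p => ⟨T.tor_even Q p, T.tor_odd Q p⟩⟩
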